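/- Let $N\ge 1$ and, for $d\ge N$, let $P_{d,N}$ be the orthogonal projector of $(\mathbb C^d)^{\otimes N}$ onto the antisymmetric subspace (the vectors that are multiplied by $\operatorname{sgn}\pi$ under every permutation $\pi$ of the $N$ parties), and let $\rho_{d,N}=P_{d,N}/\operatorname{tr}P_{d,N}$. All logarithms are to base $2$. For a state $\rho$ on $\mathcal H_1\otimes\cdots\otimes\mathcal H_N$ let $\mathrm{SEP}$ be the set of fully separable states (convex combinations of tensor products of $N$ single-party states), and put $$\Lambda^2(\rho)=\max_{\sigma\in\mathrm{SEP}}\operatorname{tr}(\rho\sigma),\qquad G(\rho)=-2\log\Lambda(\rho),\qquad E_R(\rho)=\min_{\sigma\in\mathrm{SEP}}\operatorname{tr}\rho(\log\rho-\log\sigma),$$ $$R_L(\rho)=\log(1+R_g(\rho)),\qquad R_g(\rho)=\min\Bigl\{t\ge 0:\ \tfrac{\rho+t\Delta}{1+t}\in\mathrm{SEP}\text{ for some state }\Delta\Bigr\},$$ where the relative entropy in $E_R$ is $+\infty$ unless $\ker\sigma\subseteq\ker\rho$. A closest product state of $\rho$ is a unit product vector $|\varphi\rangle=|a_1\rangle\otimes\cdots\otimes|a_N\rangle$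 with $\langle\varphi|\rho|\varphi\rangle=\Lambda^2(\rho)$. A tensor product of several $N$-partite states is regarded as an $N$-partite state, the $k$-th party holding the $k$-th particles of all factors. Then the following hold. 1. For all $n$ and all $d_1,\dots,d_n\ge N$, $$R_L\Bigl(\bigotimes_{j=1}^n\rho_{d_j,N}\Bigr)=E_R\Bigl(\bigotimes_{j=1}^n\rho_{d_j,N}\Bigr)=G\Bigl(\bigotimes_{j=1}^n\rho_{d_j,N}\Bigr)-\sum_{j=1}^n\log\operatorname{tr}P_{d_j,N}.$$ 2. For $d\ge N$ the limits $E^\infty(\rho_{d,N})=\lim_{n\to\infty}\frac1nE(\rho_{d,N}^{\otimes n})$ exist for $E=R_L,E_R,G$, are finite, and satisfy $R_L^\infty(\rho_{d,N})=E_R^\infty(\rho_{d,N})=G^\infty(\rho_{d,N})-\log\operatorname{tr}P_{d,N}$. 3. For $d\ge N$, $\operatorname{tr}P_{d,N}=\binom dN$ and $$R_L(\rho_{d,N})=E_R(\rho_{d,N})=G(\rho_{d,N})-\log\operatorname{tr}P_{d,N}=\log N!,$$ $$R_L(\rho_{d,N}^{\otimes2})=E_R(\rho_{d,N}^{\otimes2})=G(\rho_{d,N}^{\otimes2})-2\log\operatorname{tr}P_{d,N}=\log\frac{d^N\,N!\,(d-N)!}{d!}.$$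 4. For $d\ge N$, a vector is a closest product state of $\rho_{d,N}$ if and only if it is a tensor product $|a_1\rangle\otimes\cdots\otimes|a_N\rangle$ of orthonormal single-particle states. 5. For $d\ge N$ and every maximally entangled state $|\psi\rangle\in\mathbb C^d\otimes\mathbb C^d$ (one whose reduced states are $I/d$), the product $|\psi\rangle^{\otimes N}$, in which each party holds one copy of $|\psi\rangle$ shared between its two particles, is a closest product state of $\rho_{d,N}^{\otimes2}$. If $N\ge3$, every closest product state of $\rho_{d,N}^{\otimes2}$ is of this form. -/

import Mathlib

open scoped ComplexOrder

noncomputable section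

namespace Multipartite

/-! An `N`-partite quantum system whose parties all have the single-particle Hilbert space
`ℂ^ι = EuclideanSpace ℂ ι` has the joint Hilbert space `EuclideanSpace ℂ (Fin N → ι)`, the
computational basis being indexed by `x : Fin N → ι`. Operators are matrices in this basis. -/

/-- A (mixed) quantum state: a positive semidefinite matrix of trace one. -/
def IsState {α : Type*} [Fintype α] (ρ : Matrix α α ℂ) : Prop :=
  ρ.PosSemidef ∧ ρ.trace = 1

/-- The product vector `|a₁⟩ ⊗ ⋯ ⊗ |a_N⟩`. -/
def productVector {N : ℕ} {ι : Type*} [Fintype ι] (a : Fin N → EuclideanSpace ℂ ι) :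
    EuclideanSpace ℂ (Fin N → ι) :=
  WithLp.toLp 2 fun x => ∏ k, a k (x k)

/-- The tensor product `A₁ ⊗ ⋯ ⊗ A_N` of single-particle operators. -/
def productMatrix {N : ℕ} {ι : Type*} (A : Fin N → Matrix ι ι ℂ) :
    Matrix (Fin N → ι) (Fin N → ι) ℂ :=
  Matrix.of fun x y => ∏ k, A k (x k) (y k)

/-- The set `SEP` of fully separable states: convex mixtures of products of single-particle
states. -/
def separableStates (N : ℕ) (ι : Type*) [Fintype ι] : Set (Matrix (Fin N → ι) (Fin N → ι) ℂ) :=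
  convexHull ℝ {σ | ∃ A : Fin N → Matrix ι ι ℂ, (∀ k, IsState (A k)) ∧ σ = productMatrix A}

/-- The set `PRO` of fully product pure states, represented by unit vectors. -/
def productStates (N : ℕ) (ι : Type*) [Fintype ι] : Set (EuclideanSpace ℂ (Fin N → ι)) :=
  {φ | ∃ a : Fin N → EuclideanSpace ℂ ι, (∀ k, ‖a k‖ = 1) ∧ φ = productVector a}

/-- The expectation value `⟨φ|ρ|φ⟩`. -/
def expectation {α : Type*} [Fintype α] (ρ : Matrix α α ℂ) (φ : EuclideanSpace ℂ α) : ℝ :=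
  (star φ.ofLp ⬝ᵥ (ρ.mulVec φ.ofLp)).re

section Measures

variable {N : ℕ} {ι : Type*} [Fintype ι] [DecidableEq ι]

/-- `Λ²(ρ) = max_{σ ∈ SEP} tr(ρσ)`. -/
def maxOverlapSq (ρ : Matrix (Fin N → ι) (Fin N → ι) ℂ) : ℝ :=
  sSup ((fun σ => (ρ * σ).trace.re) '' separableStates N ι)

/-- The geometric measure `G(ρ) = -2 log₂ Λ(ρ)`. -/
def geometricMeasure (ρ : Matrix (Fin N → ι) (Fin N → ι) ℂ) : ℝ :=
  -2 * Real.logb 2 (Real.sqrt (maxOverlapSq ρ))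

/-- `φ` is a closest product state of `ρ`: a pure product state attaining `Λ²(ρ)`. -/
def IsClosestProductState (ρ : Matrix (Fin N → ι) (Fin N → ι) ℂ)
    (φ : EuclideanSpace ℂ (Fin N → ι)) : Prop :=
  φ ∈ productStates N ι ∧ expectation ρ φ = maxOverlapSq ρ

/-- The base-2 logarithm of a positive semidefinite matrix, by functional calculus. It is zero on
the kernel (`Real.logb 2 0 = 0`), the usual convention in the relative entropy. -/
def matrixLog {α : Type*} [Fintype α] [DecidableEq α] (A : Matrix α α ℂ) : Matrix α α ℂ :=
  cfc (Real.logb 2) A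

open Classical in
/-- The quantum relative entropy `S(ρ‖σ) = tr ρ (log₂ ρ - log₂ σ)`, which is `+∞` unless the
kernel of `σ` is contained in the kernel of `ρ`. -/
def relativeEntropy {α : Type*} [Fintype α] [DecidableEq α] (ρ σ : Matrix α α ℂ) : EReal :=
  if ∀ v : α → ℂ, σ.mulVec v = 0 → ρ.mulVec v = 0 then
    (((ρ * (matrixLog ρ - matrixLog σ)).trace.re : ℝ) : EReal)
  else ⊤

/-- The relative entropy of entanglement `E_R(ρ) = min_{σ ∈ SEP} S(ρ‖σ)`. -/
def relativeEntropyOfEntanglement (ρ : Matrix (Fin N → ι) (Fin N → ι) ℂ) : EReal :=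
  ⨅ σ ∈ separableStates N ι, relativeEntropy ρ σ

/-- The global robustness `R_g(ρ)`: the least `t ≥ 0` such that `(ρ + tΔ)/(1 + t)` is separable
for some state `Δ`. -/
def globalRobustness (ρ : Matrix (Fin N → ι) (Fin N → ι) ℂ) : ℝ :=
  sInf {t : ℝ | 0 ≤ t ∧ ∃ Δ : Matrix (Fin N → ι) (Fin N → ι) ℂ, IsState Δ ∧
    (1 + t)⁻¹ • (ρ + t • Δ) ∈ separableStates N ι}

/-- The logarithmic global robustness `R_L(ρ) = log₂ (1 + R_g(ρ))`. -/
def logGlobalRobustness (ρ : Matrix (Fin N → ι) (Fin N → ι) ℂ) : ℝ :=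
  Real.logb 2 (1 + globalRobustness ρ)

end Measures

/-- The tensor product `⨂ⱼ ρⱼ` of `N`-partite states, regarded as an `N`-partite state: the `k`-th
party holds the `k`-th particles of all the factors, so its local basis is `∀ j, ι j`. -/
def tensorState {N n : ℕ} {ι : Fin n → Type*}
    (ρ : ∀ j, Matrix (Fin N → ι j) (Fin N → ι j) ℂ) :
    Matrix (Fin N → ∀ j, ι j) (Fin N → ∀ j, ι j) ℂ :=
  Matrix.of fun x y => ∏ j, ρ j (fun k => x k j) (fun k => y k j)

/-- `ρ^{⊗n}` as an `N`-partite state. -/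
def copies {N : ℕ} {ι : Type*} (n : ℕ) (ρ : Matrix (Fin N → ι) (Fin N → ι) ℂ) :
    Matrix (Fin N → Fin n → ι) (Fin N → Fin n → ι) ℂ :=
  tensorState fun _ : Fin n => ρ

/-- The antisymmetric subspace of `(ℂ^d)^{⊗N}`: permuting the parties by `π` multiplies the vector
by the sign of `π`. -/
def antisymmetricSubspace (d N : ℕ) : Submodule ℂ (EuclideanSpace ℂ (Fin N → Fin d)) where
  carrier := {ψ | ∀ (π : Equiv.Perm (Fin N)) (x : Fin N → Fin d),
    ψ (x ∘ π) = ((Equiv.Perm.sign π : ℤ) : ℂ) * ψ x}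
  add_mem' := by
    intro ψ χ hψ hχ π x
    simp only [PiLp.add_apply, hψ π x, hχ π x, mul_add]
  zero_mem' := by
    intro π x
    simp
  smul_mem' := by
    intro c ψ hψ π x
    simp only [PiLp.smul_apply, hψ π x, smul_eq_mul]
    ring

/-- `P_{d,N}`, the matrix of the orthogonal projector onto the antisymmetric subspace. -/
def antisymmetricProjector (d N : ℕ) : Matrix (Fin N → Fin d) (Fin N → Fin d) ℂ :=
  (Matrix.toEuclideanCLM (n := Fin N → Fin d) (𝕜 := ℂ)).symm
    (antisymmetricSubspace d N).starProjection

/-- The antisymmetric projector state `ρ_{d,N} = P_{d,N} / tr P_{d,N}`. -/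
def antisymmetricProjectorState (d N : ℕ) : Matrix (Fin N → Fin d) (Fin N → Fin d) ℂ :=
  ((antisymmetricProjector d N).trace)⁻¹ • antisymmetricProjector d N

/-- The reduced state on the first factor of the pure state `ψ ∈ ℂ^d ⊗ ℂ^d`. -/
def reducedStateFirst {d : ℕ} (ψ : EuclideanSpace ℂ (Fin 2 → Fin d)) :
    Matrix (Fin d) (Fin d) ℂ :=
  Matrix.of fun a a' => ∑ b, ψ ![a, b] * star (ψ ![a', b])

/-- `ψ ∈ ℂ^d ⊗ ℂ^d` is maximally entangled: its reduced state is the maximally mixed state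
`I / d`. -/
def IsMaximallyEntangled {d : ℕ} (ψ : EuclideanSpace ℂ (Fin 2 → Fin d)) : Prop :=
  reducedStateFirst ψ = (d : ℂ)⁻¹ • (1 : Matrix (Fin d) (Fin d) ℂ)

end Multipartite

end

/-! Write `Q` for the tensor product of the antisymmetric projectors, `t = tr Q`, `ρ = Q / t`, and
`b = Λ²(ρ)`. All three measures reduce to `b`, and `b` is then computed for one and two copies.

Collapse of the measures. If `σ` is separable and `σ Q = c Q`, then `σ - c Q ≥ 0`, so `σ` serves as
a witness for the robustness with value `1/(tc) - 1`, and its relative entropy is exactly `-log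
(tc)`. Conversely, `tr ρσ ≤ b` on `SEP` gives `1 + R_g ≥ 1/(tb)`, and concavity of the logarithm
gives `S(ρ‖σ) ≥ -log (tb)`. Hence both measures equal `-log (tb) = G - log t` as soon as every
separable `σ` can be replaced by a separable `σ'` with `σ' Q = tr(ρσ) Q` (`measures_eq_of_twirl`).
The replacement is an average over a finite group: all parties apply the same signed permutation
matrix in each factor. Sign and permutation invariance alone force an averaged operator to act as a
scalar on the range of `Q` (`IsMonomialInvariant.proportional`, `twirl_mul_tensorAntisymmetrizer`).
Existence of the limits follows from Fekete's lemma, since `Λ²` is supermultiplicative.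

One copy. On a product vector the antisymmetrizer has expectation `det (Gram) / N!`; Hadamard's
inequality bounds the determinant by `1`, with equality exactly for orthonormal vectors.

Two copies. A local vector in `ℂ^d ⊗ ℂ^d` is a matrix `A k`, and the expectation of `P ⊗ P` is the
squared Hilbert–Schmidt norm of `P (A 1 ⊗ ⋯ ⊗ A N) P`. This is bounded by adding one particle at a
time. With fermionic creation and annihilation operators, the product with `A` is `∑ A i j • a_i† M
a_j`; the anticommutation relations express its norm through contractions of `M`
(`frobeniusSq_wedgeOp_succ`), and Cauchy–Schwarz with the duality between product and contraction
closes an induction with the sharp constant (`frobeniusSq_wedgeOp_le`). Equality for `d ≥ 3`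
propagates down to a pair of matrices and makes them proportional to each other and to a unitary. -/

noncomputable section

namespace Multipartite

open Matrix

/-! ### Product operators, separable states, and linear functionals on them -/

section Separable

variable {N : ℕ} {ι : Type*}

theorem productMatrix_apply (A : Fin N → Matrix ι ι ℂ) (x y : Fin N → ι) :
    productMatrix A x y = ∏ k, A k (x k) (y k) := rfl

theorem productVector_apply [Fintype ι] (a : Fin N → EuclideanSpace ℂ ι) (x : Fin N → ι) :
    productVector a x = ∏ k, a k (x k) := rfl

theorem conjTranspose_productMatrix (A : Fin N → Matrix ι ι ℂ) :
    (productMatrix A)ᴴ = productMatrix fun k => (A k)ᴴ := by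
  ext x y
  simp [productMatrix_apply, conjTranspose_apply]

variable [Fintype ι]

theorem prod_sum_eq_sum_prod {κ R : Type*} [Fintype κ] [DecidableEq κ] [CommSemiring R]
    (f : κ → ι → R) : ∏ k, ∑ i, f k i = ∑ x : κ → ι, ∏ k, f k (x k) := by
  rw [Finset.prod_univ_sum, Fintype.piFinset_univ]

theorem productMatrix_mul (A B : Fin N → Matrix ι ι ℂ) :
    productMatrix A * productMatrix B = productMatrix fun k => A k * B k := by
  ext x y
  simp [productMatrix_apply, Matrix.mul_apply, prod_sum_eq_sum_prod, Finset.prod_mul_distrib]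

theorem trace_productMatrix (A : Fin N → Matrix ι ι ℂ) :
    (productMatrix A).trace = ∏ k, (A k).trace := by
  simp [productMatrix_apply, Matrix.trace, prod_sum_eq_sum_prod]

theorem convex_setOf_isState : Convex ℝ {σ : Matrix ι ι ℂ | IsState σ} := by
  intro σ hσ τ hτ a b ha hb hab
  refine ⟨(hσ.1.smul ha).add (hτ.1.smul hb), ?_⟩
  rw [trace_add, trace_smul, trace_smul, hσ.2, hτ.2, ← add_smul, hab, one_smul]

theorem isState_vecMulVec {v : EuclideanSpace ℂ ι} (hv : ‖v‖ = 1) :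
    IsState (vecMulVec v.ofLp (star v.ofLp)) := by
  refine ⟨posSemidef_vecMulVec_self_star _, ?_⟩
  have := EuclideanSpace.inner_eq_star_dotProduct v v
  rw [inner_self_eq_norm_sq_to_K, hv] at this
  simpa [trace_vecMulVec] using this.symm

theorem expectation_eq_trace_re (ρ : Matrix ι ι ℂ) (φ : EuclideanSpace ℂ ι) :
    expectation ρ φ = (ρ * vecMulVec φ.ofLp (star φ.ofLp)).trace.re := by
  rw [expectation, mul_vecMulVec, trace_vecMulVec, dotProduct_comm]

theorem vecMulVec_productVector (a : Fin N → EuclideanSpace ℂ ι) :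
    vecMulVec (productVector a).ofLp (star (productVector a).ofLp) =
      productMatrix fun k => vecMulVec (a k).ofLp (star (a k).ofLp) := by
  ext x y
  simp [productMatrix_apply, vecMulVec_apply, productVector_apply, Finset.prod_mul_distrib]

theorem vecMulVec_mem_separableStates {φ : EuclideanSpace ℂ (Fin N → ι)}
    (hφ : φ ∈ productStates N ι) :
    vecMulVec φ.ofLp (star φ.ofLp) ∈ separableStates N ι := by
  obtain ⟨a, ha, rfl⟩ := hφ
  exact subset_convexHull _ _
    ⟨_, fun k => isState_vecMulVec (ha k), vecMulVec_productVector a⟩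

variable [DecidableEq ι]

theorem posSemidef_productMatrix {A : Fin N → Matrix ι ι ℂ} (hA : ∀ k, (A k).PosSemidef) :
    (productMatrix A).PosSemidef := by
  have h : ∀ k, ∃ B : Matrix ι ι ℂ, A k = Bᴴ * B := fun k => by
    open scoped MatrixOrder in
    exact CStarAlgebra.nonneg_iff_eq_star_mul_self.mp (Matrix.nonneg_iff_posSemidef.mpr (hA k))
  choose B hB using h
  have : productMatrix A = (productMatrix B)ᴴ * productMatrix B := by
    rw [conjTranspose_productMatrix, productMatrix_mul]
    congr 1
    exact funext hB
  rw [this]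
  exact posSemidef_conjTranspose_mul_self _

theorem IsState.productMatrix {A : Fin N → Matrix ι ι ℂ} (hA : ∀ k, IsState (A k)) :
    IsState (productMatrix A) :=
  ⟨posSemidef_productMatrix fun k => (hA k).1, by
    rw [trace_productMatrix]; exact Finset.prod_eq_one fun k _ => (hA k).2⟩

theorem isState_of_mem_separableStates {σ : Matrix (Fin N → ι) (Fin N → ι) ℂ}
    (hσ : σ ∈ separableStates N ι) : IsState σ := by
  refine convexHull_min ?_ convex_setOf_isState hσ
  rintro _ ⟨A, hA, rfl⟩
  exact IsState.productMatrix hA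

theorem IsState.exists_eq_sum_vecMulVec {A : Matrix ι ι ℂ} (hA : IsState A) :
    ∃ (p : ι → ℝ) (v : ι → EuclideanSpace ℂ ι), (∀ i, 0 ≤ p i) ∧ ∑ i, p i = 1 ∧
      (∀ i, ‖v i‖ = 1) ∧ ∀ x y, A x y = ∑ i, (p i : ℂ) * (v i x * star (v i y)) := by
  have hH := hA.1.isHermitian
  refine ⟨hH.eigenvalues, hH.eigenvectorBasis, hA.1.eigenvalues_nonneg, ?_,
    hH.eigenvectorBasis.orthonormal.1, fun x y => ?_⟩
  · have := hA.2
    rw [hH.trace_eq_sum_eigenvalues] at this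
    exact Complex.ofReal_injective (by push_cast; exact this)
  · have := congrFun (congrFun hH.spectral_theorem x) y
    rw [this, Unitary.conjStarAlgAut_apply, Matrix.mul_apply]
    refine Finset.sum_congr rfl fun i _ => ?_
    rw [mul_diagonal, star_apply, IsHermitian.eigenvectorUnitary_apply,
      IsHermitian.eigenvectorUnitary_apply]
    simp only [Function.comp_apply, Complex.coe_algebraMap]
    ring

/-- The spectral decomposition of each local state turns a product state into a mixture of pure
product states, so a linear functional on `SEP` is controlled by its values on product vectors. -/
theorem trace_mul_re_le_of_mem_separableStates {ρ : Matrix (Fin N → ι) (Fin N → ι) ℂ} {b : ℝ}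
    (h : ∀ φ ∈ productStates N ι, expectation ρ φ ≤ b)
    {σ : Matrix (Fin N → ι) (Fin N → ι) ℂ} (hσ : σ ∈ separableStates N ι) :
    (ρ * σ).trace.re ≤ b := by
  have hconv : Convex ℝ {σ : Matrix (Fin N → ι) (Fin N → ι) ℂ | (ρ * σ).trace.re ≤ b} := by
    intro σ hσ τ hτ s t hs ht hst
    simp only [Set.mem_ofPred_eq, mul_add, Matrix.mul_smul, trace_add, trace_smul, Complex.add_re,
      Complex.real_smul, Complex.re_ofReal_mul] at *
    calc _ ≤ s * b + t * b := by gcongr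
      _ = b := by rw [← add_mul, hst, one_mul]
  refine convexHull_min ?_ hconv hσ
  rintro _ ⟨A, hA, rfl⟩
  choose p v hp hp1 hv hpv using fun k => (hA k).exists_eq_sum_vecMulVec
  have hdec : productMatrix A = ∑ f : Fin N → ι, ((∏ k, p k (f k) : ℝ) : ℂ) •
      vecMulVec (productVector fun k => v k (f k)).ofLp
        (star (productVector fun k => v k (f k)).ofLp) := by
    ext x y
    simp only [productMatrix_apply, hpv, prod_sum_eq_sum_prod, Matrix.sum_apply, Matrix.smul_apply,
      vecMulVec_apply, Pi.star_apply, productVector_apply, Finset.prod_mul_distrib, star_prod,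
      smul_eq_mul, Complex.ofReal_prod]
  have hsum : ∑ f : Fin N → ι, ∏ k, p k (f k) = 1 := by
    rw [← prod_sum_eq_sum_prod]
    exact Finset.prod_eq_one fun k _ => hp1 k
  rw [Set.mem_ofPred_eq, hdec, Finset.mul_sum, trace_sum, Complex.re_sum, ← one_mul b, ← hsum,
    Finset.sum_mul]
  refine Finset.sum_le_sum fun f _ => ?_
  rw [Matrix.mul_smul, trace_smul, smul_eq_mul, Complex.re_ofReal_mul, ← expectation_eq_trace_re]
  exact mul_le_mul_of_nonneg_left (h _ ⟨_, fun k => hv k (f k), rfl⟩)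
    (Finset.prod_nonneg fun k _ => hp k _)

theorem maxOverlapSq_eq_of_isGreatest {ρ : Matrix (Fin N → ι) (Fin N → ι) ℂ} {b : ℝ}
    (h : ∀ φ ∈ productStates N ι, expectation ρ φ ≤ b)
    (h' : ∃ φ ∈ productStates N ι, expectation ρ φ = b) : maxOverlapSq ρ = b := by
  obtain ⟨φ, hφ, rfl⟩ := h'
  refine IsGreatest.csSup_eq ⟨⟨_, vecMulVec_mem_separableStates hφ, ?_⟩, ?_⟩
  · exact (expectation_eq_trace_re ρ φ).symm
  · rintro _ ⟨σ, hσ, rfl⟩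
    exact trace_mul_re_le_of_mem_separableStates h hσ

end Separable

/-! ### Functional calculus and a concavity bound for the logarithm -/

section Hermitian

variable {α : Type*} [Fintype α] [DecidableEq α]

/-- Every column of `B` is an eigenvector of `A` or zero; in the eigenbasis of `A` its entries
vanish off the eigenvalue `c`. Applied with `B` a projector, this evaluates logarithms without
diagonalizing anything further. -/
theorem cfc_mul_of_mul_eq_smul {A B : Matrix α α ℂ} (hA : A.IsHermitian) {c : ℝ}
    (h : A * B = (c : ℂ) • B) (f : ℝ → ℝ) : cfc f A * B = (f c : ℂ) • B := by
  set U := (hA.eigenvectorUnitary : Matrix α α ℂ) with hU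
  have hUU : star U * U = 1 := Unitary.coe_star_mul_self _
  have hUU' : U * star U = 1 := Unitary.coe_mul_star_self _
  have hA' : A = U * diagonal (fun i => (hA.eigenvalues i : ℂ)) * star U := by
    conv_lhs => rw [hA.spectral_theorem]
    rfl
  have hf : cfc f A = U * diagonal (fun i => (f (hA.eigenvalues i) : ℂ)) * star U := by
    rw [hA.cfc_eq]
    rfl
  have key : diagonal (fun i => (hA.eigenvalues i : ℂ)) * (star U * B) = (c : ℂ) • (star U * B) := by
    have h1 := congrArg (star U * ·) h
    simp only [Matrix.mul_smul] at h1
    rw [← h1]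
    conv_rhs => rw [hA']
    simp only [← Matrix.mul_assoc, hUU, Matrix.one_mul]
  have key2 : diagonal (fun i => (f (hA.eigenvalues i) : ℂ)) * (star U * B) =
      (f c : ℂ) • (star U * B) := by
    ext i j
    have := congrFun (congrFun key i) j
    simp only [diagonal_mul, Matrix.smul_apply, smul_eq_mul] at this ⊢
    by_cases h0 : (star U * B) i j = 0
    · rw [h0, mul_zero, mul_zero]
    · have := mul_right_cancel₀ h0 this
      rw [Complex.ofReal_inj.mp this]
  rw [hf, Matrix.mul_assoc, Matrix.mul_assoc, key2, Matrix.mul_smul, ← Matrix.mul_assoc, hUU', Matrix.one_mul]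

/-- Jensen's inequality: the diagonal of `ρ` in an eigenbasis of `σ` is a probability vector, and
`tr ρσ` is the mean of the eigenvalues of `σ` under it. -/
theorem trace_mul_matrixLog_re_le {ρ σ : Matrix α α ℂ} (hρ : IsState ρ) (hσ : σ.PosSemidef)
    (hker : ∀ v : α → ℂ, σ *ᵥ v = 0 → ρ *ᵥ v = 0) {b : ℝ} (hb : 0 < b)
    (h : (ρ * σ).trace.re ≤ b) : (ρ * matrixLog σ).trace.re ≤ Real.logb 2 b := by
  have hH := hσ.isHermitian
  set U := (hH.eigenvectorUnitary : Matrix α α ℂ) with hU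
  have hUU' : U * star U = 1 := Unitary.coe_mul_star_self _
  set R := star U * ρ * U with hR
  have hRpos : R.PosSemidef := hρ.1.conjTranspose_mul_mul_same U
  have hr : ∀ i, 0 ≤ (R i i).re := fun i => (Complex.le_def.mp hRpos.diag_nonneg).1
  have hform : ∀ g : ℝ → ℝ, (ρ * cfc g σ).trace.re = ∑ i, (R i i).re * g (hH.eigenvalues i) := by
    intro g
    have hg : cfc g σ = U * diagonal (fun i => (g (hH.eigenvalues i) : ℂ)) * star U := by
      rw [hH.cfc_eq]
      rfl
    rw [hg, ← Matrix.mul_assoc, trace_mul_comm, ← Matrix.mul_assoc, ← Matrix.mul_assoc]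
    simp [Matrix.trace, mul_diagonal, ← hR]
  have hsum : ∑ i, (R i i).re = 1 := by
    have : R.trace = 1 := by
      rw [hR, trace_mul_comm, ← Matrix.mul_assoc, hUU', Matrix.one_mul, hρ.2]
    simpa [Matrix.trace] using congrArg Complex.re this
  have hσeq : ∑ i, (R i i).re * hH.eigenvalues i ≤ b := by
    have := hform id
    rw [cfc_id ℝ σ hH.isSelfAdjoint] at this
    simpa [this] using h
  -- The kernel condition gives weight zero to the zero eigenvalues, where `Real.logb 2 0 = 0` would
  -- violate the concavity bound.
  have hzero : ∀ i, hH.eigenvalues i = 0 → (R i i).re = 0 := by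
    intro i hi
    have h1 := hH.mulVec_eigenvectorBasis i
    rw [hi, zero_smul] at h1
    have h2 := hker _ h1
    have h3 : R i i = 0 := by
      rw [hR, Matrix.mul_assoc, Matrix.mul_apply]
      refine Finset.sum_eq_zero fun j _ => ?_
      have : (ρ * U) j i = 0 := by
        have := congrFun h2 j
        simpa [mulVec, dotProduct, Matrix.mul_apply, hU] using this
      rw [this, mul_zero]
    rw [h3, Complex.zero_re]
  have hlog2 : 0 < Real.log 2 := Real.log_pos one_lt_two
  -- The tangent line to the logarithm at `b`; after averaging, the linear term is nonpositive
  -- because the mean eigenvalue is at most `b`.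
  have hterm : ∀ i, (R i i).re * Real.logb 2 (hH.eigenvalues i) ≤
      (R i i).re * Real.logb 2 b +
        ((R i i).re * hH.eigenvalues i / b - (R i i).re) / Real.log 2 := by
    intro i
    rcases (hσ.eigenvalues_nonneg i).eq_or_lt with h0 | h0
    · simp [hzero i h0.symm]
    · have h1 : Real.log (hH.eigenvalues i / b) ≤ hH.eigenvalues i / b - 1 :=
        Real.log_le_sub_one_of_pos (div_pos h0 hb)
      rw [Real.log_div h0.ne' hb.ne'] at h1
      have h2 : Real.logb 2 (hH.eigenvalues i) ≤
          Real.logb 2 b + (hH.eigenvalues i / b - 1) / Real.log 2 := by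
        rw [Real.logb, Real.logb, ← add_div]
        gcongr
        linarith
      calc _ ≤ (R i i).re * (Real.logb 2 b + (hH.eigenvalues i / b - 1) / Real.log 2) :=
            mul_le_mul_of_nonneg_left h2 (hr i)
        _ = _ := by ring
  rw [matrixLog, hform]
  refine (Finset.sum_le_sum fun i _ => hterm i).trans ?_
  rw [Finset.sum_add_distrib, ← Finset.sum_mul, hsum, one_mul, ← Finset.sum_div,
    Finset.sum_sub_distrib, hsum, ← Finset.sum_div]
  have : (∑ i, (R i i).re * hH.eigenvalues i) / b ≤ 1 := (div_le_one hb).mpr hσeq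
  have : ((∑ i, (R i i).re * hH.eigenvalues i) / b - 1) / Real.log 2 ≤ 0 :=
    div_nonpos_of_nonpos_of_nonneg (by linarith) hlog2.le
  linarith

end Hermitian

/-! ### Normalized projectors and states acting as a scalar on their range -/

section ProjectorState

variable {α : Type*} [Fintype α]

theorem mul_projector_comm {Q σ : Matrix α α ℂ} (hQ : Q.IsHermitian) (hσ : σ.IsHermitian) {c : ℝ}
    (h : σ * Q = (c : ℂ) • Q) : Q * σ = (c : ℂ) • Q := by
  have := congrArg conjTranspose h
  simpa [conjTranspose_mul, conjTranspose_smul, hQ.eq, hσ.eq] using this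

theorem isState_inv_smul_projector {Q : Matrix α α ℂ} {t : ℝ} (hQ : Q.IsHermitian)
    (hQQ : Q * Q = Q) (ht : 0 < t) (htr : Q.trace = (t : ℂ)) : IsState ((t : ℂ)⁻¹ • Q) := by
  have h0 : (t : ℂ) ≠ 0 := by exact_mod_cast ht.ne'
  refine ⟨?_, by rw [trace_smul, htr, smul_eq_mul, inv_mul_cancel₀ h0]⟩
  have : Q.PosSemidef := by
    have h := posSemidef_conjTranspose_mul_self Q
    rwa [hQ.eq, hQQ] at h
  rw [← Complex.ofReal_inv]
  exact this.smul (Complex.zero_le_real.mpr (inv_nonneg.mpr ht.le))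

variable [DecidableEq α]

/-- The defect from `1` is the trace of `(1 - Q) σ (1 - Q)`. -/
theorem trace_projector_mul_re_le_one {Q σ : Matrix α α ℂ} (hQ : Q.IsHermitian) (hQQ : Q * Q = Q)
    (hσ : IsState σ) : (Q * σ).trace.re ≤ 1 := by
  have h := (hσ.1.conjTranspose_mul_mul_same (1 - Q)).trace_nonneg
  have hQ' : (1 - Q)ᴴ = 1 - Q := by rw [conjTranspose_sub, conjTranspose_one, hQ.eq]
  have h2 : (1 - Q) * (1 - Q) = 1 - Q := by
    rw [mul_sub, sub_mul, sub_mul, mul_one, mul_one, one_mul, hQQ, sub_self, sub_zero]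
  rw [hQ', trace_mul_comm, ← Matrix.mul_assoc, h2, sub_mul, one_mul, trace_sub, hσ.2] at h
  have := (Complex.le_def.mp h).1
  simpa using this

/-- Since `σ` commutes with `Q`, the difference is the compression `(1 - Q) σ (1 - Q)`. It is, up to
scale, the noise state in the robustness. -/
theorem posSemidef_sub_smul_projector {Q σ : Matrix α α ℂ} (hQ : Q.IsHermitian)
    (hQQ : Q * Q = Q) (hσ : σ.PosSemidef) {c : ℝ} (h : σ * Q = (c : ℂ) • Q) :
    (σ - (c : ℂ) • Q).PosSemidef := by
  have h' := mul_projector_comm hQ hσ.isHermitian h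
  have hQ' : (1 - Q)ᴴ = 1 - Q := by rw [conjTranspose_sub, conjTranspose_one, hQ.eq]
  have : σ - (c : ℂ) • Q = (1 - Q)ᴴ * σ * (1 - Q) := by
    rw [hQ', sub_mul, mul_sub, one_mul, h', mul_one, sub_mul, h, Matrix.smul_mul, hQQ, sub_self,
      sub_zero]
  rw [this]
  exact hσ.conjTranspose_mul_mul_same _

theorem trace_projectorState_mul_matrixLog {Q σ : Matrix α α ℂ} {t c : ℝ} (ht : 0 < t)
    (htr : Q.trace = (t : ℂ)) (hσ : σ.IsHermitian) (h : σ * Q = (c : ℂ) • Q) :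
    (((t : ℂ)⁻¹ • Q) * matrixLog σ).trace.re = Real.logb 2 c := by
  have h0 : (t : ℂ) ≠ 0 := by exact_mod_cast ht.ne'
  rw [trace_mul_comm, Matrix.mul_smul, matrixLog, cfc_mul_of_mul_eq_smul hσ h, trace_smul,
    trace_smul, htr, smul_eq_mul, smul_eq_mul, mul_left_comm, inv_mul_cancel₀ h0, mul_one,
    Complex.ofReal_re]

theorem relativeEntropy_projectorState {Q σ : Matrix α α ℂ} {t c : ℝ} (hQ : Q.IsHermitian)
    (hQQ : Q * Q = Q) (ht : 0 < t) (htr : Q.trace = (t : ℂ)) (hσ : σ.PosSemidef) (hc : 0 < c)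
    (h : σ * Q = (c : ℂ) • Q) :
    relativeEntropy ((t : ℂ)⁻¹ • Q) σ = ((-Real.logb 2 (t * c) : ℝ) : EReal) := by
  have h' := mul_projector_comm hQ hσ.isHermitian h
  have hker : ∀ v : α → ℂ, σ *ᵥ v = 0 → ((t : ℂ)⁻¹ • Q) *ᵥ v = 0 := by
    intro v hv
    have h1 : (Q * σ) *ᵥ v = 0 := by rw [← mulVec_mulVec, hv, mulVec_zero]
    rw [h', smul_mulVec] at h1
    rw [smul_mulVec, (smul_eq_zero.mp h1).resolve_left (by exact_mod_cast hc.ne'), smul_zero]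
  have hρ : ((t : ℂ)⁻¹ • Q) * Q = ((t⁻¹ : ℝ) : ℂ) • Q := by
    rw [Matrix.smul_mul, hQQ, Complex.ofReal_inv]
  rw [relativeEntropy, if_pos hker, mul_sub, trace_sub, Complex.sub_re,
    trace_projectorState_mul_matrixLog ht htr
      (isState_inv_smul_projector hQ hQQ ht htr).1.isHermitian hρ,
    trace_projectorState_mul_matrixLog ht htr hσ.isHermitian h, Real.logb_inv,
    Real.logb_mul ht.ne' hc.ne']
  congr 1
  ring

theorem le_relativeEntropy_projectorState {Q σ : Matrix α α ℂ} {t b : ℝ} (hQ : Q.IsHermitian)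
    (hQQ : Q * Q = Q) (ht : 0 < t) (htr : Q.trace = (t : ℂ)) (hσ : σ.PosSemidef) (hb : 0 < b)
    (h : (((t : ℂ)⁻¹ • Q) * σ).trace.re ≤ b) :
    ((-Real.logb 2 (t * b) : ℝ) : EReal) ≤ relativeEntropy ((t : ℂ)⁻¹ • Q) σ := by
  rw [relativeEntropy]
  split_ifs with hker
  · have hstate := isState_inv_smul_projector hQ hQQ ht htr
    have hρ : ((t : ℂ)⁻¹ • Q) * Q = ((t⁻¹ : ℝ) : ℂ) • Q := by
      rw [Matrix.smul_mul, hQQ, Complex.ofReal_inv]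
    rw [mul_sub, trace_sub, Complex.sub_re,
      trace_projectorState_mul_matrixLog ht htr hstate.1.isHermitian hρ, Real.logb_inv,
      Real.logb_mul ht.ne' hb.ne', EReal.coe_le_coe_iff]
    have := trace_mul_matrixLog_re_le hstate hσ hker hb h
    linarith
  · exact le_top

end ProjectorState

/-! ### Robustness and relative entropy in terms of the maximal overlap -/

section Collapse

variable {N : ℕ} {ι : Type*} [Fintype ι] [DecidableEq ι]

theorem bddAbove_trace_projectorState {Q : Matrix (Fin N → ι) (Fin N → ι) ℂ} {t : ℝ}
    (hQ : Q.IsHermitian) (hQQ : Q * Q = Q) (ht : 0 < t) :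
    BddAbove ((fun σ => (((t : ℂ)⁻¹ • Q) * σ).trace.re) '' separableStates N ι) := by
  refine ⟨t⁻¹, ?_⟩
  rintro _ ⟨σ, hσ, rfl⟩
  have := trace_projector_mul_re_le_one hQ hQQ (isState_of_mem_separableStates hσ)
  simp only [Matrix.smul_mul, trace_smul, ← Complex.ofReal_inv, smul_eq_mul, Complex.re_ofReal_mul]
  exact mul_le_of_le_one_right (inv_nonneg.mpr ht.le) this

/-- Writing `σ = c Q + (σ - c Q)` and scaling by `1/(tc)` presents `σ` as `ρ` plus positive noise of
weight `1/(tc) - 1`. -/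
theorem robustness_mem_of_mul_eq_smul {Q σ : Matrix (Fin N → ι) (Fin N → ι) ℂ} {t c : ℝ}
    (hQ : Q.IsHermitian) (hQQ : Q * Q = Q) (ht : 0 < t) (htr : Q.trace = (t : ℂ))
    (hσ : σ ∈ separableStates N ι) (hc : 0 < c) (h : σ * Q = (c : ℂ) • Q) :
    (t * c)⁻¹ - 1 ∈ {s : ℝ | 0 ≤ s ∧ ∃ Δ : Matrix (Fin N → ι) (Fin N → ι) ℂ, IsState Δ ∧
      (1 + s)⁻¹ • (((t : ℂ)⁻¹ • Q) + s • Δ) ∈ separableStates N ι} := by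
  have hst := isState_of_mem_separableStates hσ
  have htc : 0 < t * c := mul_pos ht hc
  have h0 : (t : ℂ) ≠ 0 := by exact_mod_cast ht.ne'
  have hc0 : (c : ℂ) ≠ 0 := by exact_mod_cast hc.ne'
  have hle : t * c ≤ 1 := by
    have h1 := trace_projector_mul_re_le_one hQ hQQ hst
    rw [trace_mul_comm, h, trace_smul, htr, smul_eq_mul, ← Complex.ofReal_mul,
      Complex.ofReal_re] at h1
    linarith
  have hs : 0 ≤ (t * c)⁻¹ - 1 := sub_nonneg.mpr ((one_le_inv₀ htc).mpr hle)
  refine ⟨hs, ?_⟩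
  have hpsd := posSemidef_sub_smul_projector hQ hQQ hst.1 h
  have htrace : (σ - (c : ℂ) • Q).trace = ((1 - t * c : ℝ) : ℂ) := by
    rw [trace_sub, hst.2, trace_smul, htr, smul_eq_mul]
    push_cast
    ring
  rw [add_sub_cancel, inv_inv]
  -- With zero noise weight the remainder cannot be normalized to a state; then `σ` is `ρ` itself
  -- and any state can stand for the noise.
  rcases hs.eq_or_lt with hs0 | hs0
  · have h1 : t * c = 1 := by
      exact inv_eq_one.mp (sub_eq_zero.mp hs0.symm)
    have h2 : σ = (c : ℂ) • Q := by
      rw [h1, sub_self, Complex.ofReal_zero, hpsd.trace_eq_zero_iff, sub_eq_zero] at htrace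
      exact htrace
    have h3 : (t : ℂ)⁻¹ = c := by
      exact inv_eq_of_mul_eq_one_right (by exact_mod_cast h1)
    refine ⟨σ, hst, ?_⟩
    rw [← hs0, zero_smul, add_zero, h1, one_smul, h3, ← h2]
    exact hσ
  · set s := (t * c)⁻¹ - 1 with hsdef
    have hs1 : (t * c)⁻¹ = 1 + s := by rw [hsdef]; ring
    refine ⟨s⁻¹ • ((1 + s) • (σ - (c : ℂ) • Q)), ⟨?_, ?_⟩, ?_⟩
    · exact (hpsd.smul (by linarith)).smul (inv_nonneg.mpr hs)
    · rw [trace_smul, trace_smul, htrace, ← hs1, Complex.real_smul, Complex.real_smul]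
      norm_cast
      rw [mul_sub, mul_one, inv_mul_cancel₀ htc.ne', ← hsdef, inv_mul_cancel₀ hs0.ne']
    · have hcalc : (t * c) • ((t : ℂ)⁻¹ • Q + s • s⁻¹ • (1 + s) • (σ - (c : ℂ) • Q)) = σ := by
        rw [smul_smul s, mul_inv_cancel₀ hs0.ne', one_smul, smul_add, smul_smul, ← hs1,
          mul_inv_cancel₀ htc.ne', one_smul, ← Complex.coe_smul, smul_smul, Complex.ofReal_mul,
          mul_right_comm, mul_inv_cancel₀ h0, one_mul, add_sub_cancel]
      rw [hcalc]
      exact hσ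

/-- The overlap of `ρ` with the mixture is at least `tr ρ² / (1 + s) = 1 / (t (1 + s))`, because the
noise contributes nonnegatively, and it is at most `b`. -/
theorem one_le_of_robustness_mem {Q : Matrix (Fin N → ι) (Fin N → ι) ℂ} {t b s : ℝ}
    (hQ : Q.IsHermitian) (hQQ : Q * Q = Q) (ht : 0 < t) (htr : Q.trace = (t : ℂ))
    (hb : ∀ σ ∈ separableStates N ι, (((t : ℂ)⁻¹ • Q) * σ).trace.re ≤ b)
    (hs : s ∈ {s : ℝ | 0 ≤ s ∧ ∃ Δ : Matrix (Fin N → ι) (Fin N → ι) ℂ, IsState Δ ∧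
      (1 + s)⁻¹ • (((t : ℂ)⁻¹ • Q) + s • Δ) ∈ separableStates N ι}) :
    1 ≤ t * b * (1 + s) := by
  obtain ⟨hs0, Δ, hΔ, hsep⟩ := hs
  have h0 : (t : ℂ) ≠ 0 := by exact_mod_cast ht.ne'
  have h1 := hb _ hsep
  have hs1 : 0 < 1 + s := by linarith
  have hnn : 0 ≤ (Q * Δ).trace.re := by
    have h := (hΔ.1.conjTranspose_mul_mul_same Q).trace_nonneg
    rw [hQ.eq, trace_mul_comm, ← Matrix.mul_assoc, hQQ] at h
    exact (Complex.le_def.mp h).1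
  rw [Matrix.mul_smul, mul_add, trace_smul, trace_add, Matrix.smul_mul, Matrix.mul_smul,
    trace_smul, hQQ, trace_smul, htr, Matrix.smul_mul, Matrix.mul_smul, trace_smul, trace_smul,
    smul_eq_mul, smul_eq_mul, smul_eq_mul, inv_mul_cancel₀ h0, mul_one, ← Complex.ofReal_inv,
    Complex.real_smul, Complex.re_ofReal_mul, Complex.add_re, Complex.ofReal_re,
    Complex.re_ofReal_mul, Complex.real_smul, Complex.re_ofReal_mul] at h1
  have h2 : t⁻¹ ≤ b * (1 + s) := by
    have h3 : t⁻¹ + t⁻¹ * (s * (Q * Δ).trace.re) ≤ b * (1 + s) := by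
      rwa [inv_mul_le_iff₀ hs1, mul_comm (1 + s)] at h1
    have : 0 ≤ t⁻¹ * (s * (Q * Δ).trace.re) := by positivity
    linarith
  rwa [inv_le_iff_one_le_mul₀' ht, ← mul_assoc] at h2

/-- Each separable `σ` of positive overlap `c` gives upper bounds on both measures through its
twirled version. Letting `c` approach the supremum `b` makes them meet the lower bounds, so no
maximizer, hence no compactness of `SEP`, is needed. -/
theorem measures_eq_of_twirl {Q : Matrix (Fin N → ι) (Fin N → ι) ℂ} {t : ℝ}
    (hQ : Q.IsHermitian) (hQQ : Q * Q = Q) (ht : 0 < t) (htr : Q.trace = (t : ℂ))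
    (htw : ∀ σ ∈ separableStates N ι, ∃ σ' ∈ separableStates N ι,
      σ' * Q = (((((t : ℂ)⁻¹ • Q) * σ).trace.re : ℝ) : ℂ) • Q)
    (hpos : ∃ σ ∈ separableStates N ι, 0 < (((t : ℂ)⁻¹ • Q) * σ).trace.re) :
    0 < maxOverlapSq ((t : ℂ)⁻¹ • Q) ∧
    relativeEntropyOfEntanglement ((t : ℂ)⁻¹ • Q) =
      ((logGlobalRobustness ((t : ℂ)⁻¹ • Q) : ℝ) : EReal) ∧
    logGlobalRobustness ((t : ℂ)⁻¹ • Q) = geometricMeasure ((t : ℂ)⁻¹ • Q) - Real.logb 2 t ∧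
    0 ≤ logGlobalRobustness ((t : ℂ)⁻¹ • Q) := by
  set ρ := (t : ℂ)⁻¹ • Q with hρ
  set b := maxOverlapSq ρ with hbdef
  have hbdd := bddAbove_trace_projectorState (N := N) (ι := ι) hQ hQQ ht
  have hle : ∀ σ ∈ separableStates N ι, (ρ * σ).trace.re ≤ b := fun σ hσ =>
    le_csSup hbdd ⟨σ, hσ, rfl⟩
  obtain ⟨σ₀, hσ₀, hσ₀pos⟩ := hpos
  have hb : 0 < b := hσ₀pos.trans_le (hle σ₀ hσ₀)
  have htb : 0 < t * b := mul_pos ht hb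
  -- a uniform bound on the positive overlaps is a bound on `b`
  have hsup : ∀ r : ℝ, (∀ σ ∈ separableStates N ι, 0 < (ρ * σ).trace.re →
      (ρ * σ).trace.re ≤ r) → b ≤ r := by
    intro r hr
    have hr0 : 0 ≤ r := hσ₀pos.le.trans (hr σ₀ hσ₀ hσ₀pos)
    refine csSup_le ⟨_, σ₀, hσ₀, rfl⟩ ?_
    rintro _ ⟨σ, hσ, rfl⟩
    rcases le_or_gt (ρ * σ).trace.re 0 with h | h
    · exact h.trans hr0
    · exact hr σ hσ h
  have hRg : globalRobustness ρ = (t * b)⁻¹ - 1 := by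
    refine IsGLB.csInf_eq ⟨?_, ?_⟩ ?_
    · intro s hs
      have h1 := one_le_of_robustness_mem hQ hQQ ht htr hle hs
      rw [sub_le_iff_le_add', inv_le_iff_one_le_mul₀' htb]
      exact h1
    · intro r hr
      have hr1 : ∀ σ ∈ separableStates N ι, 0 < (ρ * σ).trace.re →
          1 + r ≤ (t * (ρ * σ).trace.re)⁻¹ := by
        intro σ hσ hc
        obtain ⟨σ', hσ', hQσ⟩ := htw σ hσ
        have := hr (robustness_mem_of_mul_eq_smul hQ hQQ ht htr hσ' hc hQσ)
        linarith
      rcases le_or_gt (1 + r) 0 with h | h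
      · have := inv_pos.mpr htb
        linarith
      · have : b ≤ (1 + r)⁻¹ / t := hsup _ fun σ hσ hc => by
          rw [le_div_iff₀' ht, le_inv_comm₀ (mul_pos ht hc) h]
          exact hr1 σ hσ hc
        rw [le_div_iff₀' ht, le_inv_comm₀ htb h] at this
        linarith
    · obtain ⟨σ', hσ', hQσ⟩ := htw σ₀ hσ₀
      exact ⟨_, robustness_mem_of_mul_eq_smul hQ hQQ ht htr hσ' hσ₀pos hQσ⟩
  have hRL : logGlobalRobustness ρ = -Real.logb 2 (t * b) := by
    rw [logGlobalRobustness, hRg, add_sub_cancel, Real.logb_inv]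
  have hER : relativeEntropyOfEntanglement ρ = ((-Real.logb 2 (t * b) : ℝ) : EReal) := by
    have hlow : ((-Real.logb 2 (t * b) : ℝ) : EReal) ≤ relativeEntropyOfEntanglement ρ :=
      le_iInf₂ fun σ hσ => le_relativeEntropy_projectorState hQ hQQ ht htr
        (isState_of_mem_separableStates hσ).1 hb (hle σ hσ)
    have hup : ∀ σ ∈ separableStates N ι, 0 < (ρ * σ).trace.re →
        relativeEntropyOfEntanglement ρ ≤ ((-Real.logb 2 (t * (ρ * σ).trace.re) : ℝ) : EReal) := by
      intro σ hσ hc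
      obtain ⟨σ', hσ', hQσ⟩ := htw σ hσ
      rw [← relativeEntropy_projectorState hQ hQQ ht htr (isState_of_mem_separableStates hσ').1
        hc hQσ]
      exact iInf₂_le σ' hσ'
    refine le_antisymm ?_ hlow
    have hnt : relativeEntropyOfEntanglement ρ ≠ ⊤ :=
      ne_top_of_le_ne_top (EReal.coe_ne_top _) (hup σ₀ hσ₀ hσ₀pos)
    have hnb : relativeEntropyOfEntanglement ρ ≠ ⊥ :=
      ne_bot_of_le_ne_bot (EReal.coe_ne_bot _) hlow
    -- Now that the infimum is known to be finite, the upper bounds can be solved for the overlap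
    -- and fed to `hsup`.
    lift relativeEntropyOfEntanglement ρ to ℝ using ⟨hnt, hnb⟩ with e
    rw [EReal.coe_le_coe_iff]
    have : b ≤ 2 ^ (-e) / t := hsup _ fun σ hσ hc => by
      have h1 := hup σ hσ hc
      rw [EReal.coe_le_coe_iff, le_neg, Real.logb_le_iff_le_rpow one_lt_two (mul_pos ht hc)] at h1
      rwa [le_div_iff₀' ht]
    rw [le_neg, Real.logb_le_iff_le_rpow one_lt_two htb]
    rwa [le_div_iff₀' ht] at this
  refine ⟨hb, by rw [hER, hRL], ?_, ?_⟩
  · rw [hRL, geometricMeasure, ← hbdef, Real.logb_mul ht.ne' hb.ne', Real.sqrt_eq_rpow,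
      Real.logb_rpow_eq_mul_logb_of_pos hb]
    ring
  · rw [logGlobalRobustness]
    refine Real.logb_nonneg one_lt_two ?_
    have : 0 ≤ globalRobustness ρ := Real.sInf_nonneg fun s hs => hs.1
    linarith

end Collapse

/-! ### The antisymmetrizer as a determinantal kernel -/

section Antisymmetrizer

variable {ι : Type*}

theorem eq_zero_of_antisymmetric {n : ℕ} {f : (Fin n → ι) → ℂ}
    (hf : ∀ (π : Equiv.Perm (Fin n)) x, f (x ∘ π) = ((Equiv.Perm.sign π : ℤ) : ℂ) * f x)
    {x : Fin n → ι} (hx : ¬ Function.Injective x) : f x = 0 := by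
  simp only [Function.Injective, not_forall] at hx
  obtain ⟨i, j, hij, hne⟩ := hx
  have h := hf (Equiv.swap i j) x
  have hcomp : x ∘ Equiv.swap i j = x := by
    ext k
    simp only [Function.comp_apply, Equiv.swap_apply_def]
    split_ifs with h1 h2
    · rw [h1, hij]
    · rw [h2, hij]
    · rfl
  rw [hcomp, Equiv.Perm.sign_swap hne] at h
  simp only [Units.val_neg, Units.val_one, Int.cast_neg, Int.cast_one, neg_mul, one_mul] at h
  exact self_eq_neg.mp h

variable [DecidableEq ι]

/-- The kernel of the antisymmetrizer on functions of `n` variables in `ι`. -/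
def antisymmetrizer (n : ℕ) (ι : Type*) [DecidableEq ι] : Matrix (Fin n → ι) (Fin n → ι) ℂ :=
  Matrix.of fun x y =>
    (n.factorial : ℂ)⁻¹ * (Matrix.of fun k l => if x k = y l then (1 : ℂ) else 0).det

theorem antisymmetrizer_apply {n : ℕ} (x y : Fin n → ι) : antisymmetrizer n ι x y =
    (n.factorial : ℂ)⁻¹ * (Matrix.of fun k l => if x k = y l then (1 : ℂ) else 0).det := rfl

theorem antisymmetrizer_comm {n : ℕ} (x y : Fin n → ι) :
    antisymmetrizer n ι x y = antisymmetrizer n ι y x := by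
  rw [antisymmetrizer_apply, antisymmetrizer_apply, ← det_transpose]
  congr 2
  ext k l
  simp [eq_comm]

theorem antisymmetrizer_transpose (n : ℕ) : (antisymmetrizer n ι)ᵀ = antisymmetrizer n ι := by
  ext x y
  exact antisymmetrizer_comm y x

theorem star_antisymmetrizer_apply {n : ℕ} (x y : Fin n → ι) :
    star (antisymmetrizer n ι x y) = antisymmetrizer n ι x y := by
  rw [antisymmetrizer_apply, star_mul', ← det_conjTranspose, ← det_transpose]
  congr 1
  · simp
  · congr 1
    ext k l
    simp [apply_ite]

theorem antisymmetrizer_isHermitian (n : ℕ) : (antisymmetrizer n ι).IsHermitian := by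
  ext x y
  rw [conjTranspose_apply, star_antisymmetrizer_apply, antisymmetrizer_comm]

theorem antisymmetrizer_comp_left {n : ℕ} (π : Equiv.Perm (Fin n)) (x y : Fin n → ι) :
    antisymmetrizer n ι (x ∘ π) y =
      ((Equiv.Perm.sign π : ℤ) : ℂ) * antisymmetrizer n ι x y := by
  rw [antisymmetrizer_apply, antisymmetrizer_apply, mul_left_comm, ← det_permute]
  rfl

theorem antisymmetrizer_comp_right {n : ℕ} (π : Equiv.Perm (Fin n)) (x y : Fin n → ι) :
    antisymmetrizer n ι x (y ∘ π) =
      ((Equiv.Perm.sign π : ℤ) : ℂ) * antisymmetrizer n ι x y := by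
  rw [antisymmetrizer_comm, antisymmetrizer_comp_left, antisymmetrizer_comm]

theorem antisymmetrizer_eq_sum {n : ℕ} (x y : Fin n → ι) : antisymmetrizer n ι x y =
    (n.factorial : ℂ)⁻¹ *
      ∑ π : Equiv.Perm (Fin n), ((Equiv.Perm.sign π : ℤ) : ℂ) * if x ∘ π = y then 1 else 0 := by
  rw [antisymmetrizer_apply, det_apply']
  congr 1
  refine Finset.sum_congr rfl fun π _ => ?_
  rw [show (∏ i, (Matrix.of fun k l => if x k = y l then (1 : ℂ) else 0) (π i) i) =
    if x ∘ π = y then 1 else 0 from ?_]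
  simp only [of_apply, Finset.prod_boole, funext_iff, Function.comp_apply, Finset.mem_univ,
    true_imp_iff]

theorem antisymmetrizer_self {n : ℕ} {x : Fin n → ι} (hx : Function.Injective x) :
    antisymmetrizer n ι x x = (n.factorial : ℂ)⁻¹ := by
  rw [antisymmetrizer_apply, show (Matrix.of fun k l => if x k = x l then (1 : ℂ) else 0) = 1 from ?_,
    det_one, mul_one]
  ext k l
  simp [Matrix.one_apply, hx.eq_iff]

variable [Fintype ι]

theorem antisymmetrizer_mul_apply {n : ℕ} {β : Type*} (M : Matrix (Fin n → ι) β ℂ)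
    (x : Fin n → ι) (b : β) : (antisymmetrizer n ι * M) x b = (n.factorial : ℂ)⁻¹ *
      ∑ π : Equiv.Perm (Fin n), ((Equiv.Perm.sign π : ℤ) : ℂ) * M (x ∘ π) b := by
  simp only [Matrix.mul_apply, antisymmetrizer_eq_sum, mul_assoc, Finset.sum_mul, ← Finset.mul_sum]
  congr 1
  rw [Finset.sum_comm]
  refine Finset.sum_congr rfl fun π _ => ?_
  simp

theorem antisymmetrizer_mul_eq {n : ℕ} {β : Type*} {M : Matrix (Fin n → ι) β ℂ}
    (hM : ∀ (π : Equiv.Perm (Fin n)) x b,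
      M (x ∘ π) b = ((Equiv.Perm.sign π : ℤ) : ℂ) * M x b) : antisymmetrizer n ι * M = M := by
  ext x b
  rw [antisymmetrizer_mul_apply]
  have h : ∀ π : Equiv.Perm (Fin n),
      ((Equiv.Perm.sign π : ℤ) : ℂ) * M (x ∘ π) b = M x b := by
    intro π
    rw [hM, ← mul_assoc, ← Int.cast_mul, Int.units_coe_mul_self, Int.cast_one, one_mul]
  simp only [h, Finset.sum_const, Finset.card_univ, Fintype.card_perm, Fintype.card_fin,
    nsmul_eq_mul]
  rw [inv_mul_cancel_left₀ (by exact_mod_cast n.factorial_ne_zero)]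

theorem antisymmetrizer_mul_self (n : ℕ) :
    antisymmetrizer n ι * antisymmetrizer n ι = antisymmetrizer n ι :=
  antisymmetrizer_mul_eq fun π x y => antisymmetrizer_comp_left π x y

/-- The orthogonal projection is characterized by landing in the subspace and leaving an orthogonal
error; Hermiticity and the fixing of antisymmetric vectors supply both. -/
theorem antisymmetricProjector_eq (d N : ℕ) :
    antisymmetricProjector d N = antisymmetrizer N (Fin d) := by
  rw [antisymmetricProjector, StarAlgEquiv.symm_apply_eq]
  ext1 ψ
  set P := antisymmetrizer N (Fin d)
  have hP : ∀ φ : EuclideanSpace ℂ (Fin N → Fin d), φ ∈ antisymmetricSubspace d N →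
      P *ᵥ φ.ofLp = φ.ofLp := by
    intro φ hφ
    have h := antisymmetrizer_mul_eq (M := Matrix.of fun x (_ : Unit) => φ x)
      fun π x _ => hφ π x
    ext x
    exact congrFun (congrFun h x) ()
  refine Submodule.eq_starProjection_of_mem_of_inner_eq_zero ?_ fun w hw => ?_
  · intro π x
    simp only [ofLp_toEuclideanCLM, mulVec, dotProduct, Finset.mul_sum]
    refine Finset.sum_congr rfl fun y _ => ?_
    rw [show P (x ∘ π) y = _ from antisymmetrizer_comp_left π x y, mul_assoc]
  · rw [inner_sub_left, sub_eq_zero, EuclideanSpace.inner_eq_star_dotProduct,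
      EuclideanSpace.inner_eq_star_dotProduct, ofLp_toEuclideanCLM, star_mulVec,
      (antisymmetrizer_isHermitian N).eq, dotProduct_comm w.ofLp, dotProduct_comm w.ofLp,
      ← dotProduct_mulVec, hP w hw]

/-- Only injective tuples have a nonzero diagonal entry, namely `1 / n!`, and there are `d (d - 1) ⋯
(d - n + 1)` of them. -/
theorem trace_antisymmetrizer (n : ℕ) :
    (antisymmetrizer n ι).trace = ((Fintype.card ι).choose n : ℂ) := by
  classical
  have h : ∀ x : Fin n → ι, antisymmetrizer n ι x x =
      if Function.Injective x then (n.factorial : ℂ)⁻¹ else 0 := by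
    intro x
    split_ifs with hx
    · exact antisymmetrizer_self hx
    · exact eq_zero_of_antisymmetric (f := fun y => antisymmetrizer n ι y x)
        (fun π y => antisymmetrizer_comp_left π y x) hx
  have hcard : (Finset.univ.filter fun x : Fin n → ι => Function.Injective x).card =
      (Fintype.card ι).descFactorial n := by
    rw [← Fintype.card_subtype, Fintype.card_congr (Equiv.subtypeInjectiveEquivEmbedding _ _),
      Fintype.card_embedding_eq, Fintype.card_fin]
  rw [Matrix.trace, Nat.choose_eq_descFactorial_div_factorial,
    Nat.cast_div (Nat.factorial_dvd_descFactorial _ _) (by exact_mod_cast n.factorial_ne_zero)]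
  simp only [diag_apply, h]
  rw [← Finset.sum_filter, Finset.sum_const, hcard, nsmul_eq_mul, div_eq_mul_inv]

end Antisymmetrizer

/-! ### Fermionic annihilation operators and their anticommutation relations -/

section Annihilation

variable {ι : Type*}

theorem sum_consVec [Fintype ι] {R : Type*} [AddCommMonoid R] {n : ℕ} (f : (Fin (n + 1) → ι) → R) :
    ∑ z, f z = ∑ i : ι, ∑ x : Fin n → ι, f (Fin.cons i x) := by
  rw [← (Fin.consEquiv fun _ : Fin (n + 1) => ι).sum_comp, Fintype.sum_prod_type]
  rfl

variable [DecidableEq ι]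

/-- Laplace expansion of the determinant along the column belonging to `j`. This is the source of
the anticommutation relations. -/
theorem antisymmetrizer_cons_right {n : ℕ} (j : ι) (x : Fin (n + 1) → ι) (y : Fin n → ι) :
    ((n : ℂ) + 1) * antisymmetrizer (n + 1) ι x (Fin.cons j y) =
      ∑ k : Fin (n + 1), (-1) ^ (k : ℕ) * (if x k = j then 1 else 0) *
        antisymmetrizer n ι (x ∘ k.succAbove) y := by
  have h0 : (n : ℂ) + 1 ≠ 0 := by exact_mod_cast n.succ_ne_zero
  have h1 : (n.factorial : ℂ) ≠ 0 := by exact_mod_cast n.factorial_ne_zero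
  rw [antisymmetrizer_apply, det_succ_column_zero, Nat.factorial_succ, Nat.cast_mul, mul_inv,
    Nat.cast_succ, mul_assoc, mul_inv_cancel_left₀ h0, Finset.mul_sum]
  refine Finset.sum_congr rfl fun k _ => ?_
  rw [antisymmetrizer_apply, mul_left_comm]
  rfl

/-- The annihilation operator of the mode `i`, from antisymmetric functions of `n + 1` variables to
antisymmetric functions of `n` variables. -/
def annihilation (n : ℕ) (i : ι) : Matrix (Fin n → ι) (Fin (n + 1) → ι) ℂ :=
  Matrix.of fun x z => (√(n + 1 : ℝ) : ℂ) * antisymmetrizer (n + 1) ι (Fin.cons i x) z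

theorem annihilation_apply {n : ℕ} (i : ι) (x : Fin n → ι) (z : Fin (n + 1) → ι) :
    annihilation n i x z =
      (√(n + 1 : ℝ) : ℂ) * antisymmetrizer (n + 1) ι (Fin.cons i x) z := rfl

theorem conjTranspose_annihilation_apply {n : ℕ} (i : ι) (x : Fin n → ι) (z : Fin (n + 1) → ι) :
    (annihilation n i)ᴴ z x =
      (√(n + 1 : ℝ) : ℂ) * antisymmetrizer (n + 1) ι z (Fin.cons i x) := by
  rw [conjTranspose_apply, annihilation_apply, star_mul', star_antisymmetrizer_apply,
    antisymmetrizer_comm z]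
  simp

theorem sqrt_mul_sqrt_natCast_add_one (n : ℕ) :
    (√(n + 1 : ℝ) : ℂ) * (√(n + 1 : ℝ) : ℂ) = n + 1 := by
  rw [← Complex.ofReal_mul, Real.mul_self_sqrt (by positivity)]
  push_cast
  rfl

/-- A permutation of the last `n` arguments is one of all `n + 1` that fixes the first, with the
same sign. -/
theorem antisymmetrizer_cons_comp_left {n : ℕ} (π : Equiv.Perm (Fin n)) (i : ι) (x : Fin n → ι)
    (z : Fin (n + 1) → ι) : antisymmetrizer (n + 1) ι (Fin.cons i (x ∘ π)) z =
      ((Equiv.Perm.sign π : ℤ) : ℂ) * antisymmetrizer (n + 1) ι (Fin.cons i x) z := by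
  have h : (Fin.cons i (x ∘ π) : Fin (n + 1) → ι) =
      (Fin.cons i x : Fin (n + 1) → ι) ∘ (Equiv.Perm.decomposeFin.symm (0, π)) := by
    ext k
    refine Fin.cases ?_ (fun k => ?_) k
    · simp
    · simp
  rw [h, antisymmetrizer_comp_left, Equiv.Perm.decomposeFin.symm_sign]
  simp

variable [Fintype ι]

theorem antisymmetrizer_mul_annihilation (n : ℕ) (i : ι) :
    antisymmetrizer n ι * annihilation n i = annihilation n i :=
  antisymmetrizer_mul_eq fun π x z => by
    rw [annihilation_apply, annihilation_apply, antisymmetrizer_cons_comp_left, mul_left_comm]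

theorem annihilation_mul_conjTranspose_apply (n : ℕ) (i j : ι) (x y : Fin n → ι) :
    (annihilation n i * (annihilation n j)ᴴ) x y =
      (n + 1) * antisymmetrizer (n + 1) ι (Fin.cons i x) (Fin.cons j y) := by
  have h := congrFun (congrFun (antisymmetrizer_mul_self (ι := ι) (n + 1)) (Fin.cons i x))
    (Fin.cons j y)
  rw [← h, ← sqrt_mul_sqrt_natCast_add_one, Matrix.mul_apply, Matrix.mul_apply, Finset.mul_sum]
  refine Finset.sum_congr rfl fun z _ => ?_
  rw [conjTranspose_annihilation_apply, annihilation_apply]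
  ring

theorem annihilation_mul_conjTranspose_zero (i j : ι) :
    annihilation 0 i * (annihilation 0 j)ᴴ =
      (if i = j then (1 : ℂ) else 0) • antisymmetrizer 0 ι := by
  ext x y
  rw [annihilation_mul_conjTranspose_apply, antisymmetrizer_cons_right]
  simp only [Fin.sum_univ_succ, Fin.cons_zero, Matrix.smul_apply, smul_eq_mul]
  simp

/-- The canonical anticommutation relation. -/
theorem annihilation_mul_conjTranspose_succ (n : ℕ) (i j : ι) :
    annihilation (n + 1) i * (annihilation (n + 1) j)ᴴ =
      (if i = j then (1 : ℂ) else 0) • antisymmetrizer (n + 1) ι -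
        (annihilation n j)ᴴ * annihilation n i := by
  ext x y
  have hsub : ∀ k : Fin (n + 1), antisymmetrizer (n + 1) ι (Fin.cons i (x ∘ k.succAbove)) y =
      ∑ z, antisymmetrizer n ι (x ∘ k.succAbove) z *
        antisymmetrizer (n + 1) ι (Fin.cons i z) y := by
    intro k
    have h := antisymmetrizer_mul_eq (M := Matrix.of fun (z : Fin n → ι) (w : Fin (n + 1) → ι) =>
      antisymmetrizer (n + 1) ι (Fin.cons i z) w)
      fun π z w => antisymmetrizer_cons_comp_left π i z w
    exact (congrFun (congrFun h (x ∘ k.succAbove)) y).symm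
  have hR : ((annihilation n j)ᴴ * annihilation n i) x y =
      ∑ k : Fin (n + 1), (-1) ^ (k : ℕ) * (if x k = j then 1 else 0) *
        antisymmetrizer (n + 1) ι (Fin.cons i (x ∘ k.succAbove)) y := by
    simp only [Matrix.mul_apply, hsub, Finset.mul_sum]
    rw [Finset.sum_comm]
    refine Finset.sum_congr rfl fun z _ => ?_
    rw [conjTranspose_annihilation_apply, annihilation_apply]
    calc _ = ((√(n + 1 : ℝ) : ℂ) * (√(n + 1 : ℝ) : ℂ)) *
          antisymmetrizer (n + 1) ι x (Fin.cons j z) *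
          antisymmetrizer (n + 1) ι (Fin.cons i z) y := by ring
      _ = _ := by
        rw [sqrt_mul_sqrt_natCast_add_one, antisymmetrizer_cons_right, Finset.sum_mul]
        exact Finset.sum_congr rfl fun k _ => by ring
  -- In the Laplace expansion the row of `i` gives the Kronecker term; the other rows give `a_j†
  -- a_i`, and their index shift by one is the minus sign.
  rw [annihilation_mul_conjTranspose_apply, antisymmetrizer_cons_right, Fin.sum_univ_succ,
    Matrix.sub_apply, hR, sub_eq_add_neg, ← Finset.sum_neg_distrib]
  congr 1
  · simp [Function.comp_def]
  · refine Finset.sum_congr rfl fun k _ => ?_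
    have : (Fin.cons i x : Fin (n + 2) → ι) ∘ k.succ.succAbove =
        Fin.cons i (x ∘ k.succAbove) := by
      ext l
      refine Fin.cases ?_ (fun l => ?_) l
      · simp
      · simp
    rw [this, Fin.cons_succ, Fin.val_succ, pow_succ]
    ring

/-- The number operator. With the anticommutation relations it also determines the sum in the
opposite order, which counts the empty modes. -/
theorem sum_conjTranspose_mul_annihilation (n : ℕ) :
    ∑ i : ι, (annihilation n i)ᴴ * annihilation n i = ((n : ℂ) + 1) • antisymmetrizer (n + 1) ι := by
  ext z w
  have h := congrFun (congrFun (antisymmetrizer_mul_self (ι := ι) (n + 1)) z) w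
  rw [Matrix.smul_apply, ← h, Matrix.mul_apply, sum_consVec, Matrix.sum_apply, Finset.smul_sum]
  refine Finset.sum_congr rfl fun i _ => ?_
  rw [Matrix.mul_apply, Finset.smul_sum]
  refine Finset.sum_congr rfl fun x _ => ?_
  rw [conjTranspose_annihilation_apply, annihilation_apply, smul_eq_mul,
    ← sqrt_mul_sqrt_natCast_add_one]
  ring

theorem sum_annihilation_mul_conjTranspose (n : ℕ) :
    ∑ i : ι, annihilation n i * (annihilation n i)ᴴ =
      ((Fintype.card ι : ℂ) - n) • antisymmetrizer n ι := by
  cases n with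
  | zero =>
    simp only [annihilation_mul_conjTranspose_zero, if_true, one_smul, Finset.sum_const,
      Finset.card_univ, Nat.cast_zero, sub_zero]
    rw [← Nat.cast_smul_eq_nsmul ℂ]
  | succ n =>
    simp only [annihilation_mul_conjTranspose_succ, if_true, one_smul, Finset.sum_sub_distrib,
      Finset.sum_const, Finset.card_univ, sum_conjTranspose_mul_annihilation]
    rw [← Nat.cast_smul_eq_nsmul ℂ, ← sub_smul, Nat.cast_succ]

end Annihilation

/-! ### The Hilbert–Schmidt norm -/

section FrobeniusSq

variable {α β γ : Type*} [Fintype α] [Fintype β] [Fintype γ]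

/-- The squared Frobenius (Hilbert–Schmidt) norm. -/
def frobeniusSq (M : Matrix α β ℂ) : ℝ := ∑ i, ∑ j, Complex.normSq (M i j)

theorem trace_conjTranspose_mul_self_eq (M : Matrix α β ℂ) :
    (Mᴴ * M).trace = (frobeniusSq M : ℂ) := by
  simp only [Matrix.trace, diag_apply, Matrix.mul_apply, conjTranspose_apply, frobeniusSq]
  push_cast
  rw [Finset.sum_comm]
  exact Finset.sum_congr rfl fun i _ => Finset.sum_congr rfl fun j _ =>
    (Complex.normSq_eq_conj_mul_self).symm

theorem frobeniusSq_nonneg (M : Matrix α β ℂ) : 0 ≤ frobeniusSq M :=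
  Finset.sum_nonneg fun _ _ => Finset.sum_nonneg fun _ _ => Complex.normSq_nonneg _

theorem frobeniusSq_conjTranspose (M : Matrix α β ℂ) : frobeniusSq Mᴴ = frobeniusSq M := by
  rw [frobeniusSq, frobeniusSq, Finset.sum_comm]
  simp [Complex.normSq_conj]

theorem eq_zero_of_frobeniusSq_eq_zero {M : Matrix α β ℂ} (h : frobeniusSq M = 0) : M = 0 := by
  ext i j
  have h1 := (Finset.sum_eq_zero_iff_of_nonneg fun i _ =>
    Finset.sum_nonneg fun _ _ => Complex.normSq_nonneg _).mp h i (Finset.mem_univ i)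
  have h2 := (Finset.sum_eq_zero_iff_of_nonneg fun j _ => Complex.normSq_nonneg _).mp h1 j
    (Finset.mem_univ j)
  exact Complex.normSq_eq_zero.mp h2

theorem frobeniusSq_sub (M K : Matrix α β ℂ) : frobeniusSq (M - K) =
    frobeniusSq M - 2 * (Kᴴ * M).trace.re + frobeniusSq K := by
  have h := trace_conjTranspose_mul_self_eq (M - K)
  have h2 : (Mᴴ * K).trace = star (Kᴴ * M).trace := by
    rw [← trace_conjTranspose, conjTranspose_mul, conjTranspose_conjTranspose]
  rw [conjTranspose_sub, Matrix.sub_mul, Matrix.mul_sub, Matrix.mul_sub, trace_sub, trace_sub, trace_sub,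
    trace_conjTranspose_mul_self_eq, trace_conjTranspose_mul_self_eq, h2] at h
  have := congrArg Complex.re h
  simp only [Complex.sub_re, Complex.ofReal_re, Complex.star_def, Complex.conj_re] at this
  linarith

theorem frobeniusSq_smul (c : ℂ) (M : Matrix α β ℂ) :
    frobeniusSq (c • M) = Complex.normSq c * frobeniusSq M := by
  simp [frobeniusSq, Finset.mul_sum, Complex.normSq_mul]

theorem frobeniusSq_sum_mul {κ : Type*} [Fintype κ] (W : κ → Matrix α β ℂ)
    (C : κ → Matrix β γ ℂ) : (frobeniusSq (∑ j, W j * C j) : ℂ) =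
      ∑ l, ∑ j, ((W l)ᴴ * W j * (C j * (C l)ᴴ)).trace := by
  rw [← trace_conjTranspose_mul_self_eq, conjTranspose_sum, Matrix.sum_mul, trace_sum]
  refine Finset.sum_congr rfl fun l _ => ?_
  rw [Matrix.mul_sum, trace_sum]
  refine Finset.sum_congr rfl fun j _ => ?_
  rw [conjTranspose_mul, Matrix.mul_assoc, trace_mul_comm]
  simp only [Matrix.mul_assoc]

/-- Cauchy–Schwarz for `∑ j, W j * C j`, where the column `C` is a multiple of an isometry. -/
theorem frobeniusSq_sum_mul_le {κ : Type*} [Fintype κ] {W : κ → Matrix α β ℂ}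
    {C : κ → Matrix β γ ℂ} {P : Matrix γ γ ℂ} {c : ℝ} (hc : 0 < c)
    (hC : ∑ j, (C j)ᴴ * C j = (c : ℂ) • P) (hP : ∀ j, C j * P = C j) :
    frobeniusSq (∑ j, W j * C j) ≤ c * ∑ j, frobeniusSq (W j) := by
  set Y := ∑ j, W j * C j with hY
  have hYP : Y * P = Y := by
    rw [hY, Matrix.sum_mul]
    exact Finset.sum_congr rfl fun j _ => by rw [Matrix.mul_assoc, hP]
  have h1 : ∑ j, (((Y * (C j)ᴴ)ᴴ * W j).trace) = (frobeniusSq Y : ℂ) := by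
    rw [← trace_conjTranspose_mul_self_eq]
    conv_rhs => rw [hY, Matrix.mul_sum, trace_sum]
    refine Finset.sum_congr rfl fun j _ => ?_
    rw [conjTranspose_mul, conjTranspose_conjTranspose, Matrix.mul_assoc, trace_mul_comm,
      Matrix.mul_assoc]
  have h2 : ∑ j, (frobeniusSq (Y * (C j)ᴴ) : ℂ) = c * frobeniusSq Y := by
    have : ∀ j, (frobeniusSq (Y * (C j)ᴴ) : ℂ) = (Yᴴ * (Y * ((C j)ᴴ * C j))).trace := by
      intro j
      rw [← trace_conjTranspose_mul_self_eq, conjTranspose_mul, conjTranspose_conjTranspose,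
        Matrix.mul_assoc, trace_mul_comm, Matrix.mul_assoc, Matrix.mul_assoc]
    simp only [this]
    rw [← trace_sum, ← Matrix.mul_sum, ← Matrix.mul_sum, hC, Matrix.mul_smul, hYP,
      Matrix.mul_smul, trace_smul, trace_conjTranspose_mul_self_eq, smul_eq_mul]
  -- Completing the square: `c⁻¹ • (Y * (C j)ᴴ)` is the projection of the family `W` onto the
  -- direction that `Y` detects.
  have h3 : 0 ≤ ∑ j, frobeniusSq (W j - ((c⁻¹ : ℝ) : ℂ) • (Y * (C j)ᴴ)) :=
    Finset.sum_nonneg fun j _ => frobeniusSq_nonneg _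
  have h1' : ∑ j, (((Y * (C j)ᴴ)ᴴ * W j).trace).re = frobeniusSq Y := by
    rw [← Complex.re_sum, h1, Complex.ofReal_re]
  have h2' : ∑ j, frobeniusSq (Y * (C j)ᴴ) = c * frobeniusSq Y := by exact_mod_cast h2
  simp only [frobeniusSq_sub, frobeniusSq_smul, conjTranspose_smul, Matrix.smul_mul, trace_smul,
    smul_eq_mul, Complex.star_def, Complex.conj_ofReal, Complex.re_ofReal_mul,
    Complex.normSq_ofReal, Finset.sum_add_distrib, Finset.sum_sub_distrib, ← Finset.mul_sum,
    h1', h2'] at h3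
  have h4 : c⁻¹ * c⁻¹ * (c * frobeniusSq Y) = c⁻¹ * frobeniusSq Y := by
    field_simp
  rw [h4] at h3
  have h5 : c⁻¹ * frobeniusSq Y ≤ ∑ j, frobeniusSq (W j) := by linarith
  rwa [inv_mul_le_iff₀ hc] at h5

end FrobeniusSq

/-! ### Products and contractions with a single-particle operator -/

section PairBound

variable {ι : Type*} [Fintype ι]

theorem sum_sum_star_mul_self (A : Matrix ι ι ℂ) :
    ∑ j, ∑ i, star (A i j) * A i j = (frobeniusSq A : ℂ) := by
  rw [← trace_conjTranspose_mul_self_eq]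
  rfl

variable [DecidableEq ι]

/-- The antisymmetrized product of a single-particle operator and an `n`-particle operator. -/
def wedgeOp (n : ℕ) (A : Matrix ι ι ℂ) (M : Matrix (Fin n → ι) (Fin n → ι) ℂ) :
    Matrix (Fin (n + 1) → ι) (Fin (n + 1) → ι) ℂ :=
  ∑ j, (∑ i, A i j • ((annihilation n i)ᴴ * M)) * annihilation n j

/-- The contraction of an `(n + 1)`-particle operator with the adjoint of a single-particle
operator. -/
def contractOp (n : ℕ) (A : Matrix ι ι ℂ) (M : Matrix (Fin (n + 1) → ι) (Fin (n + 1) → ι) ℂ) :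
    Matrix (Fin n → ι) (Fin n → ι) ℂ :=
  ∑ j, (∑ i, star (A i j) • (annihilation n i * M)) * (annihilation n j)ᴴ

theorem contractOp_eq (n : ℕ) (A : Matrix ι ι ℂ)
    (M : Matrix (Fin (n + 1) → ι) (Fin (n + 1) → ι) ℂ) : contractOp n A M =
      ∑ i, annihilation n i * ∑ j, star (A i j) • (M * (annihilation n j)ᴴ) := by
  simp only [contractOp, Matrix.sum_mul, Matrix.mul_sum, Matrix.smul_mul, Matrix.mul_smul,
    Matrix.mul_assoc]
  exact Finset.sum_comm

theorem antisymmetrizer_mul_contractOp (n : ℕ) (A : Matrix ι ι ℂ)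
    (M : Matrix (Fin (n + 1) → ι) (Fin (n + 1) → ι) ℂ) :
    antisymmetrizer n ι * contractOp n A M = contractOp n A M := by
  rw [contractOp_eq, Matrix.mul_sum]
  simp only [← Matrix.mul_assoc, antisymmetrizer_mul_annihilation]

/-- The contraction is adjoint to the antisymmetrized product. -/
theorem trace_wedgeOp_conjTranspose_mul (n : ℕ) (A : Matrix ι ι ℂ)
    (K : Matrix (Fin n → ι) (Fin n → ι) ℂ) (M : Matrix (Fin (n + 1) → ι) (Fin (n + 1) → ι) ℂ) :
    ((wedgeOp n A K)ᴴ * M).trace = (Kᴴ * contractOp n A M).trace := by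
  simp only [wedgeOp, contractOp, conjTranspose_sum, conjTranspose_mul, conjTranspose_smul,
    conjTranspose_conjTranspose, Matrix.sum_mul, Matrix.mul_sum, trace_sum, Matrix.smul_mul,
    Matrix.mul_smul, trace_smul]
  refine Finset.sum_congr rfl fun j _ => Finset.sum_congr rfl fun i _ => ?_
  rw [Matrix.mul_assoc, trace_mul_comm]
  simp only [Matrix.mul_assoc]

theorem frobeniusSq_wedgeOp_zero (A : Matrix ι ι ℂ) (M : Matrix (Fin 0 → ι) (Fin 0 → ι) ℂ)
    (hM : antisymmetrizer 0 ι * M = M) (hM' : M * antisymmetrizer 0 ι = M) :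
    frobeniusSq (wedgeOp 0 A M) = frobeniusSq A * frobeniusSq M := by
  have h : ∀ i k : ι, Mᴴ * (annihilation 0 k * ((annihilation 0 i)ᴴ * M)) =
      (if k = i then (1 : ℂ) else 0) • (Mᴴ * M) := by
    intro i k
    rw [← Matrix.mul_assoc (annihilation 0 k), annihilation_mul_conjTranspose_zero,
      Matrix.smul_mul, hM, Matrix.mul_smul]
  set S : ι → Matrix (Fin 1 → ι) (Fin 0 → ι) ℂ := fun j => ∑ i, A i j • ((annihilation 0 i)ᴴ * M)
    with hS
  have hSS : ∀ l j, (S l)ᴴ * S j = (∑ i, star (A i l) * A i j) • (Mᴴ * M) := by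
    intro l j
    simp only [hS, conjTranspose_sum, conjTranspose_smul, conjTranspose_mul,
      conjTranspose_conjTranspose, Matrix.sum_mul, Matrix.mul_sum, Matrix.smul_mul,
      Matrix.mul_smul, Matrix.mul_assoc, h]
    rw [Finset.sum_smul]
    refine Finset.sum_congr rfl fun i _ => ?_
    simp [smul_smul, mul_comm]
  rw [← Complex.ofReal_inj, show wedgeOp 0 A M = ∑ j, S j * annihilation 0 j from rfl,
    frobeniusSq_sum_mul]
  simp only [annihilation_mul_conjTranspose_zero, Matrix.mul_smul,
    Matrix.smul_mul, Matrix.mul_assoc Mᴴ M, trace_smul, hM', hSS,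
    trace_conjTranspose_mul_self_eq, smul_eq_mul, ite_mul, one_mul, zero_mul,
    Finset.sum_ite_eq', Finset.mem_univ, if_true]
  rw [← Finset.sum_mul, sum_sum_star_mul_self, Complex.ofReal_mul]

/-- The squared norm contains `a_k a_i†` on the left of `M` and `a_j a_l†` on the right. Normal
ordering both gives four terms: no contraction, a contraction on the left only, on the right only,
and on both sides. The signs are `+`, `-`, `-`, `+`. -/
theorem frobeniusSq_wedgeOp_succ (n : ℕ) (A : Matrix ι ι ℂ)
    (M : Matrix (Fin (n + 1) → ι) (Fin (n + 1) → ι) ℂ) (hM : antisymmetrizer (n + 1) ι * M = M)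
    (hM' : M * antisymmetrizer (n + 1) ι = M) :
    frobeniusSq (wedgeOp (n + 1) A M) = frobeniusSq A * frobeniusSq M -
      ∑ j, frobeniusSq (∑ i, star (A i j) • (annihilation n i * M)) -
      ∑ i, frobeniusSq (∑ j, (star (A i j) • M) * (annihilation n j)ᴴ) +
      frobeniusSq (contractOp n A M) := by
  set S : ι → Matrix (Fin (n + 2) → ι) (Fin (n + 1) → ι) ℂ :=
    fun j => ∑ i, A i j • ((annihilation (n + 1) i)ᴴ * M) with hS
  set W : ι → Matrix (Fin n → ι) (Fin (n + 1) → ι) ℂ :=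
    fun j => ∑ i, star (A i j) • (annihilation n i * M) with hW
  have hSM : ∀ j, S j * antisymmetrizer (n + 1) ι = S j := by
    intro j
    simp only [hS, Matrix.sum_mul, Matrix.smul_mul, Matrix.mul_assoc, hM']
  -- The anticommutation relation for the left legs only; the right legs are treated in `hX`.
  have hSS : ∀ l j, (S l)ᴴ * S j =
      (∑ i, star (A i l) * A i j) • (Mᴴ * M) - (W j)ᴴ * W l := by
    intro l j
    have h : ∀ i k : ι, Mᴴ * (annihilation (n + 1) k * ((annihilation (n + 1) i)ᴴ * M)) =
        (if k = i then (1 : ℂ) else 0) • (Mᴴ * M) -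
          Mᴴ * ((annihilation n i)ᴴ * (annihilation n k * M)) := by
      intro i k
      rw [← Matrix.mul_assoc (annihilation (n + 1) k), annihilation_mul_conjTranspose_succ,
        Matrix.sub_mul, Matrix.smul_mul, hM, Matrix.mul_sub, Matrix.mul_smul, Matrix.mul_assoc]
    simp only [hS, hW, conjTranspose_sum, conjTranspose_smul, conjTranspose_mul,
      conjTranspose_conjTranspose, Matrix.sum_mul, Matrix.mul_sum, Matrix.smul_mul,
      Matrix.mul_smul, Matrix.mul_assoc, h, smul_sub, Finset.sum_sub_distrib, star_star]
    congr 1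
    · rw [Finset.sum_smul]
      refine Finset.sum_congr rfl fun i _ => ?_
      simp [smul_smul, mul_comm]
    · simp only [Finset.smul_sum]
      rw [Finset.sum_comm]
      refine Finset.sum_congr rfl fun i _ => Finset.sum_congr rfl fun k _ => ?_
      rw [smul_comm]
  have hT1 : ∑ j, ((S j)ᴴ * S j).trace =
      (frobeniusSq A : ℂ) * frobeniusSq M - ∑ j, (frobeniusSq (W j) : ℂ) := by
    simp only [hSS, trace_sub, trace_smul, trace_conjTranspose_mul_self_eq,
      Finset.sum_sub_distrib, smul_eq_mul, ← Finset.sum_mul, sum_sum_star_mul_self]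
  have hV : ∑ l, ∑ j, ((∑ i, star (A i l) * A i j) * (Mᴴ * M * ((annihilation n l)ᴴ *
      annihilation n j)).trace) =
        ∑ i, (frobeniusSq (∑ j, (star (A i j) • M) * (annihilation n j)ᴴ) : ℂ) := by
    have h : ∀ i, (frobeniusSq (∑ j, (star (A i j) • M) * (annihilation n j)ᴴ) : ℂ) =
        ∑ l, ∑ j, star (A i l) * A i j *
          (Mᴴ * M * ((annihilation n l)ᴴ * annihilation n j)).trace := by
      intro i
      rw [frobeniusSq_sum_mul, Finset.sum_comm]
      refine Finset.sum_congr rfl fun l _ => Finset.sum_congr rfl fun j _ => ?_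
      rw [conjTranspose_smul, star_star, conjTranspose_conjTranspose, Matrix.smul_mul,
        Matrix.mul_smul, smul_smul, Matrix.smul_mul, trace_smul, smul_eq_mul, mul_comm (A i j)]
    simp only [h, Finset.sum_mul]
    rw [Finset.sum_comm, Finset.sum_comm]
    conv_rhs => rw [Finset.sum_comm]
    exact Finset.sum_congr rfl fun l _ => Finset.sum_comm
  have hY : (frobeniusSq (contractOp n A M) : ℂ) =
      ∑ l, ∑ j, ((W j)ᴴ * W l * ((annihilation n l)ᴴ * annihilation n j)).trace := by
    rw [show contractOp n A M = ∑ j, W j * (annihilation n j)ᴴ from rfl, frobeniusSq_sum_mul,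
      Finset.sum_comm]
    simp only [conjTranspose_conjTranspose]
  have hX : (frobeniusSq (wedgeOp (n + 1) A M) : ℂ) = ∑ j, ((S j)ᴴ * S j).trace -
      ∑ l, ∑ j, ((S l)ᴴ * S j * ((annihilation n l)ᴴ * annihilation n j)).trace := by
    rw [show wedgeOp (n + 1) A M = ∑ j, S j * annihilation (n + 1) j from rfl, frobeniusSq_sum_mul]
    simp only [annihilation_mul_conjTranspose_succ, Matrix.mul_sub, Matrix.mul_smul, trace_sub,
      trace_smul, Finset.sum_sub_distrib, Matrix.mul_assoc (S _)ᴴ (S _) (antisymmetrizer _ _), hSM]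
    simp
  rw [← Complex.ofReal_inj, hX, hT1]
  push_cast
  rw [hY, ← hV, sub_add]
  congr 1
  rw [← Finset.sum_sub_distrib]
  refine Finset.sum_congr rfl fun l _ => ?_
  rw [← Finset.sum_sub_distrib]
  refine Finset.sum_congr rfl fun j _ => ?_
  rw [hSS, Matrix.sub_mul, trace_sub, Matrix.smul_mul, trace_smul, smul_eq_mul]

end PairBound

/-! ### The sharp bound for antisymmetrized products of matrices -/

section WedgeBound

variable {ι : Type*} [Fintype ι] [DecidableEq ι]

theorem conjTranspose_annihilation_mul_antisymmetrizer (n : ℕ) (i : ι) :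
    (annihilation n i)ᴴ * antisymmetrizer n ι = (annihilation n i)ᴴ := by
  have h := congrArg conjTranspose (antisymmetrizer_mul_annihilation n i)
  rwa [conjTranspose_mul, (antisymmetrizer_isHermitian n).eq] at h

theorem contractOp_mul_antisymmetrizer (n : ℕ) (A : Matrix ι ι ℂ)
    (M : Matrix (Fin (n + 1) → ι) (Fin (n + 1) → ι) ℂ) :
    contractOp n A M * antisymmetrizer n ι = contractOp n A M := by
  simp only [contractOp, Matrix.sum_mul, Matrix.mul_assoc,
    conjTranspose_annihilation_mul_antisymmetrizer]

/-- The full contraction is the left contraction followed by the column of operators `a_j†`, which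
is `√(d - n)` times an isometry on antisymmetric functions, so Cauchy–Schwarz applies. -/
theorem frobeniusSq_contractOp_le_left {n : ℕ} (hn : n < Fintype.card ι) (A : Matrix ι ι ℂ)
    (M : Matrix (Fin (n + 1) → ι) (Fin (n + 1) → ι) ℂ) : frobeniusSq (contractOp n A M) ≤
      (Fintype.card ι - n) * ∑ j, frobeniusSq (∑ i, star (A i j) • (annihilation n i * M)) := by
  refine frobeniusSq_sum_mul_le (P := antisymmetrizer n ι) (sub_pos.mpr (by exact_mod_cast hn)) ?_
    fun j => conjTranspose_annihilation_mul_antisymmetrizer n j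
  simp only [conjTranspose_conjTranspose, sum_annihilation_mul_conjTranspose]
  push_cast
  rfl

theorem frobeniusSq_contractOp_le_right {n : ℕ} (hn : n < Fintype.card ι) (A : Matrix ι ι ℂ)
    (M : Matrix (Fin (n + 1) → ι) (Fin (n + 1) → ι) ℂ) : frobeniusSq (contractOp n A M) ≤
      (Fintype.card ι - n) * ∑ i, frobeniusSq (∑ j, (star (A i j) • M) * (annihilation n j)ᴴ) := by
  have h := frobeniusSq_sum_mul_le (κ := ι)
    (W := fun i => (∑ j, (star (A i j) • M) * (annihilation n j)ᴴ)ᴴ)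
    (C := fun i => (annihilation n i)ᴴ) (P := antisymmetrizer n ι)
    (c := Fintype.card ι - n) (sub_pos.mpr (by exact_mod_cast hn))
    (by simp only [conjTranspose_conjTranspose, sum_annihilation_mul_conjTranspose]
        push_cast
        rfl)
    fun j => conjTranspose_annihilation_mul_antisymmetrizer n j
  simp only [frobeniusSq_conjTranspose, ← conjTranspose_mul, ← conjTranspose_sum] at h
  rw [contractOp_eq]
  simpa only [Matrix.smul_mul] using h

/-- An operator and its adjoint have the same norm. The proof expands the square of `M - r • wedgeOp
n A Y` and takes `r = 1/c`. -/
theorem frobeniusSq_contractOp_le_of_wedgeOp {n : ℕ} {A : Matrix ι ι ℂ} {c : ℝ} (hc : 0 ≤ c)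
    (h : ∀ K : Matrix (Fin n → ι) (Fin n → ι) ℂ, antisymmetrizer n ι * K = K →
      K * antisymmetrizer n ι = K → frobeniusSq (wedgeOp n A K) ≤ c * frobeniusSq K)
    (M : Matrix (Fin (n + 1) → ι) (Fin (n + 1) → ι) ℂ) :
    frobeniusSq (contractOp n A M) ≤ c * frobeniusSq M := by
  set Y := contractOp n A M with hY
  have hX := h Y (antisymmetrizer_mul_contractOp n A M) (contractOp_mul_antisymmetrizer n A M)
  have hd : ((wedgeOp n A Y)ᴴ * M).trace.re = frobeniusSq Y := by
    rw [trace_wedgeOp_conjTranspose_mul, ← hY, trace_conjTranspose_mul_self_eq, Complex.ofReal_re]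
  have key : ∀ r : ℝ, 0 ≤ frobeniusSq M - 2 * (r * frobeniusSq Y) + r * r * (c * frobeniusSq Y) := by
    intro r
    have h3 := frobeniusSq_nonneg (M - (r : ℂ) • wedgeOp n A Y)
    rw [frobeniusSq_sub, frobeniusSq_smul, conjTranspose_smul, Matrix.smul_mul, trace_smul,
      smul_eq_mul, Complex.star_def, Complex.conj_ofReal, Complex.re_ofReal_mul, hd,
      Complex.normSq_ofReal] at h3
    have := mul_le_mul_of_nonneg_left hX (mul_self_nonneg r)
    linarith
  have hYnn := frobeniusSq_nonneg Y
  rcases hc.eq_or_lt with rfl | hc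
  · have h1 := key ((frobeniusSq M + 1) / 2)
    have h2 := frobeniusSq_nonneg M
    have h3 := frobeniusSq_nonneg (wedgeOp n A Y)
    have h4 : wedgeOp n A Y = 0 := eq_zero_of_frobeniusSq_eq_zero (by linarith)
    rw [h4] at hd
    simp only [conjTranspose_zero, Matrix.zero_mul, trace_zero, Complex.zero_re] at hd
    linarith
  · have h1 := key c⁻¹
    have h2 : c⁻¹ * c⁻¹ * (c * frobeniusSq Y) = c⁻¹ * frobeniusSq Y := by field_simp
    rw [h2] at h1
    have : c⁻¹ * frobeniusSq Y ≤ frobeniusSq M := by linarith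
    rwa [inv_mul_le_iff₀ hc] at this

/-- The antisymmetrized product of a single-particle operator with an `n`-particle operator has
largest Hilbert–Schmidt norm for two identities. -/
theorem frobeniusSq_wedgeOp_le {n : ℕ} (hn : n < Fintype.card ι) (A : Matrix ι ι ℂ)
    (M : Matrix (Fin n → ι) (Fin n → ι) ℂ) (hM : antisymmetrizer n ι * M = M)
    (hM' : M * antisymmetrizer n ι = M) :
    frobeniusSq (wedgeOp n A M) ≤
      ((n + 1) * (Fintype.card ι - n) / Fintype.card ι * frobeniusSq A) * frobeniusSq M := by
  have hd : (0 : ℝ) < Fintype.card ι := by exact_mod_cast (Nat.zero_le n).trans_lt hn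
  induction n with
  | zero =>
    rw [frobeniusSq_wedgeOp_zero A M hM hM']
    simp [hd.ne']
  | succ n ih =>
    have hn' : n < Fintype.card ι := (Nat.lt_succ_self n).trans hn
    have hn2 : (n : ℝ) + 2 ≤ Fintype.card ι := by exact_mod_cast hn
    have hdn : (0 : ℝ) < Fintype.card ι - n := by linarith
    -- The induction hypothesis bounds the product with `A` one level lower; by duality the same
    -- constant bounds the contraction.
    have hY := frobeniusSq_contractOp_le_of_wedgeOp (A := A)
      (c := (n + 1) * (Fintype.card ι - n) / Fintype.card ι * frobeniusSq A)
      (by have := frobeniusSq_nonneg A; positivity) (fun K hK hK' => ih hn' K hK hK') M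
    have hl := frobeniusSq_contractOp_le_left hn' A M
    have hr := frobeniusSq_contractOp_le_right hn' A M
    rw [frobeniusSq_wedgeOp_succ n A M hM hM']
    set Y := frobeniusSq (contractOp n A M)
    set Z₁ := ∑ j, frobeniusSq (∑ i, star (A i j) • (annihilation n i * M))
    set Z₂ := ∑ i, frobeniusSq (∑ j, (star (A i j) • M) * (annihilation n j)ᴴ)
    set a := frobeniusSq A
    set m := frobeniusSq M
    set d : ℝ := (Fintype.card ι : ℝ)
    have hl' : Y / (d - n) ≤ Z₁ := by rwa [div_le_iff₀' hdn]
    have hr' : Y / (d - n) ≤ Z₂ := by rwa [div_le_iff₀' hdn]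
    -- Both one-sided contractions are at least `Y / (d - n)`, which leaves `Y` with the coefficient
    -- `1 - 2 / (d - n)`.
    have h1 : a * m - Z₁ - Z₂ + Y ≤ a * m + (d - n - 2) * (Y / (d - n)) := by
      have : (d - n - 2) * (Y / (d - n)) = Y - 2 * (Y / (d - n)) := by field_simp
      linarith
    have h2 : Y / (d - n) ≤ (n + 1) / d * a * m := by
      rw [div_le_iff₀ hdn]
      calc Y ≤ _ := hY
        _ = _ := by ring
    -- The coefficient is nonnegative since `n + 2 ≤ d`, so the upper bound for `Y` may be inserted.
    -- The constants then match through `d + (d - n - 2)(n + 1) = (n + 2)(d - n - 1)`.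
    have h3 : (d - n - 2) * (Y / (d - n)) ≤ (d - n - 2) * ((n + 1) / d * a * m) :=
      mul_le_mul_of_nonneg_left h2 (by linarith)
    refine (h1.trans (add_le_add_right h3 _)).trans (le_of_eq ?_)
    push_cast
    field_simp
    ring

/-- The creation operators already antisymmetrize all particles, so the inner antisymmetrizers are
absorbed; the two factors `√(n + 1)` of the annihilation operators produce the scalar. -/
theorem wedgeOp_eq (n : ℕ) (A : Fin (n + 1) → Matrix ι ι ℂ) :
    wedgeOp n (A 0) (antisymmetrizer n ι * productMatrix (fun k => A k.succ) *
      antisymmetrizer n ι) =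
      ((n : ℂ) + 1) •
        (antisymmetrizer (n + 1) ι * productMatrix A * antisymmetrizer (n + 1) ι) := by
  set K := productMatrix fun k : Fin n => A k.succ with hK
  have h1 : ∀ i j : ι, (annihilation n i)ᴴ * (antisymmetrizer n ι * K * antisymmetrizer n ι) *
      annihilation n j = (annihilation n i)ᴴ * K * annihilation n j := by
    intro i j
    rw [← Matrix.mul_assoc, ← Matrix.mul_assoc, conjTranspose_annihilation_mul_antisymmetrizer,
      Matrix.mul_assoc _ _ (annihilation n j), antisymmetrizer_mul_annihilation]
  simp only [wedgeOp, Matrix.sum_mul, Matrix.smul_mul, h1]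
  ext z w
  simp only [Matrix.sum_apply, Matrix.smul_apply, Matrix.mul_apply, sum_consVec, smul_eq_mul,
    Finset.sum_mul, Finset.mul_sum, conjTranspose_annihilation_apply, annihilation_apply]
  refine Finset.sum_congr rfl fun j _ => ?_
  rw [Finset.sum_comm]
  refine Finset.sum_congr rfl fun y _ => Finset.sum_congr rfl fun i _ =>
    Finset.sum_congr rfl fun x _ => ?_
  rw [productMatrix_apply, Fin.prod_univ_succ, ← sqrt_mul_sqrt_natCast_add_one, hK,
    productMatrix_apply]
  simp only [Fin.cons_zero, Fin.cons_succ]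
  ring

/-- The Hilbert–Schmidt norm of `P (A₁ ⊗ ⋯ ⊗ Aₙ) P`, squared. -/
def wedgeNormSq {n : ℕ} (A : Fin n → Matrix ι ι ℂ) : ℝ :=
  frobeniusSq (antisymmetrizer n ι * productMatrix A * antisymmetrizer n ι)

theorem wedgeNormSq_succ {n : ℕ} (A : Fin (n + 1) → Matrix ι ι ℂ) :
    ((n : ℝ) + 1) ^ 2 * wedgeNormSq A = frobeniusSq (wedgeOp n (A 0)
      (antisymmetrizer n ι * productMatrix (fun k => A k.succ) * antisymmetrizer n ι)) := by
  rw [wedgeOp_eq, frobeniusSq_smul, wedgeNormSq,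
    show (n : ℂ) + 1 = ((n + 1 : ℕ) : ℂ) by push_cast; rfl, Complex.normSq_natCast, sq]
  push_cast
  rfl

theorem wedgeNormSq_succ_le {n : ℕ} (hn : n < Fintype.card ι) (A : Fin (n + 1) → Matrix ι ι ℂ) :
    wedgeNormSq A ≤ (Fintype.card ι - n) / ((n + 1) * Fintype.card ι) * frobeniusSq (A 0) *
      wedgeNormSq fun k => A k.succ := by
  have hd : (0 : ℝ) < Fintype.card ι := by exact_mod_cast (Nat.zero_le n).trans_lt hn
  have hP := antisymmetrizer_mul_self (ι := ι) n
  have h := frobeniusSq_wedgeOp_le hn (A 0)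
    (antisymmetrizer n ι * productMatrix (fun k => A k.succ) * antisymmetrizer n ι)
    (by rw [Matrix.mul_assoc, ← Matrix.mul_assoc, hP]) (by rw [Matrix.mul_assoc, hP])
  rw [← wedgeNormSq_succ] at h
  have hn1 : (0 : ℝ) < (n + 1) ^ 2 := by positivity
  refine le_of_mul_le_mul_left (h.trans (le_of_eq ?_)) hn1
  rw [wedgeNormSq]
  field_simp

/-- Iterating the one-particle step multiplies the factors `(d - k) / ((k + 1) d)`, whose product is
the binomial quotient. -/
theorem wedgeNormSq_le {n : ℕ} (hn : n ≤ Fintype.card ι) (A : Fin n → Matrix ι ι ℂ) :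
    wedgeNormSq A ≤
      (Fintype.card ι).choose n / (Fintype.card ι : ℝ) ^ n * ∏ k, frobeniusSq (A k) := by
  induction n with
  | zero =>
    simp [wedgeNormSq, frobeniusSq, antisymmetrizer_apply, productMatrix_apply, Matrix.mul_apply]
  | succ n ih =>
    have hd : (0 : ℝ) < Fintype.card ι := by exact_mod_cast (Nat.zero_le n).trans_lt hn
    have hdn : (0 : ℝ) < Fintype.card ι - n := sub_pos.mpr (by exact_mod_cast hn)
    have hch : ((Fintype.card ι).choose (n + 1) : ℝ) =
        (Fintype.card ι).choose n * (Fintype.card ι - n) / (n + 1) := by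
      rw [eq_div_iff (by positivity), ← Nat.cast_sub (Nat.le_of_succ_le hn)]
      exact_mod_cast Nat.choose_succ_right_eq _ _
    have hA := frobeniusSq_nonneg (A 0)
    refine (wedgeNormSq_succ_le hn A).trans ?_
    refine (mul_le_mul_of_nonneg_left (ih (Nat.le_of_succ_le hn) fun k => A k.succ)
      (by positivity)).trans (le_of_eq ?_)
    rw [Fin.prod_univ_succ, hch]
    field_simp
    ring

end WedgeBound

/-! ### The case of equality -/

section WedgeEquality

variable {ι : Type*} [Fintype ι]

theorem exists_smul_eq_of_frobenius_eq {A B : Matrix ι ι ℂ} (hA : frobeniusSq A = 1)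
    (hB : frobeniusSq B = 1) (h : Complex.normSq (Aᴴ * B).trace = 1) :
    B = (Aᴴ * B).trace • A := by
  set c := (Aᴴ * B).trace with hc
  refine sub_eq_zero.mp (eq_zero_of_frobeniusSq_eq_zero ?_)
  rw [frobeniusSq_sub, frobeniusSq_smul, conjTranspose_smul, Matrix.smul_mul, trace_smul, ← hc,
    hA, hB, h, smul_eq_mul, Complex.star_def, ← Complex.normSq_eq_conj_mul_self, h,
    Complex.ofReal_one, Complex.one_re]
  norm_num

theorem eq_smul_one_of_frobeniusSq_conjTranspose_mul_self [DecidableEq ι] {A : Matrix ι ι ℂ}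
    (hd : 0 < Fintype.card ι) (hA : frobeniusSq A = 1)
    (h : frobeniusSq (A * Aᴴ) = (Fintype.card ι : ℝ)⁻¹) :
    A * Aᴴ = (Fintype.card ι : ℂ)⁻¹ • (1 : Matrix ι ι ℂ) := by
  have h0 : (Fintype.card ι : ℝ) ≠ 0 := by exact_mod_cast hd.ne'
  have htr : (A * Aᴴ).trace = 1 := by
    rw [trace_mul_comm, trace_conjTranspose_mul_self_eq, hA, Complex.ofReal_one]
  have h1 : frobeniusSq (1 : Matrix ι ι ℂ) = Fintype.card ι := by
    have := trace_conjTranspose_mul_self_eq (1 : Matrix ι ι ℂ)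
    rw [conjTranspose_one, Matrix.one_mul, trace_one] at this
    exact_mod_cast this.symm
  refine sub_eq_zero.mp (eq_zero_of_frobeniusSq_eq_zero ?_)
  rw [frobeniusSq_sub, h, frobeniusSq_smul, h1, conjTranspose_smul, conjTranspose_one,
    Matrix.smul_mul, Matrix.one_mul, trace_smul, htr, map_inv₀, Complex.normSq_natCast]
  simp
  field_simp
  ring

theorem sum_fin_one {R : Type*} [AddCommMonoid R] (f : (Fin 1 → ι) → R) :
    ∑ z, f z = ∑ i, f fun _ => i :=
  ((Equiv.funUnique (Fin 1) ι).symm.sum_comp f).symm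

variable [DecidableEq ι]

theorem antisymmetrizer_one {ι : Type*} [DecidableEq ι] : antisymmetrizer 1 ι = 1 := by
  ext x y
  simp [antisymmetrizer_apply, Matrix.one_apply, funext_iff]

theorem annihilation_zero_apply {ι : Type*} [DecidableEq ι] (i : ι) (x : Fin 0 → ι) (z : Fin 1 → ι) :
    annihilation 0 i x z = if z 0 = i then 1 else 0 := by
  rw [annihilation_apply, antisymmetrizer_one]
  simp [Matrix.one_apply, funext_iff, eq_comm]

theorem sum_smul_annihilation_zero_mul_apply (A : Matrix ι ι ℂ)
    (B : Fin 1 → Matrix ι ι ℂ) (j : ι) (x : Fin 0 → ι) (w : Fin 1 → ι) :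
    (∑ i, star (A i j) • (annihilation 0 i * productMatrix B)) x w = (Aᴴ * B 0) j (w 0) := by
  simp [Matrix.sum_apply, Matrix.mul_apply, annihilation_zero_apply, sum_fin_one,
    productMatrix_apply]

theorem contractOp_zero_apply (A : Matrix ι ι ℂ) (B : Fin 1 → Matrix ι ι ℂ) (x y : Fin 0 → ι) :
    contractOp 0 A (productMatrix B) x y = (Aᴴ * B 0).trace := by
  rw [contractOp, Matrix.sum_apply]
  refine Finset.sum_congr rfl fun j _ => ?_
  rw [Matrix.mul_apply, sum_fin_one]
  simp only [conjTranspose_apply, annihilation_zero_apply]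
  simp only [apply_ite, star_one, star_zero, mul_one, mul_zero, Finset.sum_ite_eq',
    Finset.mem_univ, if_true]
  exact sum_smul_annihilation_zero_mul_apply A B j x fun _ => j

/-- For two normalized matrices the norm is `(1 - Z₁ - Z₂ + Y) / 4` with `Y = |tr (A 0)ᴴ (A 1)|² ≤
1` and `Z₁, Z₂ ≥ Y / d`. Equality forces `Y = 1`, which is the equality case of Cauchy–Schwarz, and
`Z₁ = 1 / d`, which makes `A 0` a multiple of a unitary. -/
theorem exists_smul_and_isometry_of_wedgeNormSq_two (hd : 3 ≤ Fintype.card ι)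
    {A : Fin 2 → Matrix ι ι ℂ} (hA : ∀ k, frobeniusSq (A k) = 1)
    (h : (Fintype.card ι).choose 2 / (Fintype.card ι : ℝ) ^ 2 ≤ wedgeNormSq A) :
    (∃ c : ℂ, A 1 = c • A 0) ∧ A 0 * (A 0)ᴴ = (Fintype.card ι : ℂ)⁻¹ • (1 : Matrix ι ι ℂ) := by
  have hd3 : (3 : ℝ) ≤ Fintype.card ι := by exact_mod_cast hd
  set B : Fin 1 → Matrix ι ι ℂ := fun k => A k.succ with hB
  have hcard : 0 < Fintype.card ι := by omega
  have h2 := wedgeNormSq_succ A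
  rw [antisymmetrizer_one, Matrix.one_mul, Matrix.mul_one,
    frobeniusSq_wedgeOp_succ 0 (A 0) _ (by rw [antisymmetrizer_one, Matrix.one_mul])
      (by rw [antisymmetrizer_one, Matrix.mul_one])] at h2
  have hl := frobeniusSq_contractOp_le_left hcard (A 0) (productMatrix B)
  have hr := frobeniusSq_contractOp_le_right hcard (A 0) (productMatrix B)
  have hM : frobeniusSq (productMatrix B) = 1 := by
    rw [← hA 1]
    simp [frobeniusSq, sum_fin_one, productMatrix_apply, hB]
  have hY : frobeniusSq (contractOp 0 (A 0) (productMatrix B)) =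
      Complex.normSq ((A 0)ᴴ * A 1).trace := by
    simp [frobeniusSq, contractOp_zero_apply, hB]
  have hZ : ∑ j, frobeniusSq (∑ i, star (A 0 i j) • (annihilation 0 i * productMatrix B)) =
      frobeniusSq ((A 0)ᴴ * A 1) := by
    simp only [frobeniusSq, sum_smul_annihilation_zero_mul_apply, sum_fin_one, hB]
    simp
  have hY1 : frobeniusSq (contractOp 0 (A 0) (productMatrix B)) ≤ 1 := by
    have := frobeniusSq_contractOp_le_of_wedgeOp (n := 0) (A := A 0) (c := 1) zero_le_one
      (fun K hK hK' => by rw [frobeniusSq_wedgeOp_zero _ _ hK hK', hA]) (productMatrix B)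
    rwa [hM, mul_one] at this
  rw [hY] at hl hr hY1 h2
  rw [hA, hM, hZ] at h2
  rw [hZ] at hl
  set Y := Complex.normSq ((A 0)ᴴ * A 1).trace
  set Z₁ := frobeniusSq ((A 0)ᴴ * A 1)
  set Z₂ := ∑ i, frobeniusSq (∑ j, (star (A 0 i j) • productMatrix B) * (annihilation 0 j)ᴴ)
  set d : ℝ := (Fintype.card ι : ℝ)
  have hch : ((Fintype.card ι).choose 2 : ℝ) = d * (d - 1) / 2 := Nat.cast_choose_two ℝ _
  have hw : 2 * (d - 1) / d ≤ 2 ^ 2 * wedgeNormSq A := by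
    rw [hch] at h
    have h5 : d * (d - 1) / 2 / d ^ 2 = (2 * (d - 1) / d) / 2 ^ 2 := by
      field_simp
    rw [h5, div_le_iff₀' (by norm_num)] at h
    exact h
  norm_num at h2 hl hr hw
  rw [h2] at hw
  have hd0 : (0 : ℝ) < d := by linarith
  have hw' : 2 * (d - 1) ≤ (1 - Z₁ - Z₂ + Y) * d := by rwa [div_le_iff₀ hd0] at hw
  have hYeq : Y = 1 := by
    -- The estimates leave `d - 2 ≤ (d - 2) Y`, which is informative only for `d > 2`.
    refine le_antisymm hY1 ?_
    have : (d - 2) * 1 ≤ (d - 2) * Y := by nlinarith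
    exact le_of_mul_le_mul_left this (by linarith)
  have hZeq : Z₁ = d⁻¹ := by
    refine eq_inv_of_mul_eq_one_left ?_
    rw [hYeq] at hw' hl hr
    nlinarith
  have hA1 := exists_smul_eq_of_frobenius_eq (hA 0) (hA 1) hYeq
  set c := ((A 0)ᴴ * A 1).trace with hcdef
  refine ⟨⟨c, hA1⟩, ?_⟩
  refine eq_smul_one_of_frobeniusSq_conjTranspose_mul_self hcard (hA 0) ?_
  have hZ' : frobeniusSq ((A 0)ᴴ * A 0) = d⁻¹ := by
    rw [← hZeq]
    change _ = frobeniusSq ((A 0)ᴴ * A 1)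
    rw [hA1, Matrix.mul_smul, frobeniusSq_smul]
    change _ = Y * _
    rw [hYeq, one_mul]
  rw [← hZ']
  have e1 := trace_conjTranspose_mul_self_eq (A 0 * (A 0)ᴴ)
  have e2 := trace_conjTranspose_mul_self_eq ((A 0)ᴴ * A 0)
  rw [conjTranspose_mul, conjTranspose_conjTranspose] at e1 e2
  rw [← Complex.ofReal_inj, ← e1, ← e2, Matrix.mul_assoc, trace_mul_comm]
  simp only [Matrix.mul_assoc]

/-- Equality for `A` forces equality in the bound for its tail, so the descent ends at the last two
matrices; other pairs are reached by permuting the factors. -/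
theorem exists_smul_and_isometry_of_wedgeNormSq {n : ℕ} (hd : 3 ≤ Fintype.card ι)
    (hn : n + 2 ≤ Fintype.card ι) {A : Fin (n + 2) → Matrix ι ι ℂ}
    (hA : ∀ k, frobeniusSq (A k) = 1)
    (h : (Fintype.card ι).choose (n + 2) / (Fintype.card ι : ℝ) ^ (n + 2) ≤ wedgeNormSq A) :
    (∃ c : ℂ, A (Fin.last (n + 1)) = c • A (Fin.last n).castSucc) ∧
      A (Fin.last n).castSucc * (A (Fin.last n).castSucc)ᴴ =
        (Fintype.card ι : ℂ)⁻¹ • (1 : Matrix ι ι ℂ) := by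
  induction n with
  | zero => exact exists_smul_and_isometry_of_wedgeNormSq_two hd hA h
  | succ n ih =>
    refine ih (Nat.le_of_succ_le hn) (A := fun k => A k.succ) (fun k => hA _) ?_
    have h1 := h.trans (wedgeNormSq_succ_le (n := n + 2) hn A)
    have hdn : (0 : ℝ) < Fintype.card ι - (n + 2 : ℕ) := sub_pos.mpr (by exact_mod_cast hn)
    have hd0 : (0 : ℝ) < Fintype.card ι := by exact_mod_cast (by omega : 0 < Fintype.card ι)
    have hch : ((Fintype.card ι).choose (n + 2 + 1) : ℝ) =
        (Fintype.card ι).choose (n + 2) * (Fintype.card ι - (n + 2 : ℕ)) / ((n + 2 : ℕ) + 1) := by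
      rw [eq_div_iff (by positivity), ← Nat.cast_sub (Nat.le_of_succ_le hn)]
      exact_mod_cast Nat.choose_succ_right_eq _ _
    rw [hA, mul_one, show n + 1 + 2 = n + 2 + 1 from rfl, hch] at h1
    have hpos : 0 < (Fintype.card ι - (n + 2 : ℕ) : ℝ) / (((n + 2 : ℕ) + 1) * Fintype.card ι) := by
      positivity
    refine le_of_mul_le_mul_left (le_trans (le_of_eq ?_) h1) hpos
    field_simp
    ring

theorem wedgeNormSq_comp_perm {n : ℕ} (A : Fin n → Matrix ι ι ℂ) (π : Equiv.Perm (Fin n)) :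
    wedgeNormSq (A ∘ π) = wedgeNormSq A := by
  set s : ℂ := ((Equiv.Perm.sign π : ℤ) : ℂ)
  have hs : s * s = 1 := by
    rw [← Int.cast_mul, Int.units_coe_mul_self, Int.cast_one]
  have hre : ∀ f : (Fin n → ι) → ℂ, ∑ x, f (x ∘ π) = ∑ x, f x := fun f =>
    (π.arrowCongr (Equiv.refl ι)).symm.sum_comp f
  have h : antisymmetrizer n ι * productMatrix (A ∘ π) * antisymmetrizer n ι =
      antisymmetrizer n ι * productMatrix A * antisymmetrizer n ι := by
    ext z w
    simp only [Matrix.mul_apply]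
    rw [← hre]
    refine Finset.sum_congr rfl fun y _ => ?_
    rw [← hre, antisymmetrizer_comp_left, ← mul_assoc, Finset.sum_mul, Finset.sum_mul,
      Finset.sum_mul]
    refine Finset.sum_congr rfl fun x _ => ?_
    rw [antisymmetrizer_comp_right, productMatrix_apply, productMatrix_apply]
    have : ∏ k, (A ∘ π) k ((x ∘ π) k) ((y ∘ π) k) = ∏ k, A k (x k) (y k) :=
      Equiv.prod_comp π fun k => A k (x k) (y k)
    rw [this]
    linear_combination antisymmetrizer n ι z x * (∏ k, A k (x k) (y k)) *
      antisymmetrizer n ι y w * hs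
  rw [wedgeNormSq, wedgeNormSq, h]

/-- For at least three dimensions the bound of `wedgeNormSq_le` is attained only by multiples of
one unitary. -/
theorem exists_smul_and_isometry_of_le_wedgeNormSq {n : ℕ} (hd : 3 ≤ Fintype.card ι)
    (hn : n ≤ Fintype.card ι) {A : Fin n → Matrix ι ι ℂ} (hA : ∀ k, frobeniusSq (A k) = 1)
    (h : (Fintype.card ι).choose n / (Fintype.card ι : ℝ) ^ n ≤ wedgeNormSq A)
    {k l : Fin n} (hkl : k ≠ l) :
    (∃ c : ℂ, A l = c • A k) ∧ A k * (A k)ᴴ = (Fintype.card ι : ℂ)⁻¹ • (1 : Matrix ι ι ℂ) := by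
  obtain _ | _ | n := n
  · exact k.elim0
  · exact absurd (by omega) hkl
  · have hinj : Function.Injective ![k, l] := by
      intro a b
      fin_cases a <;> fin_cases b <;> simp [hkl, hkl.symm]
    have hinj' : Function.Injective ![(Fin.last n).castSucc, Fin.last (n + 1)] := by
      intro a b
      fin_cases a <;> fin_cases b <;>
        simp [(Fin.castSucc_lt_last _).ne, (Fin.castSucc_lt_last _).ne']
    obtain ⟨π, hπ⟩ : ∃ π : Equiv.Perm (Fin (n + 2)), π (Fin.last n).castSucc = k ∧
        π (Fin.last (n + 1)) = l := by
      obtain ⟨π, hπ⟩ := Equiv.Perm.exists_extending_pair _ _ hinj' hinj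
      exact ⟨π, hπ 0, hπ 1⟩
    have := exists_smul_and_isometry_of_wedgeNormSq hd hn (A := A ∘ π) (fun k => hA _)
      (by rwa [wedgeNormSq_comp_perm])
    simpa only [Function.comp_apply, hπ.1, hπ.2] using this

end WedgeEquality

/-! ### Two copies: closest product states and maximally entangled vectors -/

section TwoCopies

variable {N d : ℕ}

/-- A vector of `ℂ^d ⊗ ℂ^d` as a `d × d` matrix. -/
def vectorMatrix (ψ : EuclideanSpace ℂ (Fin 2 → Fin d)) : Matrix (Fin d) (Fin d) ℂ :=
  Matrix.of fun i j => ψ ![i, j]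

theorem vectorMatrix_apply (ψ : EuclideanSpace ℂ (Fin 2 → Fin d)) (i j : Fin d) :
    vectorMatrix ψ i j = ψ ![i, j] := rfl

theorem reducedStateFirst_eq (ψ : EuclideanSpace ℂ (Fin 2 → Fin d)) :
    reducedStateFirst ψ = vectorMatrix ψ * (vectorMatrix ψ)ᴴ := rfl

theorem vectorMatrix_injective : Function.Injective (vectorMatrix (d := d)) := by
  intro ψ χ h
  ext x
  have := congrFun (congrFun h (x 0)) (x 1)
  rw [vectorMatrix_apply, vectorMatrix_apply] at this
  rwa [show x = ![x 0, x 1] from List.ofFn_inj.mp rfl]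

theorem vectorMatrix_smul (c : ℂ) (ψ : EuclideanSpace ℂ (Fin 2 → Fin d)) :
    vectorMatrix (c • ψ) = c • vectorMatrix ψ := rfl

theorem frobeniusSq_vectorMatrix (ψ : EuclideanSpace ℂ (Fin 2 → Fin d)) :
    frobeniusSq (vectorMatrix ψ) = ‖ψ‖ ^ 2 := by
  rw [EuclideanSpace.norm_sq_eq, ← (finTwoArrowEquiv (Fin d)).symm.sum_comp,
    Fintype.sum_prod_type, frobeniusSq]
  simp only [Complex.normSq_eq_norm_sq]
  rfl

theorem IsMaximallyEntangled.norm_eq_one {ψ : EuclideanSpace ℂ (Fin 2 → Fin d)}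
    (hψ : IsMaximallyEntangled ψ) (hd : 0 < d) : ‖ψ‖ = 1 := by
  have h0 : (d : ℂ) ≠ 0 := by exact_mod_cast hd.ne'
  have h := congrArg Matrix.trace hψ
  rw [reducedStateFirst_eq, trace_mul_comm, trace_conjTranspose_mul_self_eq, trace_smul, trace_one,
    Fintype.card_fin, smul_eq_mul, inv_mul_cancel₀ h0, frobeniusSq_vectorMatrix] at h
  have h1 : ‖ψ‖ ^ 2 = 1 := by exact_mod_cast h
  exact (pow_eq_one_iff_of_nonneg (norm_nonneg _) two_ne_zero).mp h1

theorem exists_isMaximallyEntangled (d : ℕ) :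
    ∃ ψ : EuclideanSpace ℂ (Fin 2 → Fin d), IsMaximallyEntangled ψ := by
  refine ⟨WithLp.toLp 2 fun x => if x 0 = x 1 then ((√(d : ℝ))⁻¹ : ℂ) else 0, ?_⟩
  ext i j
  have h : ((√(d : ℝ) : ℂ))⁻¹ * ((√(d : ℝ) : ℂ))⁻¹ = (d : ℂ)⁻¹ := by
    rw [← mul_inv, ← Complex.ofReal_mul, Real.mul_self_sqrt (Nat.cast_nonneg d),
      Complex.ofReal_natCast]
  by_cases hij : i = j
  · subst hij
    simp [reducedStateFirst, h]
  · simp [reducedStateFirst, hij, Ne.symm hij]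

/-- The pair of tuples formed by the first and the second particles of the parties. -/
def particlesEquiv (N : ℕ) (κ : Type*) :
    (Fin N → κ) × (Fin N → κ) ≃ (Fin N → Fin 2 → κ) where
  toFun p k := ![p.1 k, p.2 k]
  invFun x := (fun k => x k 0, fun k => x k 1)
  left_inv p := rfl
  right_inv x := by
    ext k l
    fin_cases l <;> rfl

/-- Reading first particles as rows and second particles as columns, the vector is the matrix `K`
and `P ⊗ P` acts by `K ↦ P K Pᵀ`, where `Pᵀ = P`. -/
theorem expectation_copies_two_antisymmetrizer (a : Fin N → EuclideanSpace ℂ (Fin 2 → Fin d)) :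
    expectation (copies 2 (antisymmetrizer N (Fin d))) (productVector a) =
      wedgeNormSq fun k => vectorMatrix (a k) := by
  set P := antisymmetrizer N (Fin d) with hP
  set K := productMatrix fun k => vectorMatrix (a k) with hK
  have hPP : P * P = P := antisymmetrizer_mul_self N
  have hPH : Pᴴ = P := antisymmetrizer_isHermitian N
  have h1 : (wedgeNormSq (fun k => vectorMatrix (a k)) : ℂ) = (Kᴴ * (P * K * P)).trace := by
    rw [wedgeNormSq, ← trace_conjTranspose_mul_self_eq, conjTranspose_mul, conjTranspose_mul, hPH,
      ← hK, trace_mul_comm]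
    have : P * K * P * (P * (Kᴴ * P)) = P * K * P * Kᴴ * P := by
      rw [← Matrix.mul_assoc (P * K * P) P, Matrix.mul_assoc (P * K) P P, hPP]
      simp only [Matrix.mul_assoc]
    rw [this, trace_mul_comm, ← Matrix.mul_assoc, ← Matrix.mul_assoc, ← Matrix.mul_assoc, hPP,
      trace_mul_comm]
  rw [← Complex.ofReal_re (wedgeNormSq _), h1, expectation]
  congr 1
  simp only [dotProduct, mulVec, Matrix.trace, diag_apply, Matrix.mul_apply (M := Kᴴ)]
  rw [← (particlesEquiv N (Fin d)).sum_comp, Fintype.sum_prod_type, Finset.sum_comm]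
  refine Finset.sum_congr rfl fun w _ => Finset.sum_congr rfl fun x _ => ?_
  congr 1
  rw [← (particlesEquiv N (Fin d)).sum_comp, Fintype.sum_prod_type, Finset.sum_comm]
  simp only [Matrix.mul_apply, Finset.sum_mul]
  refine Finset.sum_congr rfl fun z _ => Finset.sum_congr rfl fun y _ => ?_
  have hcop : copies 2 P (particlesEquiv N (Fin d) (x, w)) (particlesEquiv N (Fin d) (y, z)) =
      P x y * P w z := by
    rw [copies, tensorState, of_apply, Fin.prod_univ_two]
    rfl
  rw [hcop, show P z w = P w z from antisymmetrizer_comm z w,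
    show (productVector a).ofLp (particlesEquiv N (Fin d) (y, z)) = K y z from rfl]
  ring

/-- A tensor power commutes with permutations of the parties, so one of the two antisymmetrizers is
redundant, and `K Kᴴ` is the scalar `d⁻ᴺ`. What remains is `tr P / dᴺ`. -/
theorem wedgeNormSq_const_of_isometry {ι : Type*} [Fintype ι] [DecidableEq ι] {A : Matrix ι ι ℂ}
    (hA : A * Aᴴ = (Fintype.card ι : ℂ)⁻¹ • (1 : Matrix ι ι ℂ)) :
    wedgeNormSq (fun _ : Fin N => A) =
      (Fintype.card ι).choose N / (Fintype.card ι : ℝ) ^ N := by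
  set P := antisymmetrizer N ι with hP
  set K := productMatrix fun _ : Fin N => A with hK
  have hPP : P * P = P := antisymmetrizer_mul_self N
  have hPH : Pᴴ = P := antisymmetrizer_isHermitian N
  have h1 : P * K * P = P * K := by
    have h := antisymmetrizer_mul_eq (M := (P * K)ᵀ) fun π y x => by
      have hre : ∀ f : (Fin N → ι) → ℂ, ∑ x, f (x ∘ π) = ∑ x, f x := fun f =>
        (π.arrowCongr (Equiv.refl ι)).symm.sum_comp f
      rw [transpose_apply, transpose_apply, Matrix.mul_apply, Matrix.mul_apply, ← hre,
        Finset.mul_sum]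
      refine Finset.sum_congr rfl fun z _ => ?_
      rw [show P x (z ∘ π) = _ from antisymmetrizer_comp_right π x z, mul_assoc]
      congr 2
      exact Equiv.prod_comp π fun k => A (z k) (y k)
    have h' := congrArg transpose h
    rwa [transpose_mul, transpose_transpose, antisymmetrizer_transpose] at h'
  have h2 : K * Kᴴ = ((Fintype.card ι : ℂ) ^ N)⁻¹ • (1 : Matrix (Fin N → ι) (Fin N → ι) ℂ) := by
    rw [hK, conjTranspose_productMatrix, productMatrix_mul]
    ext x y
    simp only [productMatrix_apply, hA, Matrix.smul_apply, Matrix.one_apply, smul_eq_mul,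
      Finset.prod_mul_distrib, Finset.prod_const, Finset.card_univ, Fintype.card_fin, inv_pow,
      Finset.prod_boole, funext_iff, Finset.mem_univ, true_imp_iff]
  rw [wedgeNormSq, ← Complex.ofReal_inj, ← hP, ← hK, h1, ← trace_conjTranspose_mul_self_eq,
    trace_mul_comm, conjTranspose_mul, hPH, Matrix.mul_assoc, ← Matrix.mul_assoc K, h2,
    Matrix.smul_mul, Matrix.one_mul, Matrix.mul_smul, hPP, trace_smul, trace_antisymmetrizer]
  push_cast
  rw [smul_eq_mul, div_eq_inv_mul]

theorem antisymmetricProjectorState_eq (d N : ℕ) : antisymmetricProjectorState d N =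
    (d.choose N : ℂ)⁻¹ • antisymmetrizer N (Fin d) := by
  rw [antisymmetricProjectorState, antisymmetricProjector_eq, trace_antisymmetrizer,
    Fintype.card_fin]

theorem copies_smul {κ : Type*} (n : ℕ) (c : ℂ) (ρ : Matrix (Fin N → κ) (Fin N → κ) ℂ) :
    copies n (c • ρ) = c ^ n • copies n ρ := by
  ext x y
  simp [copies, tensorState, Finset.prod_mul_distrib]

theorem expectation_ofReal_smul {α : Type*} [Fintype α] (c : ℝ) (ρ : Matrix α α ℂ)
    (φ : EuclideanSpace ℂ α) : expectation ((c : ℂ) • ρ) φ = c * expectation ρ φ := by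
  rw [expectation, smul_mulVec, dotProduct_smul, smul_eq_mul, Complex.re_ofReal_mul, expectation]

theorem expectation_copies_two (a : Fin N → EuclideanSpace ℂ (Fin 2 → Fin d)) :
    expectation (copies 2 (antisymmetricProjectorState d N)) (productVector a) =
      ((d.choose N : ℝ)⁻¹) ^ 2 * wedgeNormSq fun k => vectorMatrix (a k) := by
  rw [antisymmetricProjectorState_eq, copies_smul, ← expectation_copies_two_antisymmetrizer,
    ← expectation_ofReal_smul]
  push_cast
  rfl

theorem expectation_copies_two_le (hd : N ≤ d) {φ : EuclideanSpace ℂ (Fin N → Fin 2 → Fin d)}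
    (hφ : φ ∈ productStates N (Fin 2 → Fin d)) :
    expectation (copies 2 (antisymmetricProjectorState d N)) φ ≤
      ((d.choose N : ℝ)⁻¹) ^ 2 * (d.choose N / (d : ℝ) ^ N) := by
  obtain ⟨a, ha, rfl⟩ := hφ
  rw [expectation_copies_two]
  have h := wedgeNormSq_le (ι := Fin d) (n := N) (by simpa using hd) fun k => vectorMatrix (a k)
  simp only [frobeniusSq_vectorMatrix, ha, one_pow, Finset.prod_const_one, mul_one,
    Fintype.card_fin] at h
  gcongr

theorem expectation_copies_two_of_isMaximallyEntangled
    {ψ : EuclideanSpace ℂ (Fin 2 → Fin d)} (hψ : IsMaximallyEntangled ψ) :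
    expectation (copies 2 (antisymmetricProjectorState d N)) (productVector fun _ : Fin N => ψ) =
      ((d.choose N : ℝ)⁻¹) ^ 2 * (d.choose N / (d : ℝ) ^ N) := by
  have h : wedgeNormSq (fun _ : Fin N => vectorMatrix ψ) = d.choose N / (d : ℝ) ^ N := by
    have := wedgeNormSq_const_of_isometry (N := N) (A := vectorMatrix ψ)
      (by rw [← reducedStateFirst_eq, Fintype.card_fin]; exact hψ)
    rwa [Fintype.card_fin] at this
  rw [expectation_copies_two, h]

theorem maxOverlapSq_copies_two (hd : N ≤ d) (hd0 : 0 < d) :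
    maxOverlapSq (copies 2 (antisymmetricProjectorState d N)) =
      ((d.choose N : ℝ)⁻¹) ^ 2 * (d.choose N / (d : ℝ) ^ N) := by
  obtain ⟨ψ, hψ⟩ := exists_isMaximallyEntangled d
  exact maxOverlapSq_eq_of_isGreatest (fun φ hφ => expectation_copies_two_le hd hφ)
    ⟨_, ⟨_, fun _ => hψ.norm_eq_one hd0, rfl⟩, expectation_copies_two_of_isMaximallyEntangled hψ⟩

theorem isClosestProductState_copies_two (hd : N ≤ d) (hd0 : 0 < d)
    {ψ : EuclideanSpace ℂ (Fin 2 → Fin d)} (hψ : IsMaximallyEntangled ψ) :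
    IsClosestProductState (copies 2 (antisymmetricProjectorState d N))
      (productVector fun _ : Fin N => ψ) :=
  ⟨⟨_, fun _ => hψ.norm_eq_one hd0, rfl⟩, by
    rw [expectation_copies_two_of_isMaximallyEntangled hψ, maxOverlapSq_copies_two hd hd0]⟩

/-- A maximizer attains the matrix bound, and `d ≥ N ≥ 3` puts it in the rigid case: all local
vectors agree up to phases. -/
theorem eq_productVector_of_isClosestProductState_copies_two (hN : 3 ≤ N) (hd : N ≤ d)
    {φ : EuclideanSpace ℂ (Fin N → Fin 2 → Fin d)}
    (hφ : IsClosestProductState (copies 2 (antisymmetricProjectorState d N)) φ) :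
    ∃ ψ : EuclideanSpace ℂ (Fin 2 → Fin d), IsMaximallyEntangled ψ ∧
      φ = productVector fun _ : Fin N => ψ := by
  obtain ⟨⟨a, ha, rfl⟩, h⟩ := hφ
  have hd0 : 0 < d := by omega
  have hch : (0 : ℝ) < d.choose N := by exact_mod_cast Nat.choose_pos hd
  rw [expectation_copies_two, maxOverlapSq_copies_two hd hd0] at h
  have h := mul_left_cancel₀ (by positivity) h
  have hfrob : ∀ k, frobeniusSq (vectorMatrix (a k)) = 1 := fun k => by
    rw [frobeniusSq_vectorMatrix, ha, one_pow]
  have key := fun {k l : Fin N} (hkl : k ≠ l) => exists_smul_and_isometry_of_le_wedgeNormSq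
    (ι := Fin d) (by simpa using hN.trans hd) (by simpa using hd) hfrob
    (by rw [h, Fintype.card_fin]) hkl
  set k₀ : Fin N := ⟨0, by omega⟩
  have hiso := (key (k := k₀) (l := ⟨1, by omega⟩) (by simp [k₀, Fin.ext_iff])).2
  have hc : ∀ k, ∃ c : ℂ, a k = c • a k₀ := by
    intro k
    by_cases hk : k₀ = k
    · exact ⟨1, by rw [hk, one_smul]⟩
    · obtain ⟨c, hc⟩ := (key hk).1
      exact ⟨c, vectorMatrix_injective (by rw [hc, vectorMatrix_smul])⟩
  choose c hc using hc
  have hcn : ∀ k, ‖c k‖ = 1 := by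
    intro k
    have := congrArg norm (hc k)
    rw [norm_smul, ha, ha, mul_one] at this
    exact this.symm
  -- Only the product of the phases matters; an `N`-th root of it distributes them equally over the
  -- parties.
  obtain ⟨ω, hω⟩ := IsAlgClosed.exists_pow_nat_eq (∏ k, c k) (show 0 < N by omega)
  have hωn : ‖ω‖ = 1 := by
    have : ‖ω‖ ^ N = 1 := by
      rw [← norm_pow, hω, norm_prod]
      exact Finset.prod_eq_one fun k _ => hcn k
    exact (pow_eq_one_iff_of_nonneg (norm_nonneg _) (by omega)).mp this
  refine ⟨ω • a k₀, ?_, ?_⟩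
  · rw [IsMaximallyEntangled, reducedStateFirst_eq, vectorMatrix_smul, conjTranspose_smul,
      Matrix.smul_mul, Matrix.mul_smul, smul_smul, hiso, Complex.star_def, Complex.mul_conj,
      Complex.normSq_eq_norm_sq, hωn]
    simp
  · ext x
    rw [productVector_apply, productVector_apply]
    calc ∏ k, a k (x k) = ∏ k, c k * a k₀ (x k) := by
          refine Finset.prod_congr rfl fun k _ => ?_
          conv_lhs => rw [hc k]
          rfl
      _ = ∏ k, ω * a k₀ (x k) := by
          rw [Finset.prod_mul_distrib, Finset.prod_mul_distrib, ← hω]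
          simp
      _ = _ := rfl

end TwoCopies

/-! ### Kernels invariant under signed permutations of the modes -/

section InvariantKernels

variable {n N : ℕ} {D : Fin n → ℕ}

/-- Flipping the sign of the single mode `η k` changes the product over `η`, so `ξ` must visit that
mode too; `N` distinct modes in `N` places then leave no freedom but the order. -/
theorem exists_perm_of_forall_prod_sign {κ : Type*} [DecidableEq κ] {ξ η : Fin N → κ}
    (hη : Function.Injective η)
    (h : ∀ ε : κ → ℤˣ, (∏ k, ε (ξ k)) * ∏ k, ε (η k) = 1) :
    ∃ π : Equiv.Perm (Fin N), ξ = η ∘ π := by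
  have hmem : ∀ k, ∃ l, ξ l = η k := by
    intro k
    by_contra! hk
    have h1 := h fun i => if i = η k then -1 else 1
    have h2 : ∏ l, (if ξ l = η k then (-1 : ℤˣ) else 1) = 1 :=
      Finset.prod_eq_one fun l _ => if_neg (hk l)
    have h3 : ∏ l, (if η l = η k then (-1 : ℤˣ) else 1) = -1 := by
      simp [hη.eq_iff]
    rw [h2, h3, one_mul] at h1
    exact absurd h1 (by decide)
  choose f hf using hmem
  have hfinj : Function.Injective f := fun a b hab => hη (by rw [← hf a, ← hf b, hab])
  set π := Equiv.ofBijective f (Finite.injective_iff_bijective.mp hfinj)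
  refine ⟨π.symm, funext fun l => ?_⟩
  rw [Function.comp_apply, ← hf (π.symm l)]
  congr 1
  exact (π.apply_symm_apply l).symm

/-- The sign character of a family of sign changes of the modes. -/
def signChar (ε : ∀ j, Fin (D j) → ℤˣ) (ξ : ∀ j, Fin N → Fin (D j)) : ℤˣ :=
  ∏ j, ∏ k, ε j (ξ j k)

/-- Kernels which are antisymmetric in the second argument and invariant under permutations and
sign changes of the modes. -/
structure IsMonomialInvariant (Y : (∀ j, Fin N → Fin (D j)) → (∀ j, Fin N → Fin (D j)) → ℂ) :
    Prop where
  antisymm : ∀ (π : ∀ _ : Fin n, Equiv.Perm (Fin N)) ξ η,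
    Y ξ (fun j => η j ∘ π j) =
      (∏ j, (((Equiv.Perm.sign (π j) : ℤˣ) : ℤ) : ℂ)) * Y ξ η
  sign : ∀ (ε : ∀ j, Fin (D j) → ℤˣ) ξ η,
    ((signChar ε ξ : ℤ) : ℂ) * ((signChar ε η : ℤ) : ℂ) * Y ξ η = Y ξ η
  perm : ∀ (τ : ∀ j, Equiv.Perm (Fin (D j))) ξ η,
    Y (fun j => τ j ∘ ξ j) (fun j => τ j ∘ η j) = Y ξ η

namespace IsMonomialInvariant

variable {Y Y' : (∀ j, Fin N → Fin (D j)) → (∀ j, Fin N → Fin (D j)) → ℂ}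

theorem eq_zero_of_not_injective (hY : IsMonomialInvariant Y) (ξ : ∀ j, Fin N → Fin (D j))
    {η : ∀ j, Fin N → Fin (D j)} {j : Fin n} (hη : ¬ Function.Injective (η j)) : Y ξ η = 0 := by
  have h := eq_zero_of_antisymmetric (f := fun w => Y ξ (Function.update η j w)) (x := η j) ?_ hη
  · simpa using h
  · intro σ w
    have h1 := hY.antisymm (Function.update (fun _ => 1) j σ) ξ (Function.update η j w)
    have h2 : (fun i => Function.update η j w i ∘
        (Function.update (fun _ => 1) j σ : Fin n → Equiv.Perm (Fin N)) i) =
        Function.update η j (w ∘ σ) := by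
      ext1 i
      by_cases hi : i = j
      · subst hi
        simp
      · simp [hi]
    rw [h2, Finset.prod_eq_single j (fun i _ hi => by simp [hi]) (by simp),
      Function.update_self] at h1
    exact h1

/-- Sign changes in one factor at a time separate the factors, so the tuples can be compared factor
by factor. -/
theorem exists_perm_of_ne_zero (hY : IsMonomialInvariant Y) {ξ η : ∀ j, Fin N → Fin (D j)}
    (h : Y ξ η ≠ 0) : ∃ π : Fin n → Equiv.Perm (Fin N), ξ = fun j => η j ∘ π j := by
  have hinj : ∀ j, Function.Injective (η j) := fun j => by
    by_contra hj
    exact h (hY.eq_zero_of_not_injective ξ hj)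
  have hex : ∀ j, ∃ π : Equiv.Perm (Fin N), ξ j = η j ∘ π := by
    intro j
    refine exists_perm_of_forall_prod_sign (hinj j) fun ε => ?_
    have h1 := hY.sign (Function.update (fun _ _ => 1) j ε) ξ η
    have h2 : ∀ ζ : ∀ j, Fin N → Fin (D j),
        signChar (Function.update (fun _ _ => 1) j ε) ζ = ∏ k, ε (ζ j k) := by
      intro ζ
      rw [signChar, Finset.prod_eq_single j (fun i _ hi => by simp [hi]) (by simp),
        Function.update_self]
    rw [h2, h2] at h1
    have h3 := mul_right_cancel₀ h (h1.trans (one_mul _).symm)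
    refine Units.ext (Int.cast_injective (α := ℂ) ?_)
    rw [Units.val_mul, Int.cast_mul, Units.val_one, Int.cast_one]
    exact h3
  choose π hπ using hex
  exact ⟨π, funext hπ⟩

theorem apply_self (hY : IsMonomialInvariant Y) {ξ ζ : ∀ j, Fin N → Fin (D j)}
    (hξ : ∀ j, Function.Injective (ξ j)) (hζ : ∀ j, Function.Injective (ζ j)) :
    Y ξ ξ = Y ζ ζ := by
  choose τ hτ using fun j => Equiv.Perm.exists_extending_pair (ζ j) (ξ j) (hζ j) (hξ j)
  have h : ξ = fun j => τ j ∘ ζ j := funext fun j => funext fun k => (hτ j k).symm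
  rw [h, hY.perm]

/-- A Schur lemma by hand: sign invariance confines the support to `ξ` a rearrangement of an
injective `η`, antisymmetry reduces such values to the diagonal, and mode permutations act
transitively on injective tuples. One diagonal value therefore determines the kernel. -/
theorem proportional (hY : IsMonomialInvariant Y) (hY' : IsMonomialInvariant Y')
    {ζ : ∀ j, Fin N → Fin (D j)} (hζ : ∀ j, Function.Injective (ζ j))
    (ξ η : ∀ j, Fin N → Fin (D j)) : Y' ζ ζ * Y ξ η = Y ζ ζ * Y' ξ η := by
  by_cases h : Y ξ η = 0 ∧ Y' ξ η = 0
  · rw [h.1, h.2, mul_zero, mul_zero]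
  · have hπ : (∃ π : Fin n → Equiv.Perm (Fin N), ξ = fun j => η j ∘ π j) ∧
        ∀ j, Function.Injective (η j) := by
      rcases not_and_or.mp h with h | h
      · exact ⟨hY.exists_perm_of_ne_zero h, fun j => by
          by_contra hj
          exact h (hY.eq_zero_of_not_injective ξ hj)⟩
      · exact ⟨hY'.exists_perm_of_ne_zero h, fun j => by
          by_contra hj
          exact h (hY'.eq_zero_of_not_injective ξ hj)⟩
    obtain ⟨⟨π, rfl⟩, hη⟩ := hπ
    have hinj : ∀ j, Function.Injective (η j ∘ π j) := fun j => (hη j).comp (π j).injective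
    have hη' : η = fun j => (η j ∘ π j) ∘ ((π j)⁻¹ : Equiv.Perm (Fin N)) := by
      ext1 j
      ext1 k
      simp
    have e1 := hY.antisymm (fun j => (π j)⁻¹) (fun j => η j ∘ π j) (fun j => η j ∘ π j)
    have e2 := hY'.antisymm (fun j => (π j)⁻¹) (fun j => η j ∘ π j) (fun j => η j ∘ π j)
    rw [← hη', hY.apply_self hinj hζ] at e1
    rw [← hη', hY'.apply_self hinj hζ] at e2
    rw [e1, e2]
    ring

end IsMonomialInvariant

/-- The tensor product of antisymmetrizers as a kernel. -/
def antisymmetrizerKernel (ξ η : ∀ j, Fin N → Fin (D j)) : ℂ :=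
  ∏ j, antisymmetrizer N (Fin (D j)) (ξ j) (η j)

theorem isMonomialInvariant_antisymmetrizerKernel :
    IsMonomialInvariant (antisymmetrizerKernel (N := N) (D := D)) where
  antisymm π ξ η := by
    simp only [antisymmetrizerKernel, antisymmetrizer_comp_right, Finset.prod_mul_distrib]
  sign ε ξ η := by
    simp only [antisymmetrizerKernel, signChar, Units.coe_prod, Int.cast_prod]
    rw [← Finset.prod_mul_distrib, ← Finset.prod_mul_distrib]
    refine Finset.prod_congr rfl fun j _ => ?_
    simp only [antisymmetrizer_eq_sum, Finset.mul_sum]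
    refine Finset.sum_congr rfl fun π _ => ?_
    split_ifs with h
    · have : ∏ k, (((ε j (η j k) : ℤˣ) : ℤ) : ℂ) = ∏ k, (((ε j (ξ j k) : ℤˣ) : ℤ) : ℂ) := by
        rw [← h]
        exact Equiv.prod_comp π fun k => (((ε j (ξ j k) : ℤˣ) : ℤ) : ℂ)
      rw [this, ← Finset.prod_mul_distrib]
      simp only [← Int.cast_mul, Int.units_coe_mul_self, Int.cast_one, Finset.prod_const_one,
        one_mul]
    · simp
  perm τ ξ η := by
    simp only [antisymmetrizerKernel, antisymmetrizer_apply, Function.comp_apply,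
      (Equiv.injective _).eq_iff]

theorem antisymmetrizerKernel_self {ζ : ∀ j, Fin N → Fin (D j)}
    (hζ : ∀ j, Function.Injective (ζ j)) :
    antisymmetrizerKernel ζ ζ = ∏ _j : Fin n, (N.factorial : ℂ)⁻¹ :=
  Finset.prod_congr rfl fun j _ => antisymmetrizer_self (hζ j)

end InvariantKernels

/-! ### Averaging over local signed permutation matrices -/

section Twirl

variable {n N : ℕ} {D : Fin n → ℕ} {ι : Type*}

/-- The coordinates of an `N`-tuple of local basis indices, factor by factor. -/
def factorEquiv (N : ℕ) (e : ι ≃ ∀ j, Fin (D j)) : (Fin N → ι) ≃ ∀ j, Fin N → Fin (D j) :=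
  (Equiv.arrowCongr (Equiv.refl _) e).trans (Equiv.piComm _)

theorem factorEquiv_apply (e : ι ≃ ∀ j, Fin (D j)) (x : Fin N → ι) (j : Fin n) (k : Fin N) :
    factorEquiv N e x j k = e (x k) j := rfl

/-- The permutation of the local basis induced by permutations of the modes of all factors. -/
def modePerm (e : ι ≃ ∀ j, Fin (D j)) (τ : ∀ j, Equiv.Perm (Fin (D j))) : Equiv.Perm ι :=
  (e.trans (Equiv.piCongrRight τ)).trans e.symm

theorem factorEquiv_modePerm (e : ι ≃ ∀ j, Fin (D j)) (τ : ∀ j, Equiv.Perm (Fin (D j)))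
    (x : Fin N → ι) :
    factorEquiv N e (modePerm e τ ∘ x) = fun j => τ j ∘ factorEquiv N e x j := by
  ext j k
  simp [factorEquiv_apply, modePerm]

/-- Conjugation by a local signed permutation matrix. -/
def monomialConj (e : ι ≃ ∀ j, Fin (D j))
    (g : (∀ j, Equiv.Perm (Fin (D j))) × (∀ j, Fin (D j) → ℤˣ))
    (X : Matrix (Fin N → ι) (Fin N → ι) ℂ) : Matrix (Fin N → ι) (Fin N → ι) ℂ :=
  Matrix.of fun x y => ((signChar g.2 (factorEquiv N e x) : ℤ) : ℂ) *
    ((signChar g.2 (factorEquiv N e y) : ℤ) : ℂ) * X (modePerm e g.1 ∘ x) (modePerm e g.1 ∘ y)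

/-- The average over all conjugations by local signed permutation matrices. -/
def twirl (e : ι ≃ ∀ j, Fin (D j)) (X : Matrix (Fin N → ι) (Fin N → ι) ℂ) :
    Matrix (Fin N → ι) (Fin N → ι) ℂ :=
  ∑ g : (∀ j, Equiv.Perm (Fin (D j))) × (∀ j, Fin (D j) → ℤˣ),
    (Fintype.card ((∀ j, Equiv.Perm (Fin (D j))) × (∀ j, Fin (D j) → ℤˣ)) : ℝ)⁻¹ •
      monomialConj e g X

theorem intUnits_cast_mul_self (u : ℤˣ) : ((u : ℤ) : ℂ) * ((u : ℤ) : ℂ) = 1 := by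
  rw [← Int.cast_mul, Int.units_coe_mul_self, Int.cast_one]

theorem signChar_mul (ε ε' : ∀ j, Fin (D j) → ℤˣ) (ξ : ∀ j, Fin N → Fin (D j)) :
    signChar (ε * ε') ξ = signChar ε ξ * signChar ε' ξ := by
  simp only [signChar, Pi.mul_apply, Finset.prod_mul_distrib]

theorem sign_mul_sign_mul_twirl (e : ι ≃ ∀ j, Fin (D j)) (X : Matrix (Fin N → ι) (Fin N → ι) ℂ)
    (ε : ∀ j, Fin (D j) → ℤˣ) (x y : Fin N → ι) :
    ((signChar ε (factorEquiv N e x) : ℤ) : ℂ) * ((signChar ε (factorEquiv N e y) : ℤ) : ℂ) *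
      twirl e X x y = twirl e X x y := by
  simp only [twirl, Matrix.sum_apply, Finset.mul_sum]
  rw [← ((Equiv.refl _).prodCongr (Equiv.mulLeft ε)).sum_comp fun g => (_ • monomialConj e g X :
    Matrix (Fin N → ι) (Fin N → ι) ℂ) x y]
  refine Finset.sum_congr rfl fun g _ => ?_
  simp only [monomialConj, Matrix.smul_apply, of_apply, Equiv.prodCongr_apply, Prod.map,
    Equiv.coe_refl, id, Equiv.coe_mulLeft, signChar_mul, Complex.real_smul]
  push_cast
  ring

theorem twirl_modePerm (e : ι ≃ ∀ j, Fin (D j)) (X : Matrix (Fin N → ι) (Fin N → ι) ℂ)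
    (τ : ∀ j, Equiv.Perm (Fin (D j))) (x y : Fin N → ι) :
    twirl e X (modePerm e τ ∘ x) (modePerm e τ ∘ y) = twirl e X x y := by
  simp only [twirl, Matrix.sum_apply]
  refine Fintype.sum_equiv ((Equiv.mulRight τ).prodCongr (Equiv.piCongrRight fun j =>
    (τ j).symm.arrowCongr (Equiv.refl ℤˣ))) _ _ fun g => ?_
  simp only [monomialConj, Matrix.smul_apply, of_apply, factorEquiv_modePerm]
  have h : ∀ z : Fin N → ι, modePerm e g.1 ∘ modePerm e τ ∘ z = modePerm e (g.1 * τ) ∘ z := by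
    intro z
    ext k
    simp only [modePerm, Function.comp_apply, Equiv.trans_apply, Equiv.apply_symm_apply]
    rfl
  rw [h, h]
  rfl

/-- The matrix of the tensor product of antisymmetrizers, in the local basis `ι`. -/
def tensorAntisymmetrizer (N : ℕ) (e : ι ≃ ∀ j, Fin (D j)) :
    Matrix (Fin N → ι) (Fin N → ι) ℂ :=
  Matrix.of fun x y => antisymmetrizerKernel (factorEquiv N e x) (factorEquiv N e y)

theorem tensorAntisymmetrizer_apply (e : ι ≃ ∀ j, Fin (D j)) (x y : Fin N → ι) :
    tensorAntisymmetrizer N e x y =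
      antisymmetrizerKernel (factorEquiv N e x) (factorEquiv N e y) := rfl

theorem tensorAntisymmetrizer_isHermitian (e : ι ≃ ∀ j, Fin (D j)) :
    (tensorAntisymmetrizer N e).IsHermitian := by
  ext x y
  rw [conjTranspose_apply, tensorAntisymmetrizer_apply, tensorAntisymmetrizer_apply,
    antisymmetrizerKernel, antisymmetrizerKernel, star_prod]
  refine Finset.prod_congr rfl fun j _ => ?_
  rw [star_antisymmetrizer_apply, antisymmetrizer_comm]

variable [Fintype ι]

/-- The conjugating operator is a tensor product over the parties: the permutation and the sign `s`
act on each local index separately, so product states go to product states. -/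
theorem monomialConj_mem_separableStates [DecidableEq ι] (e : ι ≃ ∀ j, Fin (D j))
    (g : (∀ j, Equiv.Perm (Fin (D j))) × (∀ j, Fin (D j) → ℤˣ))
    {σ : Matrix (Fin N → ι) (Fin N → ι) ℂ} (hσ : σ ∈ separableStates N ι) :
    monomialConj e g σ ∈ separableStates N ι := by
  have hconv : Convex ℝ {σ : Matrix (Fin N → ι) (Fin N → ι) ℂ |
      monomialConj e g σ ∈ separableStates N ι} := by
    intro σ hσ τ hτ a b ha hb hab
    have : monomialConj e g (a • σ + b • τ) = a • monomialConj e g σ + b • monomialConj e g τ := by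
      ext x y
      simp only [monomialConj, of_apply, Matrix.add_apply, Matrix.smul_apply, Complex.real_smul]
      ring
    rw [Set.mem_ofPred_eq, this]
    exact convex_convexHull ℝ _ hσ hτ ha hb hab
  refine convexHull_min ?_ hconv hσ
  rintro _ ⟨A, hA, rfl⟩
  set s : ι → ℂ := fun i => ∏ j, (((g.2 j (e i j) : ℤˣ) : ℤ) : ℂ) with hs
  have hss : ∀ i, s i * s i = 1 := fun i => by
    rw [hs, ← Finset.prod_mul_distrib]
    exact Finset.prod_eq_one fun j _ => intUnits_cast_mul_self _
  have hstar : ∀ i, star (s i) = s i := fun i => by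
    simp [hs]
  have hchar : ∀ x : Fin N → ι, ((signChar g.2 (factorEquiv N e x) : ℤ) : ℂ) = ∏ k, s (x k) := by
    intro x
    rw [signChar, Finset.prod_comm]
    push_cast
    rfl
  refine subset_convexHull _ _
    ⟨fun k => (diagonal s)ᴴ * (A k).submatrix (modePerm e g.1) (modePerm e g.1) * diagonal s,
      fun k => ⟨?_, ?_⟩, ?_⟩
  · exact ((hA k).1.submatrix _).conjTranspose_mul_mul_same _
  · rw [diagonal_conjTranspose, ← (hA k).2]
    simp only [Matrix.trace, diag_apply, mul_diagonal, diagonal_mul, Pi.star_apply, hstar,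
      submatrix_apply]
    conv_rhs => rw [← Equiv.sum_comp (modePerm e g.1)]
    refine Finset.sum_congr rfl fun i _ => ?_
    rw [mul_right_comm, hss, one_mul]
  · ext x y
    rw [monomialConj, of_apply, hchar, hchar, productMatrix_apply, productMatrix_apply,
      ← Finset.prod_mul_distrib, ← Finset.prod_mul_distrib]
    refine Finset.prod_congr rfl fun k _ => ?_
    rw [diagonal_conjTranspose, mul_diagonal, diagonal_mul, Pi.star_apply, hstar, submatrix_apply]
    simp only [Function.comp_apply]
    ring

theorem twirl_mem_separableStates [DecidableEq ι] (e : ι ≃ ∀ j, Fin (D j))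
    {σ : Matrix (Fin N → ι) (Fin N → ι) ℂ} (hσ : σ ∈ separableStates N ι) :
    twirl e σ ∈ separableStates N ι := by
  refine (convex_convexHull ℝ _).sum_mem (fun _ _ => by positivity) ?_
    fun g _ => monomialConj_mem_separableStates e g hσ
  rw [Finset.sum_const, Finset.card_univ, nsmul_eq_mul]
  exact mul_inv_cancel₀ (by exact_mod_cast Fintype.card_ne_zero)

theorem sum_prod_factorEquiv (e : ι ≃ ∀ j, Fin (D j)) (f : ∀ j, (Fin N → Fin (D j)) → ℂ) :
    ∑ x, ∏ j, f j (factorEquiv N e x j) = ∏ j, ∑ z, f j z := by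
  rw [(factorEquiv N e).sum_comp fun ζ => ∏ j, f j (ζ j), Finset.prod_univ_sum,
    Fintype.piFinset_univ]

theorem tensorAntisymmetrizer_mul_self (e : ι ≃ ∀ j, Fin (D j)) :
    tensorAntisymmetrizer N e * tensorAntisymmetrizer N e = tensorAntisymmetrizer N e := by
  ext x y
  simp only [Matrix.mul_apply, tensorAntisymmetrizer_apply, antisymmetrizerKernel,
    ← Finset.prod_mul_distrib]
  rw [sum_prod_factorEquiv e fun j z => antisymmetrizer N (Fin (D j)) (factorEquiv N e x j) z *
    antisymmetrizer N (Fin (D j)) z (factorEquiv N e y j)]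
  refine Finset.prod_congr rfl fun j _ => ?_
  rw [← Matrix.mul_apply, antisymmetrizer_mul_self]

theorem trace_tensorAntisymmetrizer (e : ι ≃ ∀ j, Fin (D j)) :
    (tensorAntisymmetrizer N e).trace = ((∏ j, ((D j).choose N : ℝ) : ℝ) : ℂ) := by
  simp only [Matrix.trace, diag_apply, tensorAntisymmetrizer_apply, antisymmetrizerKernel]
  rw [sum_prod_factorEquiv e fun j z => antisymmetrizer N (Fin (D j)) z z]
  push_cast
  refine Finset.prod_congr rfl fun j _ => ?_
  have := trace_antisymmetrizer (ι := Fin (D j)) N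
  rwa [Fintype.card_fin] at this

theorem isMonomialInvariant_twirl_mul [DecidableEq ι] (e : ι ≃ ∀ j, Fin (D j))
    (X : Matrix (Fin N → ι) (Fin N → ι) ℂ) :
    IsMonomialInvariant fun ξ η => (twirl e X * tensorAntisymmetrizer N e)
      ((factorEquiv N e).symm ξ) ((factorEquiv N e).symm η) := by
  have hQ := isMonomialInvariant_antisymmetrizerKernel (N := N) (D := D)
  refine ⟨fun π ξ η => ?_, fun ε ξ η => ?_, fun τ ξ η => ?_⟩
  · simp only [Matrix.mul_apply, tensorAntisymmetrizer_apply, Equiv.apply_symm_apply, hQ.antisymm,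
      Finset.mul_sum]
    exact Finset.sum_congr rfl fun z _ => by ring
  · simp only [Matrix.mul_apply, tensorAntisymmetrizer_apply, Equiv.apply_symm_apply,
      Finset.mul_sum]
    refine Finset.sum_congr rfl fun z _ => ?_
    have h1 := sign_mul_sign_mul_twirl e X ε ((factorEquiv N e).symm ξ) z
    have h2 := hQ.sign ε (factorEquiv N e z) η
    have h3 := intUnits_cast_mul_self (signChar ε (factorEquiv N e z))
    rw [Equiv.apply_symm_apply] at h1
    conv_rhs => rw [← h1, ← h2]
    linear_combination (-((signChar ε ξ : ℤ) : ℂ) * ((signChar ε η : ℤ) : ℂ) *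
      twirl e X ((factorEquiv N e).symm ξ) z *
        antisymmetrizerKernel (factorEquiv N e z) η) * h3
  · have h : ∀ ζ : ∀ j, Fin N → Fin (D j), (factorEquiv N e).symm (fun j => τ j ∘ ζ j) =
        modePerm e τ ∘ (factorEquiv N e).symm ζ := by
      intro ζ
      rw [Equiv.symm_apply_eq, factorEquiv_modePerm, Equiv.apply_symm_apply]
    simp only [Matrix.mul_apply, h]
    rw [← (Equiv.arrowCongr (Equiv.refl (Fin N)) (modePerm e τ)).sum_comp]
    refine Finset.sum_congr rfl fun z _ => ?_
    change twirl e X _ (modePerm e τ ∘ z) * tensorAntisymmetrizer N e (modePerm e τ ∘ z) _ = _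
    rw [twirl_modePerm, tensorAntisymmetrizer_apply, factorEquiv_modePerm, factorEquiv_modePerm,
      hQ.perm, tensorAntisymmetrizer_apply]

/-- The antisymmetrizer is itself invariant under the group, so each term of the average has the
same overlap. -/
theorem trace_twirl_mul (e : ι ≃ ∀ j, Fin (D j)) (X : Matrix (Fin N → ι) (Fin N → ι) ℂ) :
    (twirl e X * tensorAntisymmetrizer N e).trace = (X * tensorAntisymmetrizer N e).trace := by
  have hQ := isMonomialInvariant_antisymmetrizerKernel (N := N) (D := D)
  have h : ∀ g, (monomialConj e g X * tensorAntisymmetrizer N e).trace =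
      (X * tensorAntisymmetrizer N e).trace := by
    intro g
    simp only [Matrix.trace, diag_apply, Matrix.mul_apply]
    conv_rhs => rw [← (Equiv.arrowCongr (Equiv.refl (Fin N)) (modePerm e g.1)).sum_comp]
    refine Finset.sum_congr rfl fun x _ => ?_
    conv_rhs => rw [← (Equiv.arrowCongr (Equiv.refl (Fin N)) (modePerm e g.1)).sum_comp]
    refine Finset.sum_congr rfl fun y _ => ?_
    change _ = X (modePerm e g.1 ∘ x) (modePerm e g.1 ∘ y) *
      tensorAntisymmetrizer N e (modePerm e g.1 ∘ y) (modePerm e g.1 ∘ x)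
    rw [tensorAntisymmetrizer_apply, tensorAntisymmetrizer_apply, factorEquiv_modePerm,
      factorEquiv_modePerm, hQ.perm, monomialConj, of_apply]
    conv_rhs => rw [← hQ.sign g.2]
    ring
  rw [twirl, Matrix.sum_mul, trace_sum]
  simp only [Matrix.smul_mul, trace_smul, h]
  rw [Finset.sum_const, Finset.card_univ, ← smul_assoc, nsmul_eq_mul,
    mul_inv_cancel₀ (by exact_mod_cast Fintype.card_ne_zero), one_smul]

/-- Both sides are invariant kernels, hence proportional, and the trace fixes the scalar. For a
state `X` that scalar is its overlap with the normalized projector. -/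
theorem twirl_mul_tensorAntisymmetrizer [DecidableEq ι] (e : ι ≃ ∀ j, Fin (D j))
    (hD : ∀ j, N ≤ D j) (X : Matrix (Fin N → ι) (Fin N → ι) ℂ) :
    twirl e X * tensorAntisymmetrizer N e =
      ((tensorAntisymmetrizer N e).trace⁻¹ * (X * tensorAntisymmetrizer N e).trace) •
        tensorAntisymmetrizer N e := by
  set Q := tensorAntisymmetrizer N e with hQdef
  -- An injective reference tuple, available because every factor has at least `N` modes; both
  -- kernels are compared on its diagonal entry.
  set ζ : ∀ j, Fin N → Fin (D j) := fun j => Fin.castLE (hD j)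
  have hζ : ∀ j, Function.Injective (ζ j) := fun j => Fin.castLE_injective (hD j)
  have hprop := (isMonomialInvariant_twirl_mul e X).proportional
    (isMonomialInvariant_antisymmetrizerKernel (N := N) (D := D)) hζ
  have h0 : antisymmetrizerKernel ζ ζ ≠ 0 := by
    rw [antisymmetrizerKernel_self hζ]
    exact Finset.prod_ne_zero_iff.mpr fun _ _ =>
      inv_ne_zero (by exact_mod_cast N.factorial_ne_zero)
  have htr0 : Q.trace ≠ 0 := by
    rw [hQdef, trace_tensorAntisymmetrizer]
    exact_mod_cast Finset.prod_ne_zero_iff.mpr fun j _ => (Nat.choose_pos (hD j)).ne'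
  obtain ⟨c, hc⟩ : ∃ c : ℂ, twirl e X * Q = c • Q := by
    refine ⟨(antisymmetrizerKernel ζ ζ)⁻¹ * (twirl e X * Q) ((factorEquiv N e).symm ζ)
      ((factorEquiv N e).symm ζ), ?_⟩
    ext x y
    have h1 := hprop (factorEquiv N e x) (factorEquiv N e y)
    simp only [Equiv.symm_apply_apply] at h1
    rw [Matrix.smul_apply, smul_eq_mul, mul_assoc, hQdef, tensorAntisymmetrizer_apply, ← h1,
      inv_mul_cancel_left₀ h0]
  have h2 := trace_twirl_mul e X
  rw [← hQdef, hc, trace_smul, smul_eq_mul] at h2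
  rw [hc, ← h2, mul_comm c, inv_mul_cancel_left₀ htr0]

end Twirl

/-! ### The relation between the measures for tensor products -/

section Additivity

variable {n N : ℕ} {D : Fin n → ℕ} {ι : Type*} [Fintype ι] [DecidableEq ι]

theorem productVector_single (x : Fin N → ι) :
    productVector (fun k => EuclideanSpace.single (x k) (1 : ℂ)) = EuclideanSpace.single x 1 := by
  ext y
  rw [productVector_apply]
  simp only [PiLp.single_apply, Finset.prod_boole, funext_iff, Finset.mem_univ,
    true_imp_iff]

theorem single_mem_productStates (x : Fin N → ι) :
    EuclideanSpace.single x (1 : ℂ) ∈ productStates N ι :=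
  ⟨_, fun k => by simp, (productVector_single x).symm⟩

theorem expectation_single {α : Type*} [Fintype α] [DecidableEq α] (ρ : Matrix α α ℂ) (x : α) :
    expectation ρ (EuclideanSpace.single x 1) = (ρ x x).re := by
  simp [expectation]

/-- The equivalence `e` lets the same argument serve single copies, whose local basis is `Fin d`,
and tensor products, whose local basis is a product type. -/
theorem measures_tensorAntisymmetrizer (e : ι ≃ ∀ j, Fin (D j)) (hD : ∀ j, N ≤ D j)
    {ρ : Matrix (Fin N → ι) (Fin N → ι) ℂ}
    (hρ : ρ = ((∏ j, ((D j).choose N : ℝ) : ℝ) : ℂ)⁻¹ • tensorAntisymmetrizer N e) :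
    0 < maxOverlapSq ρ ∧
    relativeEntropyOfEntanglement ρ = ((logGlobalRobustness ρ : ℝ) : EReal) ∧
    logGlobalRobustness ρ =
      geometricMeasure ρ - Real.logb 2 (∏ j, ((D j).choose N : ℝ)) ∧
    0 ≤ logGlobalRobustness ρ := by
  subst hρ
  set t : ℝ := ∏ j, ((D j).choose N : ℝ)
  have ht : 0 < t := Finset.prod_pos fun j _ => by exact_mod_cast Nat.choose_pos (hD j)
  have hQ := tensorAntisymmetrizer_isHermitian (N := N) e
  have htr : (tensorAntisymmetrizer N e).trace = (t : ℂ) := trace_tensorAntisymmetrizer e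
  refine measures_eq_of_twirl hQ (tensorAntisymmetrizer_mul_self e) ht htr ?_ ?_
  · intro σ hσ
    refine ⟨twirl e σ, twirl_mem_separableStates e hσ, ?_⟩
    have hσH := (isState_of_mem_separableStates hσ).1.isHermitian
    have hreal : ((tensorAntisymmetrizer N e * σ).trace.re : ℂ) =
        (tensorAntisymmetrizer N e * σ).trace := by
      rw [← Complex.conj_eq_iff_re, ← Complex.star_def, ← trace_conjTranspose, conjTranspose_mul,
        hσH.eq, hQ.eq, trace_mul_comm]
    rw [twirl_mul_tensorAntisymmetrizer e hD, htr, trace_mul_comm σ, Matrix.smul_mul, trace_smul,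
      ← Complex.ofReal_inv, smul_eq_mul, Complex.re_ofReal_mul, Complex.ofReal_mul, hreal]
  -- A computational basis vector with distinct modes in every factor has positive overlap.
  · set ζ : ∀ j, Fin N → Fin (D j) := fun j => Fin.castLE (hD j)
    have hζ : ∀ j, Function.Injective (ζ j) := fun j => Fin.castLE_injective (hD j)
    refine ⟨_, vecMulVec_mem_separableStates
      (single_mem_productStates ((factorEquiv N e).symm ζ)), ?_⟩
    rw [← expectation_eq_trace_re, expectation_single, Matrix.smul_apply,
      tensorAntisymmetrizer_apply, Equiv.apply_symm_apply, antisymmetrizerKernel_self hζ,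
      smul_eq_mul, ← Complex.ofReal_inv, Complex.re_ofReal_mul]
    refine mul_pos (inv_pos.mpr ht) ?_
    have : (∏ _j : Fin n, (N.factorial : ℂ)⁻¹) = ((∏ _j : Fin n, (N.factorial : ℝ)⁻¹ : ℝ) : ℂ) := by
      push_cast
      rfl
    rw [this, Complex.ofReal_re]
    exact Finset.prod_pos fun _ _ => inv_pos.mpr (by exact_mod_cast N.factorial_pos)

theorem tensorState_antisymmetricProjectorState (D : Fin n → ℕ) :
    (tensorState fun j => antisymmetricProjectorState (D j) N) =
      ((∏ j, ((D j).choose N : ℝ) : ℝ) : ℂ)⁻¹ •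
        tensorAntisymmetrizer N (Equiv.refl (∀ j, Fin (D j))) := by
  ext x y
  simp only [tensorState, of_apply, antisymmetricProjectorState_eq, Matrix.smul_apply, smul_eq_mul,
    Finset.prod_mul_distrib, tensorAntisymmetrizer_apply, antisymmetrizerKernel]
  push_cast
  rw [Finset.prod_inv_distrib]
  rfl

theorem antisymmetricProjectorState_eq_tensorAntisymmetrizer (d N : ℕ) :
    antisymmetricProjectorState d N =
      ((∏ _j : Fin 1, (d.choose N : ℝ) : ℝ) : ℂ)⁻¹ •
        tensorAntisymmetrizer N (D := fun _ => d) (Equiv.funUnique (Fin 1) (Fin d)).symm := by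
  ext x y
  simp only [antisymmetricProjectorState_eq, Matrix.smul_apply, tensorAntisymmetrizer_apply,
    antisymmetrizerKernel]
  simp
  exact Or.inl rfl

theorem trace_antisymmetricProjector (d N : ℕ) :
    (antisymmetricProjector d N).trace = (d.choose N : ℂ) := by
  rw [antisymmetricProjector_eq, trace_antisymmetrizer, Fintype.card_fin]

theorem measures_tensorState (D : Fin n → ℕ) (hD : ∀ j, N ≤ D j) :
    relativeEntropyOfEntanglement (tensorState fun j => antisymmetricProjectorState (D j) N) =
      ((logGlobalRobustness
        (tensorState fun j => antisymmetricProjectorState (D j) N) : ℝ) : EReal) ∧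
    logGlobalRobustness (tensorState fun j => antisymmetricProjectorState (D j) N) =
      geometricMeasure (tensorState fun j => antisymmetricProjectorState (D j) N) -
        ∑ j, Real.logb 2 (antisymmetricProjector (D j) N).trace.re := by
  obtain ⟨-, h1, h2, -⟩ := measures_tensorAntisymmetrizer _ hD
    (tensorState_antisymmetricProjectorState (N := N) D)
  refine ⟨h1, h2.trans ?_⟩
  rw [Real.logb_prod _ _ fun j _ => by exact_mod_cast (Nat.choose_pos (hD j)).ne']
  simp only [trace_antisymmetricProjector, Complex.natCast_re]

theorem measures_copies {d : ℕ} (hd : N ≤ d) (n : ℕ) :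
    0 < maxOverlapSq (copies n (antisymmetricProjectorState d N)) ∧
    relativeEntropyOfEntanglement (copies n (antisymmetricProjectorState d N)) =
      ((logGlobalRobustness (copies n (antisymmetricProjectorState d N)) : ℝ) : EReal) ∧
    logGlobalRobustness (copies n (antisymmetricProjectorState d N)) =
      geometricMeasure (copies n (antisymmetricProjectorState d N)) -
        n * Real.logb 2 (d.choose N) ∧
    0 ≤ logGlobalRobustness (copies n (antisymmetricProjectorState d N)) := by
  obtain ⟨h0, h1, h2, h3⟩ := measures_tensorAntisymmetrizer (N := N) (D := fun _ : Fin n => d) _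
    (fun _ => hd) (tensorState_antisymmetricProjectorState (N := N) fun _ : Fin n => d)
  refine ⟨h0, h1, h2.trans ?_, h3⟩
  rw [Finset.prod_const, Finset.card_univ, Fintype.card_fin, Real.logb_pow]
  rfl

theorem measures_antisymmetricProjectorState {d : ℕ} (hd : N ≤ d) :
    relativeEntropyOfEntanglement (antisymmetricProjectorState d N) =
      ((logGlobalRobustness (antisymmetricProjectorState d N) : ℝ) : EReal) ∧
    logGlobalRobustness (antisymmetricProjectorState d N) =
      geometricMeasure (antisymmetricProjectorState d N) - Real.logb 2 (d.choose N) := by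
  obtain ⟨-, h1, h2, -⟩ := measures_tensorAntisymmetrizer (N := N) (D := fun _ : Fin 1 => d) _
    (fun _ => hd) (antisymmetricProjectorState_eq_tensorAntisymmetrizer d N)
  refine ⟨h1, h2.trans ?_⟩
  rw [Fin.prod_univ_one]

end Additivity

/-! ### One copy: Gram determinants and Hadamard's inequality -/

section OneCopy

variable {N d : ℕ}

/-- The eigenvalues sum to their number, so multiplying `λ ≤ exp (λ - 1)` over them gives the bound;
that inequality is strict unless `λ = 1`. -/
theorem det_re_le_one_of_diag_eq_one {κ : Type*} [Fintype κ] [DecidableEq κ] {G : Matrix κ κ ℂ}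
    (hG : G.PosSemidef) (hdiag : ∀ k, G k k = 1) : G.det.re ≤ 1 ∧ (G.det.re = 1 ↔ G = 1) := by
  have hH := hG.isHermitian
  have hdet : G.det.re = ∏ i, hH.eigenvalues i := by
    rw [hH.det_eq_prod_eigenvalues]
    exact_mod_cast Complex.ofReal_re _
  have hsum : ∑ i, (hH.eigenvalues i - 1) = 0 := by
    have h := hH.trace_eq_sum_eigenvalues
    rw [Matrix.trace] at h
    simp only [diag_apply, hdiag] at h
    rw [Finset.sum_sub_distrib, sub_eq_zero]
    exact Complex.ofReal_injective (by push_cast; exact h.symm)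
  have hexp : ∏ i, Real.exp (hH.eigenvalues i - 1) = 1 := by
    rw [← Real.exp_sum, hsum, Real.exp_zero]
  have hle : ∀ i, hH.eigenvalues i ≤ Real.exp (hH.eigenvalues i - 1) := fun i => by
    have := Real.add_one_le_exp (hH.eigenvalues i - 1)
    linarith
  have hnn := hG.eigenvalues_nonneg
  refine ⟨?_, fun h => ?_, fun h => by rw [h, det_one, Complex.one_re]⟩
  · rw [hdet, ← hexp]
    exact Finset.prod_le_prod (fun i _ => hnn i) fun i _ => hle i
  · rw [hdet] at h
    have hone : ∀ i, hH.eigenvalues i = 1 := by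
      by_contra! hne
      obtain ⟨i, hi⟩ := hne
      have hpos : ∀ j, 0 < hH.eigenvalues j := fun j =>
        (hnn j).lt_of_ne' fun h0 => by
          rw [Finset.prod_eq_zero (Finset.mem_univ j) h0] at h
          exact zero_ne_one h
      have : ∏ j, hH.eigenvalues j < ∏ j, Real.exp (hH.eigenvalues j - 1) :=
        Finset.prod_lt_prod (fun j _ => hpos j) (fun j _ => hle j) ⟨i, Finset.mem_univ i, by
          have := Real.add_one_lt_exp (sub_ne_zero.mpr hi)
          linarith⟩
      rw [h, hexp] at this
      exact lt_irrefl _ this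
    rw [hH.spectral_theorem, show (RCLike.ofReal ∘ hH.eigenvalues : κ → ℂ) = 1 from
      funext fun i => by simp [hone i], show diagonal (1 : κ → ℂ) = 1 from diagonal_one, map_one]

/-- Each permutation contributes its sign times a product of inner products, which is the Leibniz
expansion of the Gram determinant. -/
theorem expectation_antisymmetrizer (a : Fin N → EuclideanSpace ℂ (Fin d)) :
    expectation (antisymmetrizer N (Fin d)) (productVector a) =
      (N.factorial : ℝ)⁻¹ * (Matrix.gram ℂ a).det.re := by
  have h : star (productVector a).ofLp ⬝ᵥ
      (antisymmetrizer N (Fin d)).mulVec (productVector a).ofLp =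
      (((N.factorial : ℝ)⁻¹ : ℝ) : ℂ) * (Matrix.gram ℂ a).det := by
    have hmul : ∀ x, (antisymmetrizer N (Fin d)).mulVec (productVector a).ofLp x =
        (N.factorial : ℂ)⁻¹ * ∑ π : Equiv.Perm (Fin N), ((Equiv.Perm.sign π : ℤ) : ℂ) *
          productVector a (x ∘ π) := fun x =>
      antisymmetrizer_mul_apply (Matrix.of fun y (_ : Unit) => productVector a y) x ()
    simp only [dotProduct, hmul]
    rw [det_apply']
    push_cast
    simp only [Finset.mul_sum]
    rw [Finset.sum_comm]
    refine Finset.sum_congr rfl fun π _ => ?_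
    have hin : ∀ k l, Matrix.gram ℂ a k l = ∑ i, star (a k i) * a l i := fun k l => by
      rw [gram_apply, EuclideanSpace.inner_eq_star_dotProduct, dotProduct_comm]
      rfl
    simp only [hin, prod_sum_eq_sum_prod, Finset.mul_sum]
    -- Reindexing by `x ↦ x ∘ π⁻¹` moves the permutation from the ket to the bra, matching the row
    -- convention of `det_apply'`.
    rw [← (Equiv.arrowCongr π (Equiv.refl (Fin d))).sum_comp]
    refine Finset.sum_congr rfl fun x _ => ?_
    have h1 : (Equiv.arrowCongr π (Equiv.refl (Fin d)) x) ∘ π = x := by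
      ext k
      simp
    rw [h1, Pi.star_apply, productVector_apply, productVector_apply, Finset.prod_mul_distrib,
      star_prod, ← Equiv.prod_comp π]
    simp only [Equiv.arrowCongr_apply, Function.comp_apply, Equiv.symm_apply_apply,
      Equiv.coe_refl, id]
    ring
  rw [expectation, h, Complex.re_ofReal_mul]

theorem gram_eq_one_iff_orthonormal (a : Fin N → EuclideanSpace ℂ (Fin d)) :
    Matrix.gram ℂ a = 1 ↔ Orthonormal ℂ a := by
  rw [orthonormal_iff_ite, ← Matrix.ext_iff]
  simp only [gram_apply, Matrix.one_apply]

theorem expectation_antisymmetricProjectorState (a : Fin N → EuclideanSpace ℂ (Fin d)) :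
    expectation (antisymmetricProjectorState d N) (productVector a) =
      (d.choose N : ℝ)⁻¹ * ((N.factorial : ℝ)⁻¹ * (Matrix.gram ℂ a).det.re) := by
  rw [antisymmetricProjectorState_eq, ← expectation_antisymmetrizer, ← expectation_ofReal_smul]
  push_cast
  rfl

theorem gram_apply_self_of_norm_eq_one {a : Fin N → EuclideanSpace ℂ (Fin d)}
    (ha : ∀ k, ‖a k‖ = 1) (k : Fin N) : Matrix.gram ℂ a k k = 1 := by
  rw [gram_apply, inner_self_eq_norm_sq_to_K, ha]
  simp

theorem maxOverlapSq_antisymmetricProjectorState (hd : N ≤ d) :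
    maxOverlapSq (antisymmetricProjectorState d N) =
      (d.choose N : ℝ)⁻¹ * (N.factorial : ℝ)⁻¹ := by
  refine maxOverlapSq_eq_of_isGreatest ?_ ?_
  · rintro _ ⟨a, ha, rfl⟩
    rw [expectation_antisymmetricProjectorState]
    have := (det_re_le_one_of_diag_eq_one (posSemidef_gram ℂ a)
      (gram_apply_self_of_norm_eq_one ha)).1
    have h1 : (0 : ℝ) ≤ (N.factorial : ℝ)⁻¹ := by positivity
    gcongr
    exact mul_le_of_le_one_right h1 this
  · set b := EuclideanSpace.basisFun (Fin d) ℂ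
    have hb : Orthonormal ℂ fun k : Fin N => b (Fin.castLE hd k) :=
      b.orthonormal.comp _ (Fin.castLE_injective hd)
    refine ⟨_, ⟨_, hb.1, rfl⟩, ?_⟩
    rw [expectation_antisymmetricProjectorState, (gram_eq_one_iff_orthonormal _).mpr hb, det_one,
      Complex.one_re, mul_one]

theorem isClosestProductState_antisymmetricProjectorState_iff (hd : N ≤ d)
    (φ : EuclideanSpace ℂ (Fin N → Fin d)) :
    IsClosestProductState (antisymmetricProjectorState d N) φ ↔
      ∃ a : Fin N → EuclideanSpace ℂ (Fin d), Orthonormal ℂ a ∧ φ = productVector a := by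
  have hch : (d.choose N : ℝ)⁻¹ ≠ 0 := inv_ne_zero (by exact_mod_cast (Nat.choose_pos hd).ne')
  have hfac : (N.factorial : ℝ)⁻¹ ≠ 0 := inv_ne_zero (by exact_mod_cast N.factorial_ne_zero)
  rw [IsClosestProductState, maxOverlapSq_antisymmetricProjectorState hd]
  constructor
  · rintro ⟨⟨a, ha, rfl⟩, h⟩
    refine ⟨a, ?_, rfl⟩
    rw [expectation_antisymmetricProjectorState] at h
    have h1 := (mul_eq_left₀ hfac).mp (mul_left_cancel₀ hch h)
    exact (gram_eq_one_iff_orthonormal a).mp ((det_re_le_one_of_diag_eq_one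
      (posSemidef_gram ℂ a) (gram_apply_self_of_norm_eq_one ha)).2.mp h1)
  · rintro ⟨a, ha, rfl⟩
    refine ⟨⟨a, ha.1, rfl⟩, ?_⟩
    rw [expectation_antisymmetricProjectorState, (gram_eq_one_iff_orthonormal _).mpr ha, det_one,
      Complex.one_re, mul_one]

end OneCopy

/-! ### Supermultiplicativity and the regularized measures -/

section Regularization

variable {N : ℕ} {κ : Type*}

/-- Joining the copies of two groups, party by party. -/
def appendCopiesEquiv (N m n : ℕ) (κ : Type*) :
    (Fin N → Fin m → κ) × (Fin N → Fin n → κ) ≃ (Fin N → Fin (m + n) → κ) :=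
  (Equiv.arrowProdEquivProdArrow (Fin N) (fun _ => Fin m → κ) (fun _ => Fin n → κ)).symm.trans
    (Equiv.arrowCongr (Equiv.refl _) (Fin.appendEquiv m n))

theorem appendCopiesEquiv_apply {m n : ℕ} (x : Fin N → Fin m → κ) (y : Fin N → Fin n → κ)
    (k : Fin N) : appendCopiesEquiv N m n κ (x, y) k = Fin.append (x k) (y k) := rfl

/-- The tensor product of two local vectors. -/
def appendVector {m n : ℕ} (a : EuclideanSpace ℂ (Fin m → κ)) (b : EuclideanSpace ℂ (Fin n → κ)) :
    EuclideanSpace ℂ (Fin (m + n) → κ) :=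
  WithLp.toLp 2 fun u => a (fun i => u (Fin.castAdd n i)) * b (fun i => u (Fin.natAdd m i))

theorem appendVector_append {m n : ℕ} (a : EuclideanSpace ℂ (Fin m → κ))
    (b : EuclideanSpace ℂ (Fin n → κ)) (x : Fin m → κ) (y : Fin n → κ) :
    appendVector a b (Fin.append x y) = a x * b y := by
  simp [appendVector]

theorem copies_append {m n : ℕ} (ρ : Matrix (Fin N → κ) (Fin N → κ) ℂ)
    (x x' : Fin N → Fin m → κ) (y y' : Fin N → Fin n → κ) :
    copies (m + n) ρ (appendCopiesEquiv N m n κ (x, y)) (appendCopiesEquiv N m n κ (x', y')) =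
      copies m ρ x x' * copies n ρ y y' := by
  simp only [copies, tensorState, of_apply, Fin.prod_univ_add, appendCopiesEquiv_apply,
    Fin.append_left, Fin.append_right]

variable [Fintype κ]

theorem norm_appendVector {m n : ℕ} (a : EuclideanSpace ℂ (Fin m → κ))
    (b : EuclideanSpace ℂ (Fin n → κ)) (ha : ‖a‖ = 1) (hb : ‖b‖ = 1) :
    ‖appendVector a b‖ = 1 := by
  have h : ‖appendVector a b‖ ^ 2 = ‖a‖ ^ 2 * ‖b‖ ^ 2 := by
    rw [EuclideanSpace.norm_sq_eq, EuclideanSpace.norm_sq_eq, EuclideanSpace.norm_sq_eq,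
      ← (Fin.appendEquiv m n).sum_comp, Fintype.sum_prod_type, Finset.sum_mul_sum]
    refine Finset.sum_congr rfl fun x _ => Finset.sum_congr rfl fun y _ => ?_
    rw [← mul_pow, ← norm_mul, ← appendVector_append]
    rfl
  rw [ha, hb, one_pow, one_mul] at h
  exact (pow_eq_one_iff_of_nonneg (norm_nonneg _) two_ne_zero).mp h

theorem dotProduct_copies_append {m n : ℕ} (ρ : Matrix (Fin N → κ) (Fin N → κ) ℂ)
    (a : Fin N → EuclideanSpace ℂ (Fin m → κ)) (b : Fin N → EuclideanSpace ℂ (Fin n → κ)) :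
    star (productVector fun k => appendVector (a k) (b k)).ofLp ⬝ᵥ
        (copies (m + n) ρ).mulVec (productVector fun k => appendVector (a k) (b k)).ofLp =
      (star (productVector a).ofLp ⬝ᵥ (copies m ρ).mulVec (productVector a).ofLp) *
        (star (productVector b).ofLp ⬝ᵥ (copies n ρ).mulVec (productVector b).ofLp) := by
  have hv : ∀ (x : Fin N → Fin m → κ) (y : Fin N → Fin n → κ),
      (productVector fun k => appendVector (a k) (b k)) (appendCopiesEquiv N m n κ (x, y)) =
        productVector a x * productVector b y := by
    intro x y
    simp only [productVector_apply, appendCopiesEquiv_apply, appendVector_append,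
      Finset.prod_mul_distrib]
  simp only [dotProduct, mulVec, Pi.star_apply]
  rw [← (appendCopiesEquiv N m n κ).sum_comp, Fintype.sum_prod_type, Finset.sum_mul_sum]
  refine Finset.sum_congr rfl fun x _ => Finset.sum_congr rfl fun y _ => ?_
  rw [← (appendCopiesEquiv N m n κ).sum_comp, Fintype.sum_prod_type, mul_mul_mul_comm,
    Finset.sum_mul_sum, hv, star_mul']
  congr 1
  refine Finset.sum_congr rfl fun x' _ => Finset.sum_congr rfl fun y' _ => ?_
  rw [copies_append, hv]
  ring

/-- The sesquilinear values multiply; positivity makes the first one real, so their real parts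
multiply as well. -/
theorem expectation_copies_append {m n : ℕ} {ρ : Matrix (Fin N → κ) (Fin N → κ) ℂ}
    (hρ : (copies m ρ).PosSemidef)
    (a : Fin N → EuclideanSpace ℂ (Fin m → κ)) (b : Fin N → EuclideanSpace ℂ (Fin n → κ)) :
    expectation (copies (m + n) ρ) (productVector fun k => appendVector (a k) (b k)) =
      expectation (copies m ρ) (productVector a) * expectation (copies n ρ) (productVector b) := by
  have h := (Complex.le_def.mp (hρ.dotProduct_mulVec_nonneg (productVector a).ofLp)).2
  rw [expectation, dotProduct_copies_append, Complex.mul_re, ← h, Complex.zero_im, zero_mul,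
    sub_zero]
  rfl

variable {d : ℕ}

theorem isState_copies (hd : N ≤ d) (n : ℕ) :
    IsState (copies n (antisymmetricProjectorState d N)) := by
  have ht : (0 : ℝ) < ∏ _j : Fin n, (d.choose N : ℝ) :=
    Finset.prod_pos fun j _ => by exact_mod_cast Nat.choose_pos hd
  rw [copies, tensorState_antisymmetricProjectorState]
  exact isState_inv_smul_projector (tensorAntisymmetrizer_isHermitian _)
    (tensorAntisymmetrizer_mul_self _) ht (trace_tensorAntisymmetrizer _)

theorem expectation_le_maxOverlapSq_copies (hd : N ≤ d) {n : ℕ}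
    {φ : EuclideanSpace ℂ (Fin N → Fin n → Fin d)} (hφ : φ ∈ productStates N (Fin n → Fin d)) :
    expectation (copies n (antisymmetricProjectorState d N)) φ ≤
      maxOverlapSq (copies n (antisymmetricProjectorState d N)) := by
  have ht : (0 : ℝ) < ∏ _j : Fin n, (d.choose N : ℝ) :=
    Finset.prod_pos fun j _ => by exact_mod_cast Nat.choose_pos hd
  have hb := bddAbove_trace_projectorState
    (tensorAntisymmetrizer_isHermitian (N := N) (Equiv.refl (Fin n → Fin d)))
    (tensorAntisymmetrizer_mul_self _) ht
  rw [← tensorState_antisymmetricProjectorState] at hb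
  rw [expectation_eq_trace_re]
  exact le_csSup hb ⟨_, vecMulVec_mem_separableStates hφ, rfl⟩

/-- The positivity assumption excludes an empty `SEP`, for which the supremum is `0` by convention
and `b` could be negative. -/
theorem maxOverlapSq_le_of_forall_productStates {ρ : Matrix (Fin N → κ) (Fin N → κ) ℂ} {b : ℝ}
    (h : ∀ φ ∈ productStates N κ, expectation ρ φ ≤ b) (hpos : 0 < maxOverlapSq ρ) :
    maxOverlapSq ρ ≤ b := by
  classical
  refine csSup_le ?_ ?_
  · by_contra hne
    rw [Set.not_nonempty_iff_eq_empty] at hne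
    rw [maxOverlapSq, hne, Real.sSup_empty] at hpos
    exact lt_irrefl _ hpos
  · rintro _ ⟨σ, hσ, rfl⟩
    exact trace_mul_re_le_of_mem_separableStates h hσ

theorem maxOverlapSq_copies_mul_le (hd : N ≤ d) (m n : ℕ) :
    maxOverlapSq (copies m (antisymmetricProjectorState d N)) *
        maxOverlapSq (copies n (antisymmetricProjectorState d N)) ≤
      maxOverlapSq (copies (m + n) (antisymmetricProjectorState d N)) := by
  have hm := (measures_copies hd m).1
  have hn := (measures_copies hd n).1
  have hmn := (measures_copies hd (m + n)).1
  have key : ∀ φ ∈ productStates N (Fin m → Fin d), ∀ χ ∈ productStates N (Fin n → Fin d),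
      expectation (copies m (antisymmetricProjectorState d N)) φ *
        expectation (copies n (antisymmetricProjectorState d N)) χ ≤
      maxOverlapSq (copies (m + n) (antisymmetricProjectorState d N)) := by
    rintro _ ⟨a, ha, rfl⟩ _ ⟨b, hb, rfl⟩
    rw [← expectation_copies_append (isState_copies hd m).1]
    exact expectation_le_maxOverlapSq_copies hd
      ⟨_, fun k => norm_appendVector _ _ (ha k) (hb k), rfl⟩
  -- Bounding the suprema one at a time, with the other factor divided out, avoids choosing
  -- maximizers.
  rw [← le_div_iff₀' hm]
  refine maxOverlapSq_le_of_forall_productStates (fun χ hχ => ?_) hn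
  rcases le_or_gt (expectation (copies n (antisymmetricProjectorState d N)) χ) 0 with h | h
  · exact h.trans (div_pos hmn hm).le
  · rw [le_div_iff₀' hm, ← le_div_iff₀ h]
    refine maxOverlapSq_le_of_forall_productStates (fun φ hφ => ?_) hm
    rw [le_div_iff₀ h]
    exact key φ hφ χ hχ

theorem geometricMeasure_eq_neg_logb {ρ : Matrix (Fin N → κ) (Fin N → κ) ℂ}
    (h : 0 < maxOverlapSq ρ) : geometricMeasure ρ = -Real.logb 2 (maxOverlapSq ρ) := by
  rw [geometricMeasure, Real.sqrt_eq_rpow, Real.logb_rpow_eq_mul_logb_of_pos h]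
  ring

theorem subadditive_geometricMeasure_copies (hd : N ≤ d) :
    Subadditive fun n => geometricMeasure (copies n (antisymmetricProjectorState d N)) := by
  intro m n
  have hm := (measures_copies hd m).1
  have hn := (measures_copies hd n).1
  have hmn := (measures_copies hd (m + n)).1
  have h := maxOverlapSq_copies_mul_le hd m n
  simp only [geometricMeasure_eq_neg_logb hm, geometricMeasure_eq_neg_logb hn,
    geometricMeasure_eq_neg_logb hmn]
  have h1 := Real.logb_le_logb_of_le one_lt_two (mul_pos hm hn) h
  rw [Real.logb_mul hm.ne' hn.ne'] at h1
  linarith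

-- Fekete's lemma for `G`, bounded below by `0` because `R_L ≥ 0`; the exact relation for every `n`
-- transfers the limit to the other two measures.
open Filter Topology in
theorem exists_tendsto_measures_copies (hd : N ≤ d) : ∃ g : ℝ,
    Tendsto (fun n : ℕ =>
      geometricMeasure (copies n (antisymmetricProjectorState d N)) / (n : ℝ)) atTop (𝓝 g) ∧
    Tendsto (fun n : ℕ =>
      logGlobalRobustness (copies n (antisymmetricProjectorState d N)) / (n : ℝ))
      atTop (𝓝 (g - Real.logb 2 (antisymmetricProjector d N).trace.re)) ∧
    Tendsto (fun n : ℕ =>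
      relativeEntropyOfEntanglement (copies n (antisymmetricProjectorState d N)) / (n : EReal))
      atTop (𝓝 ((g - Real.logb 2 (antisymmetricProjector d N).trace.re : ℝ) : EReal)) := by
  have hch : (1 : ℝ) ≤ d.choose N := by exact_mod_cast Nat.choose_pos hd
  have hlog : 0 ≤ Real.logb 2 (d.choose N) := Real.logb_nonneg one_lt_two hch
  have hsub := subadditive_geometricMeasure_copies hd
  have hbdd : BddBelow (Set.range fun n : ℕ =>
      geometricMeasure (copies n (antisymmetricProjectorState d N)) / (n : ℝ)) := by
    refine ⟨0, ?_⟩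
    rintro _ ⟨n, rfl⟩
    obtain ⟨-, -, h2, h3⟩ := measures_copies hd n
    have : 0 ≤ geometricMeasure (copies n (antisymmetricProjectorState d N)) := by
      have : 0 ≤ n * Real.logb 2 (d.choose N) := by positivity
      linarith
    exact div_nonneg this (Nat.cast_nonneg n)
  have hG := hsub.tendsto_lim hbdd
  have hR : Tendsto (fun n : ℕ =>
      logGlobalRobustness (copies n (antisymmetricProjectorState d N)) / (n : ℝ))
      atTop (𝓝 (hsub.lim - Real.logb 2 (antisymmetricProjector d N).trace.re)) := by
    refine (hG.sub_const _).congr' ?_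
    -- At `n = 0` the quotient of the trace term is `0` by convention, so the rewriting needs `n >
    -- 0`.
    filter_upwards [eventually_gt_atTop 0] with n hn
    have hn0 : (n : ℝ) ≠ 0 := by exact_mod_cast hn.ne'
    rw [(measures_copies hd n).2.2.1, trace_antisymmetricProjector, Complex.natCast_re, sub_div,
      mul_div_cancel_left₀ _ hn0]
  refine ⟨hsub.lim, hG, hR, ?_⟩
  refine ((continuous_coe_real_ereal.tendsto _).comp hR).congr fun n => ?_
  rw [(measures_copies hd n).2.1, Function.comp_apply, EReal.coe_div, EReal.coe_coe_eq_natCast]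

end Regularization

/-! ### Explicit values for one and two copies -/

section Values

variable {N d : ℕ}

theorem logGlobalRobustness_antisymmetricProjectorState (hd : N ≤ d) :
    logGlobalRobustness (antisymmetricProjectorState d N) = Real.logb 2 (N.factorial : ℝ) := by
  have hch : (0 : ℝ) < d.choose N := by exact_mod_cast Nat.choose_pos hd
  have hfac : (0 : ℝ) < N.factorial := by exact_mod_cast N.factorial_pos
  have hL := maxOverlapSq_antisymmetricProjectorState hd
  rw [(measures_antisymmetricProjectorState hd).2,
    geometricMeasure_eq_neg_logb (by rw [hL]; positivity), hL, ← mul_inv, Real.logb_inv, neg_neg,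
    Real.logb_mul hch.ne' hfac.ne', add_sub_cancel_left]

theorem logGlobalRobustness_copies_two (hd : N ≤ d) (hd0 : 0 < d) :
    logGlobalRobustness (copies 2 (antisymmetricProjectorState d N)) =
      Real.logb 2 ((d : ℝ) ^ N * (N.factorial : ℝ) * ((d - N).factorial : ℝ) /
        (d.factorial : ℝ)) := by
  have hch : (0 : ℝ) < d.choose N := by exact_mod_cast Nat.choose_pos hd
  have hpow : (0 : ℝ) < (d : ℝ) ^ N := by positivity
  have hL := maxOverlapSq_copies_two hd hd0
  have hval : ((d.choose N : ℝ)⁻¹) ^ 2 * (d.choose N / (d : ℝ) ^ N) =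
      (d.choose N * (d : ℝ) ^ N)⁻¹ := by
    field_simp
  have hquot : (d : ℝ) ^ N * (N.factorial : ℝ) * ((d - N).factorial : ℝ) / (d.factorial : ℝ) =
      (d : ℝ) ^ N / d.choose N := by
    rw [Nat.cast_choose ℝ hd]
    field_simp
  rw [hval] at hL
  rw [(measures_copies hd 2).2.2.1,
    geometricMeasure_eq_neg_logb (by rw [hL]; positivity), hL, Real.logb_inv, neg_neg,
    Real.logb_mul hch.ne' hpow.ne', hquot, Real.logb_div hpow.ne' hch.ne']
  push_cast
  ring

end Values

end Multipartite

end

open Multipartite Filter Topology in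
theorem mainTheorem5 (N d : ℕ) (hN : 1 ≤ N) (hd : N ≤ d) :
    -- tensor products of antisymmetric projector states
    (∀ (n : ℕ) (D : Fin n → ℕ), (∀ j, N ≤ D j) →
      relativeEntropyOfEntanglement
          (tensorState fun j => antisymmetricProjectorState (D j) N) =
        ((logGlobalRobustness
          (tensorState fun j => antisymmetricProjectorState (D j) N) : ℝ) : EReal) ∧
      logGlobalRobustness (tensorState fun j => antisymmetricProjectorState (D j) N) =
        geometricMeasure (tensorState fun j => antisymmetricProjectorState (D j) N) -
          ∑ j, Real.logb 2 (antisymmetricProjector (D j) N).trace.re) ∧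
    -- the regularized measures exist and satisfy the same relation
    (∃ g : ℝ,
      Tendsto (fun n : ℕ =>
        geometricMeasure (copies n (antisymmetricProjectorState d N)) / (n : ℝ))
        atTop (𝓝 g) ∧
      Tendsto (fun n : ℕ =>
        logGlobalRobustness (copies n (antisymmetricProjectorState d N)) / (n : ℝ))
        atTop (𝓝 (g - Real.logb 2 (antisymmetricProjector d N).trace.re)) ∧
      Tendsto (fun n : ℕ =>
        relativeEntropyOfEntanglement (copies n (antisymmetricProjectorState d N)) / (n : EReal))
        atTop (𝓝 ((g - Real.logb 2 (antisymmetricProjector d N).trace.re : ℝ) : EReal))) ∧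
    (antisymmetricProjector d N).trace = (d.choose N : ℂ) ∧
    -- one copy
    (relativeEntropyOfEntanglement (antisymmetricProjectorState d N) =
        ((logGlobalRobustness (antisymmetricProjectorState d N) : ℝ) : EReal) ∧
      logGlobalRobustness (antisymmetricProjectorState d N) =
        geometricMeasure (antisymmetricProjectorState d N) -
          Real.logb 2 (antisymmetricProjector d N).trace.re ∧
      logGlobalRobustness (antisymmetricProjectorState d N) =
        Real.logb 2 (N.factorial : ℝ)) ∧
    -- two copies
    (relativeEntropyOfEntanglement (copies 2 (antisymmetricProjectorState d N)) =
        ((logGlobalRobustness (copies 2 (antisymmetricProjectorState d N)) : ℝ) : EReal) ∧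
      logGlobalRobustness (copies 2 (antisymmetricProjectorState d N)) =
        geometricMeasure (copies 2 (antisymmetricProjectorState d N)) -
          2 * Real.logb 2 (antisymmetricProjector d N).trace.re ∧
      logGlobalRobustness (copies 2 (antisymmetricProjectorState d N)) =
        Real.logb 2 ((d : ℝ) ^ N * (N.factorial : ℝ) * ((d - N).factorial : ℝ) /
          (d.factorial : ℝ))) ∧
    -- closest product states of one copy
    (∀ φ : EuclideanSpace ℂ (Fin N → Fin d),
      IsClosestProductState (antisymmetricProjectorState d N) φ ↔
        ∃ a : Fin N → EuclideanSpace ℂ (Fin d), Orthonormal ℂ a ∧ φ = productVector a) ∧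
    -- closest product states of two copies
    (∀ ψ : EuclideanSpace ℂ (Fin 2 → Fin d), IsMaximallyEntangled ψ →
      IsClosestProductState (copies 2 (antisymmetricProjectorState d N))
        (productVector fun _ : Fin N => ψ)) ∧
    (3 ≤ N → ∀ φ : EuclideanSpace ℂ (Fin N → Fin 2 → Fin d),
      IsClosestProductState (copies 2 (antisymmetricProjectorState d N)) φ →
        ∃ ψ : EuclideanSpace ℂ (Fin 2 → Fin d), IsMaximallyEntangled ψ ∧
          φ = productVector fun _ : Fin N => ψ) := by
  have hd0 : 0 < d := by omega
  have htr : (antisymmetricProjector d N).trace.re = (d.choose N : ℝ) := by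
    rw [trace_antisymmetricProjector, Complex.natCast_re]
  refine ⟨fun n D hD => measures_tensorState D hD, exists_tendsto_measures_copies hd,
    trace_antisymmetricProjector d N, ?_, ?_,
    isClosestProductState_antisymmetricProjectorState_iff hd,
    fun ψ hψ => isClosestProductState_copies_two hd hd0 hψ,
    fun hN3 φ hφ => eq_productVector_of_isClosestProductState_copies_two hN3 hd hφ⟩
  · rw [htr]
    exact ⟨(measures_antisymmetricProjectorState hd).1, (measures_antisymmetricProjectorState hd).2,
      logGlobalRobustness_antisymmetricProjectorState hd⟩
  · rw [htr]
    refine ⟨(measures_copies hd 2).2.1, ?_, logGlobalRobustness_copies_two hd hd0⟩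
    exact_mod_cast (measures_copies hd 2).2.2.1
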